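/- Let $M$ be a compact complex manifold of dimension $n\ge 2$ and let $F:T^{1,0}M\to[0,\infty)$ be a strongly pseudoconvex complex Finsler metric: $F$ is continuous, $G=F^2$ is smooth on the slit bundle $\tilde M=T^{1,0}M\setminus\{0\}$, $F>0$ on $\tilde M$, $F(z,\zeta v)=|\zeta|F(z,v)$ for $\zeta\in\mathbb C$, and $(G_{\alpha\bar\beta})=(\partial^2G/\partial v^\alpha\partial\bar v^\beta)$ is positive definite on $\tilde M$. Notation. Let $(z,v)$ be local holomorphic coordinates on $T^{1,0}M$, $\partial_\mu=\partial/\partial z^\mu$, $\dot\partial_\alpha=\partial/\partial v^\alpha$, $(G^{\bar\beta\alpha})=(G_{\alpha\bar\beta})^{-1}$; repeated indices are summed. Put $\Gamma^\alpha_{;\mu}=G^{\bar\lambda\alpha}\,\partial^2G/\partial\bar v^\lambda\partial z^\mu$, $\ \delta_\mu=\partial_\mu-\Gamma^\alpha_{;\mu}\dot\partial_\alpha$, $\ \delta v^\alpha=dv^\alpha+\Gamma^\alpha_{;\beta}dz^\beta$, $\ \delta_{\bar\mu}=\overline{\delta_\mu}$. On the horizontal bundle $\mathcal H=\mathrm{span}\{\delta_\alpha\}$,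 with $\langle\delta_\alpha,\delta_\beta\rangle=G_{\alpha\bar\beta}$, the Chern–Finsler connection $D$ has connection forms $\theta^\alpha_\beta=G^{\bar\lambda\alpha}\partial G_{\beta\bar\lambda}$, and the canonical connection $\nabla$ has connection forms $\omega^\alpha_\beta=L^\alpha_{\beta\mu}dz^\mu+L^\alpha_{\beta\bar\mu}d\bar z^\mu+C^\alpha_{\beta\mu}\delta v^\mu$ with $$L^\alpha_{\beta\mu}=\tfrac12G^{\bar\lambda\alpha}(\delta_\mu G_{\beta\bar\lambda}+\delta_\beta G_{\mu\bar\lambda}),\quad L^\alpha_{\beta\bar\mu}=\tfrac12G^{\bar\lambda\alpha}(\delta_{\bar\mu}G_{\beta\bar\lambda}-\delta_{\bar\lambda}G_{\beta\bar\mu}),\quad C^\alpha_{\beta\mu}=G^{\bar\lambda\alpha}\dot\partial_\mu G_{\beta\bar\lambda}.$$ Let $\Omega_{\alpha\bar\beta;\mu\bar\nu}$ and $R_{\alpha\bar\beta\mu\bar\nu}$ be the tensors $\langle(\nabla'_{\delta_\mu}\nabla'_{\delta_{\bar\nu}}-\nabla'_{\delta_{\bar\nu}}\nabla'_{\delta_\mu}-\nabla'_{[\delta_\mu,\delta_{\bar\nu}]})\delta_\alpha,\delta_\beta\rangle$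 for $\nabla'=D$ and $\nabla'=\nabla$ respectively, $\Omega_{\mu\bar\nu}=G^{\bar\beta\alpha}\Omega_{\alpha\bar\beta;\mu\bar\nu}$, $R_{\mu\bar\nu}=G^{\bar\beta\alpha}R_{\alpha\bar\beta\mu\bar\nu}$, and $$\mathbf{Ric}_D=\sqrt{-1}\,\Omega_{\mu\bar\nu}dz^\mu\wedge d\bar z^\nu,\quad \mathbf{Ric}_\nabla=\sqrt{-1}\,R_{\mu\bar\nu}dz^\mu\wedge d\bar z^\nu,\quad s_D=G^{\bar\nu\mu}\Omega_{\mu\bar\nu},\quad s_\nabla=G^{\bar\nu\mu}R_{\mu\bar\nu}.$$ On the projectivized tangent bundle $\mathbb P\tilde M=\tilde M/(\mathbb C\setminus\{0\})$ let $\omega_{\mathcal H}=\sqrt{-1}G_{\alpha\bar\beta}dz^\alpha\wedge d\bar z^\beta$, $\omega_{\mathcal V}=\sqrt{-1}(\log G)_{\alpha\bar\beta}\delta v^\alpha\wedge\delta\bar v^\beta$, where $(\log G)_{\alpha\bar\beta}=\partial^2\log G/\partial v^\alpha\partial\bar v^\beta$, and $d\mu=\frac{\omega_{\mathcal V}^{n-1}}{(n-1)!}\wedge\frac{\omega_{\mathcal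 H}^n}{n!}$. A horizontal $(p,q)$-form on $\mathbb P\tilde M$ is a form in $dz^\alpha,d\bar z^\beta$ whose coefficients are smooth and homogeneous of degree $0$ in $v$. Put $\langle\varphi,\psi\rangle=\varphi_\alpha G^{\bar\gamma\alpha}\overline{\psi_\gamma}$, $\ \varphi_{\bar\beta}G^{\bar\beta\delta}\overline{\psi_{\bar\delta}}$, $\ \varphi_{\alpha\bar\beta}G^{\bar\gamma\alpha}G^{\bar\beta\delta}\overline{\psi_{\gamma\bar\delta}}$ for horizontal forms of type $(1,0)$, $(0,1)$, $(1,1)$, and $(\varphi,\psi)=\int_{\mathbb P\tilde M}\langle\varphi,\psi\rangle\,d\mu$. Put $\partial_{\mathcal H}\varphi=\delta_\alpha(\varphi_{\bar\beta})dz^\alpha\wedge d\bar z^\beta$ for $\varphi=\varphi_{\bar\beta}d\bar z^\beta$ and $\bar\partial_{\mathcal H}\varphi=-\delta_{\bar\beta}(\varphi_\alpha)dz^\alpha\wedge d\bar z^\beta$ for $\varphi=\varphi_\alpha dz^\alpha$; $\partial_{\mathcal H}^*$ and $\bar\partial_{\mathcal H}^*$ are the formal adjoints with respect to $(\cdot,\cdot)$.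 The metric $F$ is balanced if $\partial_{\mathcal H}^*\omega_{\mathcal H}+\bar\partial_{\mathcal H}^*\omega_{\mathcal H}=0$. Theorem. The horizontal forms $\partial_{\mathcal H}^*\omega_{\mathcal H}$ and $\bar\partial_{\mathcal H}^*\omega_{\mathcal H}$ exist and are unique, and $$\mathbf{Ric}_D-\mathbf{Ric}_\nabla=\tfrac12\left(\partial_{\mathcal H}\partial_{\mathcal H}^*\omega_{\mathcal H}+\bar\partial_{\mathcal H}\bar\partial_{\mathcal H}^*\omega_{\mathcal H}\right),$$ $$s_D-s_\nabla=\tfrac12\left\langle\partial_{\mathcal H}\partial_{\mathcal H}^*\omega_{\mathcal H}+\bar\partial_{\mathcal H}\bar\partial_{\mathcal H}^*\omega_{\mathcal H},\ \omega_{\mathcal H}\right\rangle .$$ The functions $s_D$ and $s_\nabla$ are integrable over $\mathbb P\tilde M$, and the following three statements are equivalent: (a) $F$ is balanced; (b) $\mathbf{Ric}_D=\mathbf{Ric}_\nabla$; (c) $\int_{\mathbb P\tilde M}s_D\,d\mu=\int_{\mathbb P\tilde M}s_\nabla\,d\mu$. -/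

import Mathlib

open scoped Manifold ContDiff ComplexOrder LinearAlgebra.Projectivization
open MeasureTheory

noncomputable section

namespace ComplexFinsler

/-! ### Local calculus on `ℂⁿ × ℂⁿ` with coordinates `(z, v)` -/

/-- The model space `ℂⁿ`. -/
abbrev Cn (n : ℕ) : Type := Fin n → ℂ

/-- Local coordinates `(z, v)` of the holomorphic tangent bundle. -/
abbrev Pn (n : ℕ) : Type := Cn n × Cn n

/-- The coordinate vector `e_α` of `ℂⁿ`. -/
def unit {n : ℕ} (α : Fin n) : Cn n := Pi.single α 1

/-- The vector of `ℂⁿ` with `i`-th coordinate `1` and the other coordinates given by `w`. -/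
def affVec {n : ℕ} (i : Fin n) (w : {α : Fin n // α ≠ i} → ℂ) : Cn n :=
  fun α => if h : α = i then 1 else w ⟨α, h⟩

theorem affVec_ne_zero {n : ℕ} (i : Fin n) (w : {α : Fin n // α ≠ i} → ℂ) : affVec i w ≠ 0 := by
  intro h
  have := congrFun h i
  simp [affVec] at this

/-- `∂f_p(u) = ∑ⱼ uʲ ∂f/∂xʲ`, the Wirtinger derivative of type `(1,0)`; `ℂ`-linear in `u`. -/
def dHol {n : ℕ} (f : Pn n → ℂ) (p u : Pn n) : ℂ :=
  (1 / 2) * (fderiv ℝ f p u - Complex.I * fderiv ℝ f p (Complex.I • u))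

/-- `∂̄f_p(u) = ∑ⱼ conj(uʲ) ∂f/∂x̄ʲ`, the Wirtinger derivative of type `(0,1)`; conjugate-linear
in `u`. -/
def dAnti {n : ℕ} (f : Pn n → ℂ) (p u : Pn n) : ℂ :=
  (1 / 2) * (fderiv ℝ f p u + Complex.I * fderiv ℝ f p (Complex.I • u))

/-- The matrix of mixed vertical derivatives `f_{αβ̄} = ∂²f / ∂v^α ∂v̄^β` of a real function. -/
def levi {n : ℕ} (f : Pn n → ℝ) (p : Pn n) : Matrix (Fin n) (Fin n) ℂ :=
  Matrix.of fun α β =>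
    dHol (fun q => dAnti (fun r => (f r : ℂ)) q (0, unit β)) p (0, unit α)

/-- The inverse `G^{β̄α}` of the matrix `G_{αβ̄}`: `∑_β G_{γβ̄} G^{β̄α} = δ_γ^α`. -/
def gInv {n : ℕ} (g : Pn n → ℝ) (p : Pn n) (β α : Fin n) : ℂ := (levi g p)⁻¹ β α

/-- The Chern–Finsler nonlinear connection coefficients
`Γ^α_{;μ} = G^{λ̄α} G_{λ̄;μ}`, where `G_{λ̄;μ} = ∂²G / ∂v̄^λ ∂z^μ`. -/
def nonlin {n : ℕ} (g : Pn n → ℝ) (α μ : Fin n) (p : Pn n) : ℂ :=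
  ∑ l, gInv g p l α *
    dHol (fun q => dAnti (fun r => (g r : ℂ)) q (0, unit l)) p (unit μ, 0)

/-- A complexified tangent vector of `ℂⁿ × ℂⁿ`: the pair of its coefficients with respect to
`∂/∂z^μ, ∂/∂v^α` (type `(1,0)`) and with respect to `∂/∂z̄^μ, ∂/∂v̄^α` (type `(0,1)`). -/
abbrev CVec (n : ℕ) : Type := Pn n × Pn n

/-- Complex vector fields on `ℂⁿ × ℂⁿ`. -/
abbrev CField (n : ℕ) : Type := Pn n → CVec n

/-- The derivative `X f` of a function along a complex vector field. -/
def act {n : ℕ} (X : CField n) (f : Pn n → ℂ) (p : Pn n) : ℂ :=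
  dHol f p (X p).1 + dAnti f p (star (X p).2)

/-- The Lie bracket `[X, Y]` of complex vector fields. -/
def bracket {n : ℕ} (X Y : CField n) : CField n := fun p =>
  ((fun μ => act X (fun q => (Y q).1.1 μ) p - act Y (fun q => (X q).1.1 μ) p,
    fun α => act X (fun q => (Y q).1.2 α) p - act Y (fun q => (X q).1.2 α) p),
   (fun μ => act X (fun q => (Y q).2.1 μ) p - act Y (fun q => (X q).2.1 μ) p,
    fun α => act X (fun q => (Y q).2.2 α) p - act Y (fun q => (X q).2.2 α) p))

/-- The horizontal frame `δ_μ = ∂/∂z^μ - Γ^α_{;μ} ∂/∂v^α`. -/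
def hor {n : ℕ} (g : Pn n → ℝ) (μ : Fin n) : CField n := fun p =>
  ((unit μ, fun α => -nonlin g α μ p), 0)

/-- The conjugate horizontal frame `δ_ν̄`. -/
def horBar {n : ℕ} (g : Pn n → ℝ) (ν : Fin n) : CField n := fun p =>
  (0, (unit ν, fun α => -star (nonlin g α ν p)))

/-- The vertical frame `∂/∂v^γ`. -/
def vert {n : ℕ} (γ : Fin n) : CField n := fun _ => ((0, unit γ), 0)

/-- `G_{αβ̄}` as a function of `(z, v)`. -/
def gCoef {n : ℕ} (g : Pn n → ℝ) (α β : Fin n) (p : Pn n) : ℂ := levi g p α β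

/-- The form `δv^σ = dv^σ + Γ^σ_{;β} dz^β`. -/
def deltaV {n : ℕ} (g : Pn n → ℝ) (p : Pn n) (X : CVec n) (σ : Fin n) : ℂ :=
  X.1.2 σ + ∑ β, nonlin g σ β p * X.1.1 β

/-! ### Linear connections on the horizontal bundle and their curvature -/

/-- Connection forms `ω^α_β` with respect to the frame `δ_α`; the arguments are the point, the
vector, the upper index `α` and the lower index `β`. -/
abbrev ConnForm (n : ℕ) : Type := Pn n → CVec n → Fin n → Fin n → ℂ

/-- The connection forms `θ^α_β = G^{λ̄α} ∂G_{βλ̄}` of the Chern–Finsler connection `D`. -/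
def chernFinsler {n : ℕ} (g : Pn n → ℝ) : ConnForm n := fun p X α β =>
  ∑ l, gInv g p l α * dHol (gCoef g β l) p X.1

/-- `L^α_{βμ} = ½ G^{λ̄α} (δ_μ G_{βλ̄} + δ_β G_{μλ̄})`. -/
def coefL {n : ℕ} (g : Pn n → ℝ) (α β μ : Fin n) (p : Pn n) : ℂ :=
  (1 / 2) * ∑ l, gInv g p l α *
    (act (hor g μ) (gCoef g β l) p + act (hor g β) (gCoef g μ l) p)

/-- `L^α_{βμ̄} = ½ G^{λ̄α} (δ_μ̄ G_{βλ̄} - δ_λ̄ G_{βμ̄})`. -/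
def coefLBar {n : ℕ} (g : Pn n → ℝ) (α β μ : Fin n) (p : Pn n) : ℂ :=
  (1 / 2) * ∑ l, gInv g p l α *
    (act (horBar g μ) (gCoef g β l) p - act (horBar g l) (gCoef g β μ) p)

/-- `C^α_{βγ} = G^{λ̄α} ∂G_{βλ̄}/∂v^γ`. -/
def coefC {n : ℕ} (g : Pn n → ℝ) (α β γ : Fin n) (p : Pn n) : ℂ :=
  ∑ l, gInv g p l α * act (vert γ) (gCoef g β l) p

/-- The connection forms `ω^α_β = L^α_{βμ} dz^μ + L^α_{βμ̄} dz̄^μ + C^α_{βγ} δv^γ` of the canonical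
connection `∇`. -/
def canonical {n : ℕ} (g : Pn n → ℝ) : ConnForm n := fun p X α β =>
  (∑ μ, coefL g α β μ p * X.1.1 μ) + (∑ μ, coefLBar g α β μ p * X.2.1 μ)
    + ∑ γ, coefC g α β γ p * deltaV g p X γ

/-- The covariant derivative `∇_X s` of the horizontal field `s = s^α δ_α`. -/
def cov {n : ℕ} (A : ConnForm n) (X : CField n) (s : Pn n → Cn n) : Pn n → Cn n := fun p α =>
  act X (fun q => s q α) p + ∑ β, A p (X p) α β * s p β

/-- The curvature operator `∇_X ∇_Y s - ∇_Y ∇_X s - ∇_{[X,Y]} s`. -/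
def curv {n : ℕ} (A : ConnForm n) (X Y : CField n) (s : Pn n → Cn n) : Pn n → Cn n := fun p =>
  cov A X (cov A Y s) p - cov A Y (cov A X s) p - cov A (bracket X Y) s p

/-- The holomorphic sectional curvature tensor
`⟨(∇_{δ_μ} ∇_{δ_ν̄} - ∇_{δ_ν̄} ∇_{δ_μ} - ∇_{[δ_μ, δ_ν̄]}) δ_α, δ_β⟩`. -/
def curvTensor {n : ℕ} (g : Pn n → ℝ) (A : ConnForm n) (α β μ ν : Fin n) (p : Pn n) : ℂ :=
  ∑ γ, curv A (hor g μ) (horBar g ν) (fun _ => unit α) p γ * gCoef g γ β p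

/-- The contraction `G^{β̄α} R_{αβ̄μν̄}` of the curvature tensor. -/
def ricciCoef {n : ℕ} (g : Pn n → ℝ) (A : ConnForm n) (μ ν : Fin n) (p : Pn n) : ℂ :=
  ∑ α, ∑ β, gInv g p β α * curvTensor g A α β μ ν p

/-- The contraction `G^{ν̄μ} R_{μν̄}` of the Ricci curvature. -/
def scalarCoef {n : ℕ} (g : Pn n → ℝ) (A : ConnForm n) (p : Pn n) : ℂ :=
  ∑ μ, ∑ ν, gInv g p ν μ * ricciCoef g A μ ν p

/-! ### Complex Finsler metrics -/

section Manifold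

variable {n : ℕ} {M : Type*} [TopologicalSpace M] [ChartedSpace (Cn n) M]
  [IsManifold 𝓘(ℂ, Cn n) ω M]

/-- The tangent vector `v^α ∂/∂z^α` at the point with coordinates `z` in the chart `e`. -/
def vec (e : OpenPartialHomeomorph M (Cn n)) (z v : Cn n) :
    TangentSpace 𝓘(ℂ, Cn n) (e.symm z) :=
  mfderiv 𝓘(ℂ, Cn n) 𝓘(ℂ, Cn n) e.symm z v

/-- The expression `G(z, v) = F(v^α ∂/∂z^α)²` in the chart `e`. -/
def gLoc (F : TangentBundle 𝓘(ℂ, Cn n) M → ℝ) (e : OpenPartialHomeomorph M (Cn n)) :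
    Pn n → ℝ :=
  fun q => (F ⟨e.symm q.1, vec e q.1 q.2⟩) ^ 2

variable (n M) in
/-- Strongly pseudoconvex complex Finsler metrics on the complex manifold `M`. -/
structure FinslerMetric where
  toFun : TangentBundle 𝓘(ℂ, Cn n) M → ℝ
  continuous : Continuous toFun
  nonneg : ∀ p, 0 ≤ toFun p
  smooth : ∀ e ∈ atlas (Cn n) M, ContDiffOn ℝ ∞ (gLoc toFun e) (e.target ×ˢ {0}ᶜ)
  pos : ∀ (x : M) (v : TangentSpace 𝓘(ℂ, Cn n) x), v ≠ 0 → 0 < toFun ⟨x, v⟩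
  homogeneous : ∀ (x : M) (v : TangentSpace 𝓘(ℂ, Cn n) x) (ζ : ℂ),
    toFun ⟨x, ζ • v⟩ = ‖ζ‖ * toFun ⟨x, v⟩
  pseudoconvex : ∀ e ∈ atlas (Cn n) M, ∀ z ∈ e.target, ∀ v ≠ 0,
    (levi (gLoc toFun e) (z, v)).PosDef

/-- The function `G` in the chart `e`. -/
abbrev FinslerMetric.loc (F : FinslerMetric n M) (e : OpenPartialHomeomorph M (Cn n)) :
    Pn n → ℝ := gLoc F.toFun e

/-! ### The projectivized tangent bundle and its volume -/

variable (n M) in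
/-- The slit holomorphic tangent bundle. -/
abbrev Slit : Type _ := {p : TangentBundle 𝓘(ℂ, Cn n) M // p.2 ≠ 0}

variable (n M) in
/-- The projectivized tangent bundle: points of `M` with a complex line in the tangent space. -/
@[ext]
structure PTM where
  base : M
  line : ℙ ℂ (TangentSpace 𝓘(ℂ, Cn n) base)

/-- The projection from the slit tangent bundle. -/
def toPTM (p : Slit n M) : PTM n M := ⟨p.1.1, Projectivization.mk ℂ p.1.2 p.2⟩

/-- The quotient topology. -/
instance : TopologicalSpace (PTM n M) := TopologicalSpace.coinduced toPTM inferInstance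

instance : MeasurableSpace (PTM n M) := borel _

instance : BorelSpace (PTM n M) := ⟨rfl⟩

/-- The point `[v^α ∂/∂z^α]` over the point with coordinates `z`, if `v^α ∂/∂z^α` is nonzero;
for `z` in the target of a chart `e` of the atlas this only means `v ≠ 0`. -/
def linePoint (e : OpenPartialHomeomorph M (Cn n)) (z v : Cn n) (h : vec e z v ≠ 0) : PTM n M :=
  ⟨e.symm z, Projectivization.mk ℂ (vec e z v) h⟩

open Classical in
/-- The inverse of the coordinate chart `(z, w)` of the projectivized tangent bundle, where `z` are
the coordinates of the chart `e` and `w` the affine coordinates `w^a = v^a / v^i` on `{v^i ≠ 0}`.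
Only its values at `z ∈ e.target` are used. -/
def affParam (e : OpenPartialHomeomorph M (Cn n)) (i : Fin n)
    (q : Cn n × ({α : Fin n // α ≠ i} → ℂ)) : PTM n M :=
  if h : vec e q.1 (affVec i q.2) ≠ 0 then linePoint e q.1 (affVec i q.2) h
  else ⟨e.symm q.1, Projectivization.mk ℂ
    (show TangentSpace 𝓘(ℂ, Cn n) (e.symm q.1) from affVec i q.2) (affVec_ne_zero i q.2)⟩

/-- The coefficient of the volume form `ω_V^{n-1}/(n-1)! ∧ ω_H^n/n!` with respect to the Lebesgue
measure in the coordinates `(z, w)`. Here `ω_H = i G_{αβ̄} dz^α ∧ dz̄^β` and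
`ω_V = i (log G)_{αβ̄} δv^α ∧ δv̄^β`, so that, at `v = (1, w)`, the form equals
`det((log G)_{ab̄})_{a,b ≠ i} · det(G_{αβ̄}) · ∏_{a ≠ i} (i dw^a ∧ dw̄^a) ∧ ∏_α (i dz^α ∧ dz̄^α)`,
and `i dz ∧ dz̄ = 2 dx ∧ dy`. -/
def volDensity (F : FinslerMetric n M) (e : OpenPartialHomeomorph M (Cn n)) (i : Fin n)
    (q : Cn n × ({α : Fin n // α ≠ i} → ℂ)) : ℝ :=
  2 ^ Fintype.card {α : Fin n // α ≠ i} * 2 ^ n *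
    (((levi (fun r => Real.log (F.loc e r)) (q.1, affVec i q.2)).submatrix
        (fun a : {α : Fin n // α ≠ i} => a.1) (fun b : {α : Fin n // α ≠ i} => b.1)).det *
      (levi (F.loc e) (q.1, affVec i q.2)).det).re

/-- The volume measure in one coordinate domain, extended by zero. -/
def chartVol (F : FinslerMetric n M) (e : OpenPartialHomeomorph M (Cn n)) (i : Fin n) :
    Measure (PTM n M) :=
  ((volume.restrict (e.target ×ˢ Set.univ)).withDensity
    (fun q => ENNReal.ofReal (volDensity F e i q))).map (affParam e i)

/-- The invariant volume measure `dμ` of the projectivized tangent bundle. The measures in the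
coordinate domains agree on overlaps and `dμ` is the measure that they define together; being
restrictions of `dμ` to sets that cover, they have `dμ` as their least upper bound. -/
def volPTM (F : FinslerMetric n M) : Measure (PTM n M) :=
  ⨆ e ∈ atlas (Cn n) M, ⨆ i : Fin n, chartVol F e i

/-! ### Coordinates at a point -/

/-- The differential at `x` of the preferred chart at `x`: the components `X^α = dz^α(X)` of a
tangent vector. -/
def comp (x : M) : TangentSpace 𝓘(ℂ, Cn n) x →L[ℂ] Cn n :=
  mfderiv 𝓘(ℂ, Cn n) 𝓘(ℂ, Cn n) (chartAt (Cn n) x) x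

/-- The coordinate vector `∂/∂z^α` at `x` in the preferred chart at `x`. -/
def frame (x : M) (α : Fin n) : TangentSpace 𝓘(ℂ, Cn n) x := (comp x).inverse (unit α)

/-- The coordinates `(z, v)`, in the preferred chart at the base point, of a vector spanning the
line `p`. -/
def coord (p : PTM n M) : Pn n := (chartAt (Cn n) p.base p.base, comp p.base p.line.rep)

/-- The function `G` in the preferred chart at the base point of `p`. -/
def FinslerMetric.locAt (F : FinslerMetric n M) (p : PTM n M) : Pn n → ℝ :=
  F.loc (chartAt (Cn n) p.base)

/-- `G^{β̄α}` at `p`, in the preferred chart. -/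
def gInvAt (F : FinslerMetric n M) (p : PTM n M) (β α : Fin n) : ℂ :=
  gInv (F.locAt p) (coord p) β α

/-! ### Horizontal forms on the projectivized tangent bundle

A horizontal form of type `(1,0)`, `(0,1)` or `(1,1)` assigns to every point `p` a `ℂ`-linear,
conjugate-linear or sesquilinear form on the tangent space of `M` at the base point:
`φ_α dz^α`, `φ_β̄ dz̄^β` and `φ_{αβ̄} dz^α ∧ dz̄^β` are
`X ↦ φ_α X^α`, `Y ↦ φ_β̄ conj(Y^β)` and `(X, Y) ↦ φ_{αβ̄} X^α conj(Y^β)`. -/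

variable (n M) in
/-- Not necessarily smooth horizontal `(1,0)`-forms. -/
abbrev Raw10 : Type _ := ∀ p : PTM n M, TangentSpace 𝓘(ℂ, Cn n) p.base →ₗ[ℂ] ℂ

variable (n M) in
/-- Not necessarily smooth horizontal `(0,1)`-forms. -/
abbrev Raw01 : Type _ := ∀ p : PTM n M, TangentSpace 𝓘(ℂ, Cn n) p.base →ₗ⋆[ℂ] ℂ

variable (n M) in
/-- Not necessarily smooth horizontal `(1,1)`-forms. -/
abbrev Raw11 : Type _ := ∀ p : PTM n M,
  TangentSpace 𝓘(ℂ, Cn n) p.base →ₗ[ℂ] TangentSpace 𝓘(ℂ, Cn n) p.base →ₗ⋆[ℂ] ℂ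

open Classical in
/-- The coefficient `φ_α(z, v)` in the chart `e`. -/
def coef10 (φ : Raw10 n M) (e : OpenPartialHomeomorph M (Cn n)) (α : Fin n) (q : Pn n) : ℂ :=
  if h : vec e q.1 q.2 ≠ 0 then φ (linePoint e q.1 q.2 h) (vec e q.1 (unit α)) else 0

open Classical in
/-- The coefficient `φ_β̄(z, v)` in the chart `e`. -/
def coef01 (φ : Raw01 n M) (e : OpenPartialHomeomorph M (Cn n)) (β : Fin n) (q : Pn n) : ℂ :=
  if h : vec e q.1 q.2 ≠ 0 then φ (linePoint e q.1 q.2 h) (vec e q.1 (unit β)) else 0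

variable (n M) in
/-- The space of smooth horizontal `(1,0)`-forms. -/
@[ext]
structure Form10 where
  toRaw : Raw10 n M
  smooth : ∀ e ∈ atlas (Cn n) M, ∀ α, ContDiffOn ℝ ∞ (coef10 toRaw e α) (e.target ×ˢ {0}ᶜ)

variable (n M) in
/-- The space of smooth horizontal `(0,1)`-forms. -/
@[ext]
structure Form01 where
  toRaw : Raw01 n M
  smooth : ∀ e ∈ atlas (Cn n) M, ∀ β, ContDiffOn ℝ ∞ (coef01 toRaw e β) (e.target ×ˢ {0}ᶜ)

instance : Inhabited (Form10 n M) :=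
  ⟨⟨0, fun e _ α => by
    have : coef10 (0 : Raw10 n M) e α = fun _ => 0 := by
      funext q; unfold coef10; split_ifs <;> rfl
    rw [this]; exact contDiffOn_const⟩⟩

instance : Inhabited (Form01 n M) :=
  ⟨⟨0, fun e _ α => by
    have : coef01 (0 : Raw01 n M) e α = fun _ => 0 := by
      funext q; unfold coef01; split_ifs <;> rfl
    rw [this]; exact contDiffOn_const⟩⟩

/-- The form `c_{αβ̄} dz^α ∧ dz̄^β` at one point. -/
def sesq (x : M) (c : Fin n → Fin n → ℂ) :
    TangentSpace 𝓘(ℂ, Cn n) x →ₗ[ℂ] TangentSpace 𝓘(ℂ, Cn n) x →ₗ⋆[ℂ] ℂ :=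
  LinearMap.mk₂'ₛₗ (RingHom.id ℂ) (starRingEnd ℂ)
    (fun X Y => ∑ α, ∑ β, c α β * comp x X α * star (comp x Y β))
    (fun X X' Y => by simp [mul_add, add_mul, Finset.sum_add_distrib])
    (fun a X Y => by
      simp only [map_smul, Pi.smul_apply, smul_eq_mul, RingHom.id_apply, Finset.mul_sum]
      exact Finset.sum_congr rfl fun _ _ => Finset.sum_congr rfl fun _ _ => by ring)
    (fun X Y Y' => by simp [mul_add, Finset.sum_add_distrib])
    (fun a X Y => by
      simp only [map_smul, Pi.smul_apply, smul_eq_mul, Finset.mul_sum, star_mul']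
      exact Finset.sum_congr rfl fun _ _ => Finset.sum_congr rfl fun _ _ => by
        simp only [starRingEnd_apply]; ring)

/-- The horizontal fundamental form `ω_H = i G_{αβ̄} dz^α ∧ dz̄^β`. -/
def omegaH (F : FinslerMetric n M) : Raw11 n M := fun p =>
  sesq p.base fun α β => Complex.I * gCoef (F.locAt p) α β (coord p)

/-- `∂_H φ = δ_α(φ_β̄) dz^α ∧ dz̄^β` for a horizontal `(0,1)`-form. -/
def delH (F : FinslerMetric n M) (φ : Form01 n M) : Raw11 n M := fun p =>
  sesq p.base fun α β =>
    act (hor (F.locAt p) α) (coef01 φ.toRaw (chartAt (Cn n) p.base) β) (coord p)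

/-- `∂̄_H φ = -δ_β̄(φ_α) dz^α ∧ dz̄^β` for a horizontal `(1,0)`-form. -/
def delbarH (F : FinslerMetric n M) (φ : Form10 n M) : Raw11 n M := fun p =>
  sesq p.base fun α β =>
    -act (horBar (F.locAt p) β) (coef10 φ.toRaw (chartAt (Cn n) p.base) α) (coord p)

/-! ### Inner products and formal adjoints -/

/-- `⟨φ, ψ⟩ = φ_α G^{γ̄α} conj(ψ_γ)`. -/
def inner10 (F : FinslerMetric n M) (φ ψ : Raw10 n M) (p : PTM n M) : ℂ :=
  ∑ α, ∑ γ, φ p (frame p.base α) * gInvAt F p γ α * star (ψ p (frame p.base γ))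

/-- `⟨φ, ψ⟩ = φ_β̄ G^{β̄δ} conj(ψ_δ̄)`. -/
def inner01 (F : FinslerMetric n M) (φ ψ : Raw01 n M) (p : PTM n M) : ℂ :=
  ∑ β, ∑ δ, φ p (frame p.base β) * gInvAt F p β δ * star (ψ p (frame p.base δ))

/-- `⟨φ, ψ⟩ = φ_{αβ̄} G^{γ̄α} G^{β̄δ} conj(ψ_{γδ̄})`. -/
def inner11 (F : FinslerMetric n M) (φ ψ : Raw11 n M) (p : PTM n M) : ℂ :=
  ∑ α, ∑ β, ∑ γ, ∑ δ, φ p (frame p.base α) (frame p.base β) *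
    gInvAt F p γ α * gInvAt F p β δ * star (ψ p (frame p.base γ) (frame p.base δ))

/-- `φ = ∂_H^* η` for the `L²` inner products over the projectivized tangent bundle. -/
def IsDelAdjoint (F : FinslerMetric n M) (η : Raw11 n M) (φ : Form01 n M) : Prop :=
  ∀ ψ : Form01 n M,
    ∫ p, inner11 F (delH F ψ) η p ∂(volPTM F) = ∫ p, inner01 F ψ.toRaw φ.toRaw p ∂(volPTM F)

/-- `φ = ∂̄_H^* η` for the `L²` inner products over the projectivized tangent bundle. -/
def IsDelbarAdjoint (F : FinslerMetric n M) (η : Raw11 n M) (φ : Form10 n M) : Prop :=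
  ∀ ψ : Form10 n M,
    ∫ p, inner11 F (delbarH F ψ) η p ∂(volPTM F) = ∫ p, inner10 F ψ.toRaw φ.toRaw p ∂(volPTM F)

/-- `∂_H^* η`, where it exists. -/
def delStar (F : FinslerMetric n M) (η : Raw11 n M) : Form01 n M :=
  Classical.epsilon (IsDelAdjoint F η)

/-- `∂̄_H^* η`, where it exists. -/
def delbarStar (F : FinslerMetric n M) (η : Raw11 n M) : Form10 n M :=
  Classical.epsilon (IsDelbarAdjoint F η)

/-- The metric is balanced if `d_H^* ω_H = ∂_H^* ω_H + ∂̄_H^* ω_H` vanishes, as a form on the real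
tangent vectors. -/
def IsBalanced (F : FinslerMetric n M) : Prop :=
  ∀ (p : PTM n M) (X : TangentSpace 𝓘(ℂ, Cn n) p.base),
    (delStar F (omegaH F)).toRaw p X + (delbarStar F (omegaH F)).toRaw p X = 0

/-! ### Ricci and scalar curvatures -/

/-- `Ric_D = i Ω_{μν̄} dz^μ ∧ dz̄^ν` of the Chern–Finsler connection. -/
def ricD (F : FinslerMetric n M) : Raw11 n M := fun p =>
  sesq p.base fun μ ν =>
    Complex.I * ricciCoef (F.locAt p) (chernFinsler (F.locAt p)) μ ν (coord p)

/-- `Ric_∇ = i R_{μν̄} dz^μ ∧ dz̄^ν` of the canonical connection. -/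
def ricNabla (F : FinslerMetric n M) : Raw11 n M := fun p =>
  sesq p.base fun μ ν =>
    Complex.I * ricciCoef (F.locAt p) (canonical (F.locAt p)) μ ν (coord p)

/-- The scalar curvature of the Chern–Finsler connection. -/
def scalD (F : FinslerMetric n M) (p : PTM n M) : ℂ :=
  scalarCoef (F.locAt p) (chernFinsler (F.locAt p)) (coord p)

/-- The scalar curvature of the canonical connection. -/
def scalNabla (F : FinslerMetric n M) (p : PTM n M) : ℂ :=
  scalarCoef (F.locAt p) (canonical (F.locAt p)) (coord p)

end Manifold

end ComplexFinsler

end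

open ComplexFinsler

noncomputable section

namespace ComplexFinsler

/-! ### Wirtinger calculus -/

section Wirtinger

variable {n : ℕ} {f h : Pn n → ℂ} {p u w : Pn n} {S : Set (Pn n)}

/-! Everything is governed by the torsion trace T_δ = G^{λ̄α}(δ_α G_{δλ̄} − δ_δ G_{αλ̄}) of the
Chern–Finsler connection (`tors`).

Curvature. Both Ricci tensors are traces of curvature endomorphisms, and the trace of a curvature
sees only the trace of the connection forms (`sum_curv_unit`). For D this trace is ∂ log det G. For
∇ it has the additional horizontal terms ½T_μ dz^μ − ½conj(T_μ) dz̄^μ, while the vertical parts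
coincide. Hence Ω_{μν̄} − R_{μν̄} = ½(δ_μ conj(T_ν) + δ_ν̄ T_μ) (`IsLocalMetric.ricciCoef_sub`).

Adjoints. The claim is ∂_H^*ω_H = i conj(T_δ) dz̄^δ (`isDelAdjoint_torsForm`), with ∂̄_H^*ω_H its
conjugate; together with the formula above this gives both identities. Integration by parts is
carried out on the slit bundle, with the density κ(G) det(G_{αβ̄})² for a cut-off κ. Integrating
this density over the complex multiples of v gives a constant times det²/Gⁿ, and that is dμ up to a
constant, because the vertical determinant is det(G_{αβ̄})/Gⁿ
(`IsLocalMetric.det_submatrix_levi_log`). Since δ_μ G = 0, the cut-off is horizontally constant. The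
factor det² contributes 2δ_μ log det G, of which the fibre divergence of Γ removes one half, so the
divergence of X^α δ_α is δ_α X^α + X^α δ_α log det G (`IsLocalMetric.setIntegral_divergence`). For
X^α = ψ_β̄ G^{β̄α}, the derivative of the inverse metric and the log det term combine to −T
(`IsLocalMetric.divergence_dual`). A partition of unity passes from charts to the compact manifold,
and positivity of the inner product gives uniqueness.

Globalization. Global objects are evaluated in the preferred chart at the base point and on a chosen
vector of the line, so covariance is needed under holomorphic changes of z combined with dilations
of v (`IsChange`). The horizontal vectors are the common kernel of the forms ∂G_β̄, which is
invariant; second derivatives of the transition map are symmetric and drop out of T; and log det G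
changes only by log|det J|². So T is a smooth form and s_D is continuous, and s_∇ is then continuous
by the difference formula.

Equivalence. The difference s_D − s_∇ is the real part of ⟨∂_H∂_H^*ω_H, ω_H⟩, so its integral is
‖∂_H^*ω_H‖². If that vanishes then T = 0, which makes F balanced; conversely balancedness gives T =
0, since a (1,0)- and a (0,1)-form can cancel only if both vanish, and T = 0 gives equal Ricci
forms. -/

theorem dHol_add_right (f : Pn n → ℂ) (p u w : Pn n) :
    dHol f p (u + w) = dHol f p u + dHol f p w := by
  simp only [dHol, smul_add, map_add]; ring

theorem dAnti_add_right (f : Pn n → ℂ) (p u w : Pn n) :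
    dAnti f p (u + w) = dAnti f p u + dAnti f p w := by
  simp only [dAnti, smul_add, map_add]; ring

theorem fderiv_complex_smul (f : Pn n → ℂ) (p u : Pn n) (c : ℂ) :
    fderiv ℝ f p (c • u) = c.re * fderiv ℝ f p u + c.im * fderiv ℝ f p (Complex.I • u) := by
  have : c • u = c.re • u + c.im • (Complex.I • u) := by
    conv_lhs => rw [← Complex.re_add_im c]
    rw [add_smul, mul_smul]; simp only [Complex.coe_smul]
  rw [this, map_add, map_smul, map_smul]; simp

theorem dHol_smul_right (f : Pn n → ℂ) (p u : Pn n) (c : ℂ) :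
    dHol f p (c • u) = c * dHol f p u := by
  simp only [dHol, smul_smul]
  rw [fderiv_complex_smul f p u c, fderiv_complex_smul f p u (Complex.I * c)]
  have h1 : (Complex.I * c).re = -c.im := by simp
  have h2 : (Complex.I * c).im = c.re := by simp
  rw [h1, h2]
  generalize fderiv ℝ f p u = A
  generalize fderiv ℝ f p (Complex.I • u) = B
  conv_rhs => rw [← Complex.re_add_im c]
  push_cast
  linear_combination (1 / 2) * c.im * B * Complex.I_mul_I

theorem dAnti_smul_right (f : Pn n → ℂ) (p u : Pn n) (c : ℂ) :
    dAnti f p (c • u) = star c * dAnti f p u := by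
  have hc : star c = c.re - c.im * Complex.I := by
    apply Complex.ext <;> simp
  simp only [dAnti, smul_smul]
  rw [fderiv_complex_smul f p u c, fderiv_complex_smul f p u (Complex.I * c), hc]
  have h1 : (Complex.I * c).re = -c.im := by simp
  have h2 : (Complex.I * c).im = c.re := by simp
  rw [h1, h2]
  generalize fderiv ℝ f p u = A
  generalize fderiv ℝ f p (Complex.I • u) = B
  push_cast
  linear_combination (1 / 2) * c.im * B * Complex.I_mul_I

theorem dHol_zero_right (f : Pn n → ℂ) (p : Pn n) : dHol f p 0 = 0 := by simp [dHol]

theorem dAnti_zero_right (f : Pn n → ℂ) (p : Pn n) : dAnti f p 0 = 0 := by simp [dAnti]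

theorem dHol_neg_right (f : Pn n → ℂ) (p u : Pn n) : dHol f p (-u) = - dHol f p u := by
  simp [dHol]; ring

theorem dHol_sum_right {ι : Type*} (s : Finset ι) (f : Pn n → ℂ) (p : Pn n) (u : ι → Pn n) :
    dHol f p (∑ i ∈ s, u i) = ∑ i ∈ s, dHol f p (u i) := by
  classical
  induction s using Finset.induction_on with
  | empty => simp [dHol_zero_right]
  | insert a s ha ih => rw [Finset.sum_insert ha, Finset.sum_insert ha, dHol_add_right, ih]

theorem dAnti_sum_right {ι : Type*} (s : Finset ι) (f : Pn n → ℂ) (p : Pn n) (u : ι → Pn n) :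
    dAnti f p (∑ i ∈ s, u i) = ∑ i ∈ s, dAnti f p (u i) := by
  classical
  induction s using Finset.induction_on with
  | empty => simp [dAnti_zero_right]
  | insert a s ha ih => rw [Finset.sum_insert ha, Finset.sum_insert ha, dAnti_add_right, ih]

theorem eq_sum_unit (u : Cn n) : u = ∑ α, u α • (unit α : Cn n) := by
  ext i; simp [unit, Finset.sum_apply, Pi.single_apply]

theorem sum_base (u : Cn n) : ((u, 0) : Pn n) = ∑ α, u α • ((unit α, 0) : Pn n) := by
  refine Prod.ext ?_ ?_
  · simp only [Prod.fst_sum, Prod.smul_fst]; exact eq_sum_unit u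
  · simp [Prod.snd_sum]

theorem sum_fibre (u : Cn n) : ((0, u) : Pn n) = ∑ α, u α • ((0, unit α) : Pn n) := by
  refine Prod.ext ?_ ?_
  · simp [Prod.fst_sum]
  · simp only [Prod.snd_sum, Prod.smul_snd]; exact eq_sum_unit u

theorem dHol_base (f : Pn n → ℂ) (p : Pn n) (u : Cn n) :
    dHol f p (u, 0) = ∑ α, u α * dHol f p (unit α, 0) := by
  rw [sum_base, dHol_sum_right]; simp only [dHol_smul_right]

theorem dHol_fibre (f : Pn n → ℂ) (p : Pn n) (u : Cn n) :
    dHol f p (0, u) = ∑ α, u α * dHol f p (0, unit α) := by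
  rw [sum_fibre, dHol_sum_right]; simp only [dHol_smul_right]

theorem dAnti_fibre (f : Pn n → ℂ) (p : Pn n) (u : Cn n) :
    dAnti f p (0, u) = ∑ α, star (u α) * dAnti f p (0, unit α) := by
  rw [sum_fibre, dAnti_sum_right]; simp only [dAnti_smul_right]

theorem dHol_pair (f : Pn n → ℂ) (p : Pn n) (u w : Cn n) :
    dHol f p (u, w) = dHol f p (u, 0) + dHol f p (0, w) := by
  rw [← dHol_add_right]; simp

theorem dAnti_pair (f : Pn n → ℂ) (p : Pn n) (u w : Cn n) :
    dAnti f p (u, w) = dAnti f p (u, 0) + dAnti f p (0, w) := by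
  rw [← dAnti_add_right]; simp

theorem dHol_star (f : Pn n → ℂ) (p u : Pn n) :
    dHol (fun q => star (f q)) p u = star (dAnti f p u) := by
  simp only [dHol, dAnti, fderiv_star]
  simp
  ring

theorem dAnti_star (f : Pn n → ℂ) (p u : Pn n) :
    dAnti (fun q => star (f q)) p u = star (dHol f p u) := by
  simp only [dHol, dAnti, fderiv_star]
  simp

theorem dHol_congr (hf : f =ᶠ[nhds p] h) : dHol f p u = dHol h p u := by
  simp only [dHol, hf.fderiv_eq]

theorem dAnti_congr (hf : f =ᶠ[nhds p] h) : dAnti f p u = dAnti h p u := by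
  simp only [dAnti, hf.fderiv_eq]

theorem dHol_congr_on (hS : IsOpen S) (hp : p ∈ S) (hf : Set.EqOn f h S) :
    dHol f p u = dHol h p u :=
  dHol_congr (Filter.eventuallyEq_of_mem (hS.mem_nhds hp) hf)

theorem dAnti_congr_on (hS : IsOpen S) (hp : p ∈ S) (hf : Set.EqOn f h S) :
    dAnti f p u = dAnti h p u :=
  dAnti_congr (Filter.eventuallyEq_of_mem (hS.mem_nhds hp) hf)

theorem dHol_const (c : ℂ) : dHol (fun _ => c) p u = 0 := by simp [dHol]

theorem dAnti_const (c : ℂ) : dAnti (fun _ => c) p u = 0 := by simp [dAnti]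

theorem dAnti_add (hf : DifferentiableAt ℝ f p) (hh : DifferentiableAt ℝ h p) :
    dAnti (fun q => f q + h q) p u = dAnti f p u + dAnti h p u := by
  simp only [dAnti, fderiv_fun_add hf hh, add_apply]; ring

theorem dAnti_neg : dAnti (fun q => -f q) p u = -dAnti f p u := by
  simp only [dAnti, fderiv_fun_neg, neg_apply]; ring

theorem dHol_sub (hf : DifferentiableAt ℝ f p) (hh : DifferentiableAt ℝ h p) :
    dHol (fun q => f q - h q) p u = dHol f p u - dHol h p u := by
  simp only [dHol, fderiv_fun_sub hf hh, sub_apply]; ring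

theorem dAnti_sub (hf : DifferentiableAt ℝ f p) (hh : DifferentiableAt ℝ h p) :
    dAnti (fun q => f q - h q) p u = dAnti f p u - dAnti h p u := by
  simp only [dAnti, fderiv_fun_sub hf hh, sub_apply]; ring

theorem dHol_mul (hf : DifferentiableAt ℝ f p) (hh : DifferentiableAt ℝ h p) :
    dHol (fun q => f q * h q) p u = dHol f p u * h p + f p * dHol h p u := by
  simp only [dHol, fderiv_fun_mul hf hh, add_apply,
    smul_apply, smul_eq_mul]; ring

theorem dAnti_mul (hf : DifferentiableAt ℝ f p) (hh : DifferentiableAt ℝ h p) :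
    dAnti (fun q => f q * h q) p u = dAnti f p u * h p + f p * dAnti h p u := by
  simp only [dAnti, fderiv_fun_mul hf hh, add_apply,
    smul_apply, smul_eq_mul]; ring

theorem dHol_const_mul (c : ℂ) (hf : DifferentiableAt ℝ f p) :
    dHol (fun q => c * f q) p u = c * dHol f p u := by
  rw [dHol_mul (differentiableAt_const c) hf, dHol_const]; ring

theorem dAnti_const_mul (c : ℂ) (hf : DifferentiableAt ℝ f p) :
    dAnti (fun q => c * f q) p u = c * dAnti f p u := by
  rw [dAnti_mul (differentiableAt_const c) hf, dAnti_const]; ring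

theorem dHol_sum {ι : Type*} {s : Finset ι} {f : ι → Pn n → ℂ}
    (hf : ∀ i ∈ s, DifferentiableAt ℝ (f i) p) :
    dHol (fun q => ∑ i ∈ s, f i q) p u = ∑ i ∈ s, dHol (f i) p u := by
  simp only [dHol, fderiv_fun_sum hf, sum_apply]
  rw [← Finset.mul_sum, Finset.sum_sub_distrib, Finset.mul_sum]

theorem dAnti_sum {ι : Type*} {s : Finset ι} {f : ι → Pn n → ℂ}
    (hf : ∀ i ∈ s, DifferentiableAt ℝ (f i) p) :
    dAnti (fun q => ∑ i ∈ s, f i q) p u = ∑ i ∈ s, dAnti (f i) p u := by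
  simp only [dAnti, fderiv_fun_sum hf, sum_apply]
  rw [← Finset.mul_sum, Finset.sum_add_distrib, Finset.mul_sum]

theorem dHol_comp {Φ : Pn n → Pn n} {Φ' : Pn n →L[ℂ] Pn n} (hf : DifferentiableAt ℝ f (Φ p))
    (hΦ : HasFDerivAt Φ Φ' p) : dHol (fun q => f (Φ q)) p u = dHol f (Φ p) (Φ' u) := by
  have := (hf.hasFDerivAt.comp p (hΦ.restrictScalars ℝ)).fderiv
  simp only [Function.comp_def] at this
  simp [dHol, this]

theorem dAnti_comp {Φ : Pn n → Pn n} {Φ' : Pn n →L[ℂ] Pn n} (hf : DifferentiableAt ℝ f (Φ p))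
    (hΦ : HasFDerivAt Φ Φ' p) : dAnti (fun q => f (Φ q)) p u = dAnti f (Φ p) (Φ' u) := by
  have := (hf.hasFDerivAt.comp p (hΦ.restrictScalars ℝ)).fderiv
  simp only [Function.comp_def] at this
  simp [dAnti, this]

theorem dHol_of_hasFDerivAt {f' : Pn n →L[ℂ] ℂ} (hf : HasFDerivAt f f' p) :
    dHol f p u = f' u := by
  simp only [dHol, (hf.restrictScalars ℝ).fderiv, ContinuousLinearMap.coe_restrictScalars',
    map_smul, smul_eq_mul]
  linear_combination (-1/2) * f' u * Complex.I_mul_I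

theorem dAnti_of_hasFDerivAt {f' : Pn n →L[ℂ] ℂ} (hf : HasFDerivAt f f' p) :
    dAnti f p u = 0 := by
  simp only [dAnti, (hf.restrictScalars ℝ).fderiv, ContinuousLinearMap.coe_restrictScalars',
    map_smul, smul_eq_mul]
  linear_combination (1/2) * f' u * Complex.I_mul_I

theorem dAnti_of_differentiableAt (hf : DifferentiableAt ℂ f p) : dAnti f p u = 0 :=
  dAnti_of_hasFDerivAt hf.hasFDerivAt

/-- Conjugates of holomorphic Jacobian entries are constants for ∂. This removes the inhomogeneous
terms in most of the transformation laws below. -/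
theorem dHol_star_of_differentiableAt (hf : DifferentiableAt ℂ f p) :
    dHol (fun q => star (f q)) p u = 0 := by
  rw [dHol_star, dAnti_of_differentiableAt hf, star_zero]

theorem contDiffOn_fderiv_apply (hS : IsOpen S) (hf : ContDiffOn ℝ ∞ f S) (u : Pn n) :
    ContDiffOn ℝ ∞ (fun q => fderiv ℝ f q u) S :=
  (hf.fderiv_of_isOpen hS (by simp)).clm_apply contDiffOn_const

theorem contDiffOn_dHol (hS : IsOpen S) (hf : ContDiffOn ℝ ∞ f S) (u : Pn n) :
    ContDiffOn ℝ ∞ (fun q => dHol f q u) S := by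
  unfold dHol
  exact contDiffOn_const.mul ((contDiffOn_fderiv_apply hS hf _).sub
    (contDiffOn_const.mul (contDiffOn_fderiv_apply hS hf _)))

theorem contDiffOn_dAnti (hS : IsOpen S) (hf : ContDiffOn ℝ ∞ f S) (u : Pn n) :
    ContDiffOn ℝ ∞ (fun q => dAnti f q u) S := by
  unfold dAnti
  exact contDiffOn_const.mul ((contDiffOn_fderiv_apply hS hf _).add
    (contDiffOn_const.mul (contDiffOn_fderiv_apply hS hf _)))

theorem ContDiffOn.star' {f : Pn n → ℂ} (hf : ContDiffOn ℝ ∞ f S) :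
    ContDiffOn ℝ ∞ (fun q => star (f q)) S :=
  ((starL' ℝ : ℂ ≃L[ℝ] ℂ).contDiff).comp_contDiffOn hf

theorem diffAt (hS : IsOpen S) (hf : ContDiffOn ℝ ∞ f S) (hp : p ∈ S) : DifferentiableAt ℝ f p :=
  (hf.contDiffAt (hS.mem_nhds hp)).differentiableAt (by simp)

theorem fderiv_fderiv_apply_comm (hS : IsOpen S) (hf : ContDiffOn ℝ ∞ f S) (hp : p ∈ S)
    (u w : Pn n) :
    fderiv ℝ (fun q => fderiv ℝ f q u) p w = fderiv ℝ (fun q => fderiv ℝ f q w) p u := by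
  have hd : DifferentiableAt ℝ (fderiv ℝ f) p :=
    ((hf.fderiv_of_isOpen hS (m := ∞) (by simp)).contDiffAt (hS.mem_nhds hp)).differentiableAt
      (by simp)
  have hsymm : IsSymmSndFDerivAt ℝ f p :=
    (hf.contDiffAt (hS.mem_nhds hp)).isSymmSndFDerivAt (by simp; exact WithTop.coe_le_coe.2 le_top)
  rw [fderiv_clm_apply hd (differentiableAt_const _), fderiv_clm_apply hd (differentiableAt_const _)]
  simp
  exact hsymm _ _

theorem fderiv_dHol_apply (hS : IsOpen S) (hf : ContDiffOn ℝ ∞ f S) (hp : p ∈ S) (a b : Pn n) :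
    fderiv ℝ (fun q => dHol f q a) p b = (1 / 2) * (fderiv ℝ (fun q => fderiv ℝ f q a) p b -
      Complex.I * fderiv ℝ (fun q => fderiv ℝ f q (Complex.I • a)) p b) := by
  have hd : ∀ a, DifferentiableAt ℝ (fun q => fderiv ℝ f q a) p := fun a =>
    diffAt hS (contDiffOn_fderiv_apply hS hf a) hp
  have := ((((hd a).hasFDerivAt.sub ((hd (Complex.I • a)).hasFDerivAt.const_mul
    Complex.I)).const_mul (1 / 2))).fderiv
  have h2 := congrArg (fun L => L b) this
  simpa [dHol] using h2

/-- Symmetry of the real second derivative, applied to the directions u, iu, w, iw. It is used to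
exchange ∂_z and ∂_v on G_β̄. -/
theorem dHol_dHol_comm (hS : IsOpen S) (hf : ContDiffOn ℝ ∞ f S) (hp : p ∈ S) (u w : Pn n) :
    dHol (fun q => dHol f q u) p w = dHol (fun q => dHol f q w) p u := by
  have hs := fderiv_fderiv_apply_comm hS hf hp
  rw [dHol, dHol]
  simp only [fderiv_dHol_apply hS hf hp]
  rw [hs u w, hs u (Complex.I • w), hs (Complex.I • u) w, hs (Complex.I • u) (Complex.I • w)]
  ring

end Wirtinger

end ComplexFinsler

namespace ComplexFinsler

/-! ### Metrics in local coordinates -/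

section Local

variable {n : ℕ}

/-- The part of the slit tangent bundle over an open set of `ℂⁿ`. -/
def slit (U : Set (Cn n)) : Set (Pn n) := U ×ˢ {0}ᶜ

/-- Strongly pseudoconvex complex Finsler metrics on an open set of `ℂⁿ`. -/
structure IsLocalMetric (U : Set (Cn n)) (g : Pn n → ℝ) : Prop where
  isOpen : IsOpen U
  smooth : ContDiffOn ℝ ∞ g (slit U)
  pos : ∀ q ∈ slit U, 0 < g q
  homog : ∀ z ∈ U, ∀ (v : Cn n) (ζ : ℂ), g (z, ζ • v) = ‖ζ‖ ^ 2 * g (z, v)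
  posDef : ∀ q ∈ slit U, (levi g q).PosDef

/-- `G_β̄ = ∂G / ∂v̄^β`. -/
def gBar (g : Pn n → ℝ) (β : Fin n) (q : Pn n) : ℂ := dAnti (fun r => (g r : ℂ)) q (0, unit β)

/-- The coefficients of `δ_μ`. -/
def horVec (g : Pn n → ℝ) (μ : Fin n) (q : Pn n) : Pn n := (unit μ, fun α => -nonlin g α μ q)

/-- The torsion trace `T_δ = G^{λ̄α} (δ_α G_{δλ̄} - δ_δ G_{αλ̄})`. -/
def tors (g : Pn n → ℝ) (δ : Fin n) (q : Pn n) : ℂ :=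
  ∑ α, ∑ l, gInv g q l α * (dHol (gCoef g δ l) q (horVec g α q) - dHol (gCoef g α l) q (horVec g δ q))

/-- The `(1,0)`-form `∂ log det G = G^{λ̄α} ∂G_{αλ̄}`. -/
def logDet (g : Pn n → ℝ) (X : Pn n) (q : Pn n) : ℂ :=
  ∑ α, ∑ l, gInv g q l α * dHol (gCoef g α l) q X

theorem gCoef_eq (g : Pn n → ℝ) (α β : Fin n) :
    gCoef g α β = fun q => dHol (gBar g β) q (0, unit α) := rfl

theorem nonlin_eq (g : Pn n → ℝ) (α μ : Fin n) (q : Pn n) :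
    nonlin g α μ q = ∑ l, gInv g q l α * dHol (gBar g l) q (unit μ, 0) := rfl

theorem star_unit (μ : Fin n) : star (unit μ : Cn n) = unit μ := by
  ext i; simp only [unit, Pi.star_apply, Pi.single_apply]; split_ifs <;> simp

theorem act_hor (g : Pn n → ℝ) (μ : Fin n) (f : Pn n → ℂ) (q : Pn n) :
    act (hor g μ) f q = dHol f q (horVec g μ q) := by
  simp [act, hor, horVec, dAnti_zero_right]

/-- `dAnti` is conjugate-linear in its direction, so δ_ν̄ is `dAnti` along the very vector that
represents δ_ν. -/
theorem act_horBar (g : Pn n → ℝ) (μ : Fin n) (f : Pn n → ℂ) (q : Pn n) :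
    act (horBar g μ) f q = dAnti f q (horVec g μ q) := by
  have : star ((unit μ, fun α => -star (nonlin g α μ q)) : Pn n) = horVec g μ q := by
    refine Prod.ext (star_unit μ) ?_
    ext i; simp [horVec]
  simp only [act, horBar, this, dHol_zero_right, zero_add]

theorem act_vert (g : Fin n) (f : Pn n → ℂ) (q : Pn n) :
    act (vert g) f q = dHol f q (0, unit g) := by
  simp [act, vert, dAnti_zero_right]

theorem dHol_horVec (g : Pn n → ℝ) (μ : Fin n) (f : Pn n → ℂ) (q : Pn n) :
    dHol f q (horVec g μ q) =
      dHol f q (unit μ, 0) - ∑ α, nonlin g α μ q * dHol f q (0, unit α) := by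
  rw [horVec, dHol_pair, dHol_fibre]
  simp [sub_eq_add_neg]

theorem dAnti_horVec (g : Pn n → ℝ) (μ : Fin n) (f : Pn n → ℂ) (q : Pn n) :
    dAnti f q (horVec g μ q) =
      dAnti f q (unit μ, 0) - ∑ α, star (nonlin g α μ q) * dAnti f q (0, unit α) := by
  rw [horVec, dAnti_pair, dAnti_fibre]
  simp [sub_eq_add_neg]

theorem contDiffOn_det {ι : Type*} [Fintype ι] [DecidableEq ι] {S : Set (Pn n)}
    {A : Pn n → Matrix ι ι ℂ} (hA : ∀ i j, ContDiffOn ℝ ∞ (fun q => A q i j) S) :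
    ContDiffOn ℝ ∞ (fun q => (A q).det) S := by
  simp only [Matrix.det_apply']
  exact ContDiffOn.sum fun σ _ => contDiffOn_const.mul (contDiffOn_prod fun i _ => hA _ _)

/-- By Cramer's rule an entry of the inverse is a quotient of determinants, hence smooth where the
denominator does not vanish. -/
theorem contDiffOn_inv {ι : Type*} [Fintype ι] [DecidableEq ι] {S : Set (Pn n)}
    {A : Pn n → Matrix ι ι ℂ} (hA : ∀ i j, ContDiffOn ℝ ∞ (fun q => A q i j) S)
    (h0 : ∀ q ∈ S, (A q).det ≠ 0) (i j : ι) : ContDiffOn ℝ ∞ (fun q => (A q)⁻¹ i j) S := by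
  have : ∀ q, (A q)⁻¹ i j = (A q).det⁻¹ * ((A q).updateRow j (Pi.single i 1)).det := by
    intro q
    rw [Matrix.inv_def, Matrix.smul_apply, Matrix.adjugate_apply, Ring.inverse_eq_inv', smul_eq_mul]
  simp only [this]
  refine ((contDiffOn_det hA).inv h0).mul (contDiffOn_det fun k l => ?_)
  simp only [Matrix.updateRow_apply]
  split_ifs
  · exact contDiffOn_const
  · exact hA _ _

/-- Jacobi's formula. -/
theorem dHol_det {ι : Type*} [Fintype ι] [DecidableEq ι] {q u : Pn n}
    {A : Pn n → Matrix ι ι ℂ} (hA : ∀ i j, DifferentiableAt ℝ (fun q => A q i j) q)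
    (h0 : (A q).det ≠ 0) :
    dHol (fun q => (A q).det) q u =
      (A q).det * ∑ i, ∑ j, (A q)⁻¹ j i * dHol (fun q => A q i j) q u := by
  classical
  have key : ∀ (s : Finset ι) (F : ι → Pn n → ℂ), (∀ i, DifferentiableAt ℝ (F i) q) →
      DifferentiableAt ℝ (fun q => ∏ i ∈ s, F i q) q ∧
      dHol (fun q => ∏ i ∈ s, F i q) q u =
        ∑ i ∈ s, ∏ j ∈ s, if j = i then dHol (F j) q u else F j q := by
    intro s F hF
    induction s using Finset.induction_on with
    | empty => simp [dHol_const]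
    | insert a s ha ih =>
      simp only [Finset.prod_insert ha, Finset.sum_insert ha]
      refine ⟨(hF a).mul ih.1, ?_⟩
      rw [dHol_mul (hF a) ih.1, ih.2, if_pos trivial, Finset.mul_sum]
      congr 1
      · congr 1
        refine Finset.prod_congr rfl fun j hj => ?_
        rw [if_neg]; rintro rfl; exact ha hj
      · refine Finset.sum_congr rfl fun i hi => ?_
        rw [if_neg]; rintro rfl; exact ha hi
  -- The Leibniz rule in each term of the permutation expansion; the terms in which the `i`-th
  -- factor is differentiated regroup into the determinant with column `i` differentiated.
  have h1 : dHol (fun q => (A q).det) q u =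
      ∑ i, ((A q).updateCol i (fun k => dHol (fun q => A q k i) q u)).det := by
    simp only [Matrix.det_apply']
    rw [dHol_sum fun σ _ => ((key Finset.univ (fun i q => A q (σ i) i) fun i => hA _ _).1.const_mul _)]
    rw [Finset.sum_comm]
    refine Finset.sum_congr rfl fun σ _ => ?_
    rw [dHol_const_mul _ (key Finset.univ (fun i q => A q (σ i) i) fun i => hA _ _).1,
      (key Finset.univ (fun i q => A q (σ i) i) fun i => hA _ _).2, Finset.mul_sum]
    refine Finset.sum_congr rfl fun i _ => ?_
    congr 1
    refine Finset.prod_congr rfl fun j _ => ?_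
    rw [Matrix.updateCol_apply]
    split_ifs with h
    · rw [h]
    · rfl
  rw [h1, Finset.sum_comm, Finset.mul_sum]
  refine Finset.sum_congr rfl fun i _ => ?_
  -- A determinant with one column replaced is an entry of the adjugate applied to that column, and
  -- the adjugate is the determinant times the inverse.
  rw [← Matrix.cramer_apply, Matrix.cramer_eq_adjugate_mulVec, Matrix.mulVec, dotProduct,
    Finset.mul_sum]
  refine Finset.sum_congr rfl fun j _ => ?_
  rw [Matrix.inv_def, Matrix.smul_apply, Ring.inverse_eq_inv', smul_eq_mul, ← mul_assoc,
    mul_inv_cancel_left₀ h0]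

/-! ### Regularity of the metric data, and the horizontal space as a kernel. -/

namespace IsLocalMetric

variable {U : Set (Cn n)} {g : Pn n → ℝ} (hg : IsLocalMetric U g) {q : Pn n}
include hg

theorem isOpen_slit : IsOpen (slit U) := hg.isOpen.prod isOpen_compl_singleton

theorem contDiffOn_coe : ContDiffOn ℝ ∞ (fun r => (g r : ℂ)) (slit U) :=
  Complex.ofRealCLM.contDiff.comp_contDiffOn hg.smooth

theorem contDiffOn_gBar (β : Fin n) : ContDiffOn ℝ ∞ (gBar g β) (slit U) :=
  contDiffOn_dAnti hg.isOpen_slit hg.contDiffOn_coe _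

theorem contDiffOn_gCoef (α β : Fin n) : ContDiffOn ℝ ∞ (gCoef g α β) (slit U) :=
  contDiffOn_dHol hg.isOpen_slit (hg.contDiffOn_gBar β) _

theorem det_ne_zero (hq : q ∈ slit U) : (levi g q).det ≠ 0 := (hg.posDef q hq).det_pos.ne'

theorem contDiffOn_gInv (β α : Fin n) : ContDiffOn ℝ ∞ (fun q => gInv g q β α) (slit U) :=
  contDiffOn_inv (fun i j => hg.contDiffOn_gCoef i j) (fun _ hq => hg.det_ne_zero hq) _ _

theorem contDiffOn_nonlin (α μ : Fin n) : ContDiffOn ℝ ∞ (nonlin g α μ) (slit U) :=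
  ContDiffOn.sum fun l _ => (hg.contDiffOn_gInv l α).mul
    (contDiffOn_dHol hg.isOpen_slit (hg.contDiffOn_gBar l) _)

theorem contDiffOn_dHol_horVec {f : Pn n → ℂ} (hf : ContDiffOn ℝ ∞ f (slit U)) (μ : Fin n) :
    ContDiffOn ℝ ∞ (fun q => dHol f q (horVec g μ q)) (slit U) := by
  simp only [dHol_horVec]
  exact (contDiffOn_dHol hg.isOpen_slit hf _).sub (ContDiffOn.sum fun α _ =>
    (hg.contDiffOn_nonlin α μ).mul (contDiffOn_dHol hg.isOpen_slit hf _))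

theorem contDiffOn_dAnti_horVec {f : Pn n → ℂ} (hf : ContDiffOn ℝ ∞ f (slit U)) (μ : Fin n) :
    ContDiffOn ℝ ∞ (fun q => dAnti f q (horVec g μ q)) (slit U) := by
  simp only [dAnti_horVec]
  exact (contDiffOn_dAnti hg.isOpen_slit hf _).sub (ContDiffOn.sum fun α _ =>
    (ContDiffOn.star' (hg.contDiffOn_nonlin α μ)).mul (contDiffOn_dAnti hg.isOpen_slit hf _))

theorem contDiffOn_tors (δ : Fin n) : ContDiffOn ℝ ∞ (tors g δ) (slit U) :=
  ContDiffOn.sum fun α _ => ContDiffOn.sum fun l _ => (hg.contDiffOn_gInv l α).mul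
    ((hg.contDiffOn_dHol_horVec (hg.contDiffOn_gCoef _ _) _).sub
      (hg.contDiffOn_dHol_horVec (hg.contDiffOn_gCoef _ _) _))

theorem contDiffOn_logDet (X : Pn n) : ContDiffOn ℝ ∞ (logDet g X) (slit U) :=
  ContDiffOn.sum fun α _ => ContDiffOn.sum fun l _ => (hg.contDiffOn_gInv l α).mul
    (contDiffOn_dHol hg.isOpen_slit (hg.contDiffOn_gCoef _ _) _)

theorem differentiableAt {f : Pn n → ℂ} (hf : ContDiffOn ℝ ∞ f (slit U)) (hq : q ∈ slit U) :
    DifferentiableAt ℝ f q := diffAt hg.isOpen_slit hf hq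

theorem sum_gCoef_mul_gInv (hq : q ∈ slit U) (α γ : Fin n) :
    ∑ β, gCoef g α β q * gInv g q β γ = if α = γ then 1 else 0 := by
  have := Matrix.mul_nonsing_inv (levi g q) (isUnit_iff_ne_zero.2 (hg.det_ne_zero hq))
  have := congrFun (congrFun this α) γ
  rwa [Matrix.mul_apply, Matrix.one_apply] at this

theorem sum_gInv_mul_gCoef (hq : q ∈ slit U) (α γ : Fin n) :
    ∑ β, gInv g q α β * gCoef g β γ q = if α = γ then 1 else 0 := by
  have := Matrix.nonsing_inv_mul (levi g q) (isUnit_iff_ne_zero.2 (hg.det_ne_zero hq))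
  have := congrFun (congrFun this α) γ
  rwa [Matrix.mul_apply, Matrix.one_apply] at this

theorem star_gCoef (hq : q ∈ slit U) (α β : Fin n) : star (gCoef g α β q) = gCoef g β α q :=
  (hg.posDef q hq).isHermitian.apply β α

theorem star_gInv (hq : q ∈ slit U) (α β : Fin n) : star (gInv g q α β) = gInv g q β α :=
  ((hg.posDef q hq).inv.isHermitian).apply β α

/-- Horizontality of `δ_μ`. -/
theorem dHol_gBar_horVec (hq : q ∈ slit U) (l μ : Fin n) :
    dHol (gBar g l) q (horVec g μ q) = 0 := by
  rw [dHol_horVec]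
  simp only [nonlin_eq, Finset.sum_mul]
  rw [Finset.sum_comm]
  have : ∀ k, ∑ α, gInv g q k α * dHol (gBar g k) q (unit μ, 0) * dHol (gBar g l) q (0, unit α) =
      dHol (gBar g k) q (unit μ, 0) * if k = l then 1 else 0 := by
    intro k
    rw [← hg.sum_gInv_mul_gCoef hq k l, Finset.mul_sum]
    exact Finset.sum_congr rfl fun α _ => by rw [gCoef_eq]; ring
  simp [this]

/-- Horizontal vectors are determined by their projection to the base. -/
theorem eq_of_dHol_gBar_eq_zero (hq : q ∈ slit U) {u w : Cn n}
    (h : ∀ l, dHol (gBar g l) q (u, w) = 0) : (u, w) = ∑ μ, u μ • horVec g μ q := by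
  -- Subtracting the horizontal combination with the same base part leaves a vertical vector, on
  -- which ∂G_λ̄ is the pairing with the nondegenerate matrix G_{αλ̄}; so the remainder is zero.
  have h' : ∀ l, dHol (gBar g l) q ((u, w) - ∑ μ, u μ • horVec g μ q) = 0 := by
    intro l
    rw [sub_eq_add_neg, dHol_add_right, dHol_neg_right, dHol_sum_right, h l]
    simp [dHol_smul_right, hg.dHol_gBar_horVec hq]
  obtain ⟨y, hy⟩ : ∃ y, (u, w) - ∑ μ, u μ • horVec g μ q = (0, y) := by
    refine ⟨_, Prod.ext ?_ rfl⟩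
    simp only [Prod.fst_sub, Prod.fst_sum, Prod.smul_fst, horVec]
    rw [← eq_sum_unit, sub_self]
  suffices y = 0 by rw [← sub_eq_zero, hy, this]; rfl
  have h2 : ∀ l, ∑ α, y α * gCoef g α l q = 0 := by
    intro l
    have := h' l
    rw [hy, dHol_fibre] at this
    exact this
  ext γ
  have : y γ = ∑ l, (∑ α, y α * gCoef g α l q) * gInv g q l γ := by
    simp only [Finset.sum_mul]
    rw [Finset.sum_comm]
    simp only [mul_assoc, ← Finset.mul_sum, hg.sum_gCoef_mul_gInv hq]
    simp
  rw [this]; simp [h2]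

theorem dHol_det_levi (hq : q ∈ slit U) (X : Pn n) :
    dHol (fun q => (levi g q).det) q X = (levi g q).det * logDet g X q :=
  dHol_det (A := fun q => levi g q)
    (fun i j => hg.differentiableAt (hg.contDiffOn_gCoef i j) hq) (hg.det_ne_zero hq)

end IsLocalMetric

end Local

end ComplexFinsler

namespace ComplexFinsler

/-! ### Changes of coordinates -/

section Change

variable {n : ℕ}

/-- The Jacobian matrix of a holomorphic map. -/
def jac (f : Cn n → Cn n) (z : Cn n) : Matrix (Fin n) (Fin n) ℂ :=
  Matrix.of fun σ α => fderiv ℂ f z (unit α) σ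

/-- The map `(z, v) ↦ (f(z), ζ f'(z) v)`. -/
def tangentLift (f : Cn n → Cn n) (ζ : ℂ) (q : Pn n) : Pn n := (f q.1, ζ • fderiv ℂ f q.1 q.2)

/-- A change of coordinates on the base, composed with a dilation of the fibres, that relates two
local metrics. -/
structure IsChange (W U' : Set (Cn n)) (g g' : Pn n → ℝ) (f : Cn n → Cn n) (ζ : ℂ) : Prop where
  isOpen : IsOpen W
  smooth : ContDiffOn ℂ ω f W
  mapsTo : Set.MapsTo f W U'
  injective : ∀ z ∈ W, ∀ v, fderiv ℂ f z v = 0 → v = 0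
  ne_zero : ζ ≠ 0
  eq : ∀ q ∈ slit W, g' (tangentLift f ζ q) = ‖ζ‖ ^ 2 * g q

theorem fderiv_eq_sum_jac (f : Cn n → Cn n) (z v : Cn n) :
    fderiv ℂ f z v = ∑ σ, (∑ α, jac f z σ α * v α) • (unit σ : Cn n) := by
  conv_lhs => rw [eq_sum_unit v, map_sum]
  rw [eq_sum_unit (∑ x, (fderiv ℂ f z) (v x • unit x))]
  refine Finset.sum_congr rfl fun σ _ => ?_
  congr 1
  simp [Finset.sum_apply, jac, mul_comm]

theorem jac_mulVec (f : Cn n → Cn n) (z v : Cn n) : (jac f z).mulVec v = fderiv ℂ f z v := by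
  rw [fderiv_eq_sum_jac]
  ext σ
  simp [Matrix.mulVec, dotProduct, unit, Finset.sum_apply, Pi.single_apply]

namespace IsChange

variable {W U U' : Set (Cn n)} {g g' : Pn n → ℝ} {f : Cn n → Cn n} {ζ : ℂ}
  (hc : IsChange W U' g g' f ζ) {q : Pn n}
include hc

theorem isOpen_slit : IsOpen (slit W) := hc.isOpen.prod isOpen_compl_singleton

theorem det_jac_ne_zero {z : Cn n} (hz : z ∈ W) : (jac f z).det ≠ 0 := by
  intro h
  obtain ⟨v, hv, h⟩ := Matrix.exists_mulVec_eq_zero_iff.2 h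
  rw [jac_mulVec] at h
  exact hv (hc.injective z hz v h)

theorem contDiffOn_fderiv : ContDiffOn ℂ ω (fderiv ℂ f) W :=
  hc.smooth.fderiv_of_isOpen hc.isOpen (by simp)

theorem differentiableAt_fderiv {z : Cn n} (hz : z ∈ W) : DifferentiableAt ℂ (fderiv ℂ f) z :=
  (hc.contDiffOn_fderiv.contDiffAt (hc.isOpen.mem_nhds hz)).differentiableAt (by simp)

theorem hasFDerivAt {z : Cn n} (hz : z ∈ W) : HasFDerivAt f (fderiv ℂ f z) z :=
  ((hc.smooth.contDiffAt (hc.isOpen.mem_nhds hz)).differentiableAt (by simp)).hasFDerivAt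

theorem hasFDerivAt_jac (hq : q ∈ slit W) (σ α : Fin n) :
    ∃ L : Pn n →L[ℂ] ℂ, HasFDerivAt (fun q : Pn n => jac f q.1 σ α) L q ∧
      ∀ u, L u = fderiv ℂ (fderiv ℂ f) q.1 u.1 (unit α) σ := by
  have h1 := (hc.differentiableAt_fderiv hq.1).hasFDerivAt.comp q
    (hasFDerivAt_fst (𝕜 := ℂ) (p := q))
  have h2 := h1.clm_apply (hasFDerivAt_const (unit α : Cn n) q)
  have h3 := (hasFDerivAt_pi'.1 h2) σ
  exact ⟨_, h3, fun u => by simp⟩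

theorem differentiableAt_jac (hq : q ∈ slit W) (σ α : Fin n) :
    DifferentiableAt ℂ (fun q : Pn n => jac f q.1 σ α) q :=
  (hc.hasFDerivAt_jac hq σ α).choose_spec.1.differentiableAt

theorem contDiffOn_jac (σ α : Fin n) : ContDiffOn ℂ ω (fun q : Pn n => jac f q.1 σ α) (slit W) := by
  have h1 : ContDiffOn ℂ ω (fun q : Pn n => fderiv ℂ f q.1) (slit W) :=
    hc.contDiffOn_fderiv.comp contDiffOn_fst fun q hq => hq.1
  exact contDiffOn_pi.1 (h1.clm_apply contDiffOn_const) σ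

theorem contDiffOn_det_jac : ContDiffOn ℂ ω (fun q : Pn n => (jac f q.1).det) (slit W) := by
  simp only [Matrix.det_apply']
  exact ContDiffOn.sum fun σ _ => contDiffOn_const.mul
    (contDiffOn_prod fun i _ => hc.contDiffOn_jac _ _)

theorem dHol_jac (hq : q ∈ slit W) (σ α : Fin n) (u : Pn n) :
    dHol (fun q : Pn n => jac f q.1 σ α) q u = fderiv ℂ (fderiv ℂ f) q.1 u.1 (unit α) σ := by
  obtain ⟨L, h, hL⟩ := hc.hasFDerivAt_jac hq σ α
  rw [dHol_of_hasFDerivAt h, hL]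

theorem fderiv_fderiv_comm {z : Cn n} (hz : z ∈ W) (u w : Cn n) :
    fderiv ℂ (fderiv ℂ f) z u w = fderiv ℂ (fderiv ℂ f) z w u :=
  (hc.smooth.contDiffAt (hc.isOpen.mem_nhds hz)).isSymmSndFDerivAt (by simp) u w

/-- The derivative of the tangent lift. -/
theorem exists_hasFDerivAt_lift (hq : q ∈ slit W) :
    ∃ L : Pn n →L[ℂ] Pn n, HasFDerivAt (tangentLift f ζ) L q ∧
      ∀ u w, L (u, w) = (fderiv ℂ f q.1 u,
        ζ • (fderiv ℂ f q.1 w + fderiv ℂ (fderiv ℂ f) q.1 u q.2)) := by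
  have h1 := (hc.differentiableAt_fderiv hq.1).hasFDerivAt.comp q
    (hasFDerivAt_fst (𝕜 := ℂ) (p := q))
  have h2 := (h1.clm_apply (hasFDerivAt_snd (𝕜 := ℂ) (p := q))).const_smul ζ
  have h3 := ((hc.hasFDerivAt hq.1).comp q (hasFDerivAt_fst (𝕜 := ℂ) (p := q))).prodMk h2
  exact ⟨_, h3, fun u w => by simp⟩

theorem lift_mem (hq : q ∈ slit W) : tangentLift f ζ q ∈ slit U' :=
  ⟨hc.mapsTo hq.1, fun h => hq.2 (hc.injective _ hq.1 _
    ((smul_eq_zero.1 (Set.mem_singleton_iff.1 h)).resolve_left hc.ne_zero))⟩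

theorem differentiableAt_lift (hq : q ∈ slit W) : DifferentiableAt ℂ (tangentLift f ζ) q :=
  (hc.exists_hasFDerivAt_lift hq).choose_spec.1.differentiableAt

omit hc in
theorem slit_subset (hWU : W ⊆ U) : slit W ⊆ slit U := Set.prod_mono hWU subset_rfl

variable (hg : IsLocalMetric U g) (hg' : IsLocalMetric U' g') (hWU : W ⊆ U)
include hg'

theorem differentiableAt_comp {h : Pn n → ℂ} (hh : ContDiffOn ℝ ∞ h (slit U')) (hq : q ∈ slit W) :
    DifferentiableAt ℝ (fun q => h (tangentLift f ζ q)) q :=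
  (hg'.differentiableAt hh (hc.lift_mem hq)).comp q
    ((hc.differentiableAt_lift hq).restrictScalars ℝ)

include hg hWU

/-- Differentiate g' ∘ lift = |ζ|² g in v̄. The chain rule produces ζ̄ times the conjugate Jacobian,
and |ζ|² = ζ̄ζ leaves a single ζ on the left. -/
theorem gBar_eq (hq : q ∈ slit W) (β : Fin n) :
    ζ * gBar g β q = ∑ τ, star (jac f q.1 τ β) * gBar g' τ (tangentLift f ζ q) := by
  obtain ⟨L, hL, hLe⟩ := hc.exists_hasFDerivAt_lift hq
  have h1 : dAnti (fun r => (‖ζ‖ ^ 2 : ℂ) * (g r : ℂ)) q (0, unit β) =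
      dAnti (fun r => (g' r : ℂ)) (tangentLift f ζ q) (L (0, unit β)) := by
    rw [← dAnti_comp (hg'.differentiableAt hg'.contDiffOn_coe (hc.lift_mem hq)) hL]
    refine dAnti_congr_on hc.isOpen_slit hq fun r hr => ?_
    simp only [hc.eq r hr]; push_cast; ring
  rw [dAnti_const_mul _ (hg.differentiableAt hg.contDiffOn_coe (slit_subset hWU hq)), hLe] at h1
  simp only [map_zero, zero_apply, add_zero] at h1
  have h2 : (0, ζ • fderiv ℂ f q.1 (unit β)) = ζ • ((0, fderiv ℂ f q.1 (unit β)) : Pn n) := by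
    simp
  rw [h2, dAnti_smul_right, dAnti_fibre _ (tangentLift f ζ q)] at h1
  have h3 : (‖ζ‖ ^ 2 : ℂ) = star ζ * ζ := (Complex.conj_mul' ζ).symm
  rw [h3, mul_assoc] at h1
  exact mul_left_cancel₀ (star_ne_zero.2 hc.ne_zero) h1

/-- The coefficients conj(J) are killed by ∂, so the transformation law of G_β̄ may be
differentiated in every (1,0)-direction, base directions included, without extra terms. This is why
horizontality is invariant. -/
theorem dHol_gBar (hq : q ∈ slit W) (β : Fin n) {L : Pn n →L[ℂ] Pn n}
    (hL : HasFDerivAt (tangentLift f ζ) L q) (X : Pn n) :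
    ζ * dHol (gBar g β) q X =
      ∑ τ, star (jac f q.1 τ β) * dHol (gBar g' τ) (tangentLift f ζ q) (L X) := by
  have hd : ∀ τ, DifferentiableAt ℝ (fun q => gBar g' τ (tangentLift f ζ q)) q := fun τ =>
    hc.differentiableAt_comp hg' (hg'.contDiffOn_gBar τ) hq
  have hj : ∀ τ, DifferentiableAt ℝ (fun q : Pn n => star (jac f q.1 τ β)) q := fun τ =>
    ((hc.differentiableAt_jac hq τ β).restrictScalars ℝ).star
  rw [← dHol_const_mul ζ (hg.differentiableAt (hg.contDiffOn_gBar β) (slit_subset hWU hq)),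
    dHol_congr_on hc.isOpen_slit hq (fun r hr => hc.gBar_eq hg hg' hWU hr β),
    dHol_sum fun τ _ => (hj τ).fun_mul (hd τ)]
  refine Finset.sum_congr rfl fun τ _ => ?_
  rw [dHol_mul (hj τ) (hd τ), dHol_star_of_differentiableAt (hc.differentiableAt_jac hq τ β),
    dHol_comp (hg'.differentiableAt (hg'.contDiffOn_gBar τ) (hc.lift_mem hq)) hL]
  ring

/-- The case of a fibre direction. The chain rule supplies a second factor ζ, which cancels, so
G_{αβ̄} does not see the dilation. -/
theorem gCoef_eq' (hq : q ∈ slit W) (α β : Fin n) :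
    gCoef g α β q = ∑ σ, ∑ τ, jac f q.1 σ α * star (jac f q.1 τ β) *
      gCoef g' σ τ (tangentLift f ζ q) := by
  obtain ⟨L, hL, hLe⟩ := hc.exists_hasFDerivAt_lift hq
  have h := hc.dHol_gBar hg hg' hWU hq β hL (0, unit α)
  rw [hLe] at h
  simp only [map_zero, zero_apply, add_zero] at h
  have h2 : (0, ζ • fderiv ℂ f q.1 (unit α)) = ζ • ((0, fderiv ℂ f q.1 (unit α)) : Pn n) := by
    simp
  apply mul_left_cancel₀ hc.ne_zero
  rw [gCoef_eq, h, Finset.sum_comm, Finset.mul_sum]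
  refine Finset.sum_congr rfl fun τ _ => ?_
  rw [h2, dHol_smul_right, dHol_fibre, Finset.mul_sum, Finset.mul_sum, Finset.mul_sum]
  refine Finset.sum_congr rfl fun σ _ => ?_
  rw [gCoef_eq]; simp only [jac, Matrix.of_apply]; ring

theorem levi_eq (hq : q ∈ slit W) :
    levi g q = (jac f q.1).transpose * levi g' (tangentLift f ζ q) * (jac f q.1).map star := by
  ext α β
  have := hc.gCoef_eq' hg hg' hWU hq α β
  rw [gCoef] at this
  rw [this, Finset.sum_comm]
  simp only [Matrix.mul_apply, Matrix.transpose_apply, Matrix.map_apply, Finset.sum_mul]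
  refine Finset.sum_congr rfl fun τ _ => Finset.sum_congr rfl fun σ _ => ?_
  rw [gCoef]; ring

theorem det_levi_eq (hq : q ∈ slit W) :
    (levi g q).det = (jac f q.1).det * star (jac f q.1).det * (levi g' (tangentLift f ζ q)).det := by
  rw [hc.levi_eq hg hg' hWU hq, Matrix.det_mul, Matrix.det_mul, Matrix.det_transpose]
  have : ((jac f q.1).map star).det = star (jac f q.1).det :=
    ((starRingEnd ℂ).map_det (jac f q.1)).symm
  rw [this]; ring

theorem gInv_eq (hq : q ∈ slit W) (τ σ : Fin n) :
    gInv g' (tangentLift f ζ q) τ σ =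
      ∑ α, ∑ β, star (jac f q.1 τ β) * gInv g q β α * jac f q.1 σ α := by
  have hJ := isUnit_iff_ne_zero.2 (hc.det_jac_ne_zero hq.1)
  have hJs : IsUnit ((jac f q.1).map star).det := by
    have : ((jac f q.1).map star).det = star (jac f q.1).det :=
      ((starRingEnd ℂ).map_det (jac f q.1)).symm
    rw [this]; exact hJ.star
  have hJt : IsUnit (jac f q.1).transpose.det := by rwa [Matrix.det_transpose]
  have : (levi g' (tangentLift f ζ q))⁻¹ =
      (jac f q.1).map star * (levi g q)⁻¹ * (jac f q.1).transpose := by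
    rw [hc.levi_eq hg hg' hWU hq, Matrix.mul_inv_rev, Matrix.mul_inv_rev, ← Matrix.mul_assoc,
      Matrix.mul_nonsing_inv _ hJs, Matrix.one_mul, Matrix.mul_assoc, Matrix.nonsing_inv_mul _ hJt,
      Matrix.mul_one]
  rw [gInv, this]
  simp only [Matrix.mul_apply, Matrix.transpose_apply, Matrix.map_apply, Finset.sum_mul]
  rfl

/-- Contractions with the inverse metric are invariant. -/
theorem contraction_eq (hq : q ∈ slit W) (A A' : Fin n → Fin n → ℂ)
    (hA : ∀ α β, A α β = ∑ σ, ∑ τ, jac f q.1 σ α * star (jac f q.1 τ β) * A' σ τ) :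
    ∑ α, ∑ β, gInv g q β α * A α β =
      ∑ σ, ∑ τ, gInv g' (tangentLift f ζ q) τ σ * A' σ τ := by
  simp only [hA, hc.gInv_eq hg hg' hWU hq, Finset.sum_mul, Finset.mul_sum]
  have e : ∀ (F : Fin n → Fin n → Fin n → Fin n → ℂ),
      ∑ a, ∑ b, ∑ s, ∑ t, F a b s t = ∑ s, ∑ t, ∑ a, ∑ b, F a b s t := by
    intro F
    calc ∑ a, ∑ b, ∑ s, ∑ t, F a b s t = ∑ a, ∑ s, ∑ b, ∑ t, F a b s t :=
          Finset.sum_congr rfl fun _ _ => Finset.sum_comm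
      _ = ∑ s, ∑ a, ∑ b, ∑ t, F a b s t := Finset.sum_comm
      _ = ∑ s, ∑ a, ∑ t, ∑ b, F a b s t :=
          Finset.sum_congr rfl fun _ _ => Finset.sum_congr rfl fun _ _ => Finset.sum_comm
      _ = _ := Finset.sum_congr rfl fun _ _ => Finset.sum_comm
  rw [e]
  refine Finset.sum_congr rfl fun _ _ => Finset.sum_congr rfl fun _ _ =>
    Finset.sum_congr rfl fun _ _ => Finset.sum_congr rfl fun _ _ => by ring

/-- The frame `δ_μ` is covariant. -/
theorem lift_horVec (hq : q ∈ slit W) (μ : Fin n) {L : Pn n →L[ℂ] Pn n}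
    (hL : HasFDerivAt (tangentLift f ζ) L q) :
    L (horVec g μ q) = ∑ σ, jac f q.1 σ μ • horVec g' σ (tangentLift f ζ q) := by
  -- The image of a horizontal vector lies in the kernel of all ∂G'_τ̄: `dHol_gBar` expresses the
  -- vanishing of the old forms through the new ones by the matrix conj(J), which is invertible.
  have h0 : ∀ τ, dHol (gBar g' τ) (tangentLift f ζ q) (L (horVec g μ q)) = 0 := by
    have h1 : ∀ β, ∑ τ, star (jac f q.1 τ β) *
        dHol (gBar g' τ) (tangentLift f ζ q) (L (horVec g μ q)) = 0 := by
      intro β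
      rw [← hc.dHol_gBar hg hg' hWU hq β hL, hg.dHol_gBar_horVec (slit_subset hWU hq), mul_zero]
    have h2 : (jac f q.1).transpose.mulVec (fun τ => star
        (dHol (gBar g' τ) (tangentLift f ζ q) (L (horVec g μ q)))) = 0 := by
      ext β
      have := congrArg star (h1 β)
      simpa [Matrix.mulVec, dotProduct] using this
    have h3 := Matrix.eq_zero_of_mulVec_eq_zero
      (by rw [Matrix.det_transpose]; exact hc.det_jac_ne_zero hq.1) h2
    intro τ
    exact star_eq_zero.1 (congrFun h3 τ)
  obtain ⟨L', hL', hLe⟩ := hc.exists_hasFDerivAt_lift hq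
  obtain rfl := hL.unique hL'
  have := hg'.eq_of_dHol_gBar_eq_zero (hc.lift_mem hq) (u := (L (horVec g μ q)).1)
    (w := (L (horVec g μ q)).2) h0
  rw [Prod.mk.eta] at this
  rw [this]
  refine Finset.sum_congr rfl fun σ _ => ?_
  congr 1
  rw [horVec, hLe]; rfl

/-- The derivative `δ_μ(φ_β̄)` of the coefficients of a horizontal `(0,1)`-form is covariant. -/
theorem dHol_horVec_anti {φ φ' : Fin n → Pn n → ℂ}
    (hφ' : ∀ τ, ContDiffOn ℝ ∞ (φ' τ) (slit U'))
    (h : ∀ β, ∀ q ∈ slit W, φ β q = ∑ τ, star (jac f q.1 τ β) * φ' τ (tangentLift f ζ q))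
    (hq : q ∈ slit W) (α β : Fin n) :
    dHol (φ β) q (horVec g α q) = ∑ σ, ∑ τ, jac f q.1 σ α * star (jac f q.1 τ β) *
      dHol (φ' τ) (tangentLift f ζ q) (horVec g' σ (tangentLift f ζ q)) := by
  obtain ⟨L, hL, hLe⟩ := hc.exists_hasFDerivAt_lift hq
  have hd : ∀ τ, DifferentiableAt ℝ (fun q => φ' τ (tangentLift f ζ q)) q := fun τ =>
    hc.differentiableAt_comp hg' (hφ' τ) hq
  have hj : ∀ τ, DifferentiableAt ℝ (fun q : Pn n => star (jac f q.1 τ β)) q := fun τ =>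
    ((hc.differentiableAt_jac hq τ β).restrictScalars ℝ).star
  rw [dHol_congr_on hc.isOpen_slit hq (h β), dHol_sum fun τ _ => (hj τ).fun_mul (hd τ),
    Finset.sum_comm]
  refine Finset.sum_congr rfl fun τ _ => ?_
  rw [dHol_mul (hj τ) (hd τ), dHol_star_of_differentiableAt (hc.differentiableAt_jac hq τ β),
    dHol_comp (hg'.differentiableAt (hφ' τ) (hc.lift_mem hq)) hL,
    hc.lift_horVec hg hg' hWU hq α hL, dHol_sum_right, zero_mul, zero_add, Finset.mul_sum]
  refine Finset.sum_congr rfl fun σ _ => ?_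
  rw [dHol_smul_right]; ring

/-- The only inhomogeneous term is the second derivative of `f` in the base part of X and e_δ. It is
symmetric in the two, hence disappears under antisymmetrization. -/
theorem dHol_gCoef (hq : q ∈ slit W) (δ l : Fin n) {L : Pn n →L[ℂ] Pn n}
    (hL : HasFDerivAt (tangentLift f ζ) L q) (X : Pn n) :
    dHol (gCoef g δ l) q X = ∑ σ, ∑ τ, star (jac f q.1 τ l) *
      (fderiv ℂ (fderiv ℂ f) q.1 X.1 (unit δ) σ * gCoef g' σ τ (tangentLift f ζ q) +
        jac f q.1 σ δ * dHol (gCoef g' σ τ) (tangentLift f ζ q) (L X)) := by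
  have hd : ∀ σ τ, DifferentiableAt ℝ (fun q => gCoef g' σ τ (tangentLift f ζ q)) q := fun σ τ =>
    hc.differentiableAt_comp hg' (hg'.contDiffOn_gCoef σ τ) hq
  have hj : ∀ σ, DifferentiableAt ℝ (fun q : Pn n => jac f q.1 σ δ) q := fun σ =>
    (hc.differentiableAt_jac hq σ δ).restrictScalars ℝ
  have hjs : ∀ τ, DifferentiableAt ℝ (fun q : Pn n => star (jac f q.1 τ l)) q := fun τ =>
    ((hc.differentiableAt_jac hq τ l).restrictScalars ℝ).star
  rw [dHol_congr_on hc.isOpen_slit hq (fun r hr => hc.gCoef_eq' hg hg' hWU hr δ l),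
    dHol_sum fun σ _ => DifferentiableAt.fun_sum fun τ _ => ((hj σ).fun_mul (hjs τ)).fun_mul (hd σ τ)]
  refine Finset.sum_congr rfl fun σ _ => ?_
  rw [dHol_sum fun τ _ => ((hj σ).fun_mul (hjs τ)).fun_mul (hd σ τ)]
  refine Finset.sum_congr rfl fun τ _ => ?_
  rw [dHol_mul ((hj σ).fun_mul (hjs τ)) (hd σ τ), dHol_mul (hj σ) (hjs τ),
    dHol_star_of_differentiableAt (hc.differentiableAt_jac hq τ l), hc.dHol_jac hq,
    dHol_comp (hg'.differentiableAt (hg'.contDiffOn_gCoef σ τ) (hc.lift_mem hq)) hL]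
  ring

/-- The torsion trace is covariant. -/
theorem tors_eq (hq : q ∈ slit W) (δ : Fin n) :
    tors g δ q = ∑ σ, jac f q.1 σ δ * tors g' σ (tangentLift f ζ q) := by
  obtain ⟨L, hL, hLe⟩ := hc.exists_hasFDerivAt_lift hq
  have h := hc.contraction_eq hg hg' hWU hq
    (fun α l => dHol (gCoef g δ l) q (horVec g α q) - dHol (gCoef g α l) q (horVec g δ q))
    (fun ρ τ => ∑ σ, jac f q.1 σ δ * (dHol (gCoef g' σ τ) (tangentLift f ζ q)
        (horVec g' ρ (tangentLift f ζ q)) - dHol (gCoef g' ρ τ) (tangentLift f ζ q)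
        (horVec g' σ (tangentLift f ζ q)))) ?_
  · rw [tors, h]
    simp only [tors, Finset.mul_sum]
    rw [Finset.sum_comm' (t' := Finset.univ) (s' := fun _ => Finset.univ) (by simp)]
    rw [Finset.sum_comm]
    have e : ∀ (F : Fin n → Fin n → Fin n → ℂ),
      ∑ a, ∑ b, ∑ s, F a b s = ∑ s, ∑ b, ∑ a, F b a s := by
      intro F
      calc ∑ a, ∑ b, ∑ s, F a b s = ∑ a, ∑ s, ∑ b, F a b s :=
            Finset.sum_congr rfl fun _ _ => Finset.sum_comm
        _ = _ := Finset.sum_comm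
    rw [e]
    refine Finset.sum_congr rfl fun _ _ => Finset.sum_congr rfl fun _ _ =>
      Finset.sum_congr rfl fun _ _ => by ring
  · intro α l
    rw [hc.dHol_gCoef hg hg' hWU hq δ l hL, hc.dHol_gCoef hg hg' hWU hq α l hL,
      hc.lift_horVec hg hg' hWU hq α hL, hc.lift_horVec hg hg' hWU hq δ hL]
    simp only [dHol_sum_right, dHol_smul_right, horVec]
    -- The Hessian terms of the two summands now agree and cancel in the difference; the remaining
    -- terms are tensorial.
    rw [hc.fderiv_fderiv_comm hq.1 (unit α) (unit δ)]
    simp only [mul_add, Finset.sum_add_distrib, mul_sub, Finset.sum_sub_distrib, Finset.mul_sum]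
    rw [add_sub_add_left_eq_sub]
    congr 1
    · calc _ = ∑ σ, ∑ ρ, ∑ τ, _ := Finset.sum_congr rfl fun _ _ => Finset.sum_comm
        _ = ∑ ρ, ∑ σ, ∑ τ, _ := Finset.sum_comm
        _ = ∑ ρ, ∑ τ, ∑ σ, _ := Finset.sum_congr rfl fun _ _ => Finset.sum_comm
        _ = _ := ?_
      refine Finset.sum_congr rfl fun _ _ => Finset.sum_congr rfl fun _ _ =>
        Finset.sum_congr rfl fun _ _ => by ring
    · refine Finset.sum_congr rfl fun _ _ => Finset.sum_congr rfl fun _ _ =>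
        Finset.sum_congr rfl fun _ _ => by ring

/-- The logarithmic ∂-derivative of det G = |det J|² det G'. The conjugate of det J contributes
nothing, so the correction is ∂ log det J, which is holomorphic. -/
theorem logDet_eq (hq : q ∈ slit W) {L : Pn n →L[ℂ] Pn n}
    (hL : HasFDerivAt (tangentLift f ζ) L q) (X : Pn n) :
    logDet g X q = dHol (fun q => (jac f q.1).det) q X / (jac f q.1).det +
      logDet g' (L X) (tangentLift f ζ q) := by
  have hq' := slit_subset hWU hq
  have hJ := hc.det_jac_ne_zero hq.1
  have hdet : DifferentiableAt ℂ (fun q : Pn n => (jac f q.1).det) q :=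
    (hc.contDiffOn_det_jac.contDiffAt (hc.isOpen_slit.mem_nhds hq)).differentiableAt (by simp)
  have hdR := hdet.restrictScalars ℝ
  have hd' : ContDiffOn ℝ ∞ (fun q => (levi g' q).det) (slit U') :=
    contDiffOn_det fun i j => hg'.contDiffOn_gCoef i j
  have h1 := hg.dHol_det_levi hq' X
  have hne := hg.det_ne_zero hq'
  have hd2 : DifferentiableAt ℝ (fun q => (levi g' (tangentLift f ζ q)).det) q :=
    hc.differentiableAt_comp hg' hd' hq
  rw [dHol_congr_on hc.isOpen_slit hq (fun r hr => hc.det_levi_eq hg hg' hWU hr),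
    dHol_mul (f := fun q => (jac f q.1).det * star (jac f q.1).det)
      (hdR.fun_mul hdR.star) hd2, dHol_mul hdR hdR.star,
    dHol_star_of_differentiableAt hdet,
    dHol_comp (f := fun q => (levi g' q).det) (hg'.differentiableAt hd' (hc.lift_mem hq)) hL,
    hg'.dHol_det_levi (hc.lift_mem hq), hc.det_levi_eq hg hg' hWU hq] at h1
  have hJs : star (jac f q.1).det ≠ 0 := star_ne_zero.2 hJ
  have hne' := hg'.det_ne_zero (hc.lift_mem hq)
  field_simp
  apply mul_left_cancel₀ (mul_ne_zero hJs hne')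
  linear_combination -h1

/-- The Levi form of `log det G` on horizontal vectors is covariant. -/
theorem levi_logDet_eq (hq : q ∈ slit W) (μ ν : Fin n) :
    dAnti (logDet g (horVec g μ q)) q (horVec g ν q) =
      ∑ σ, ∑ τ, jac f q.1 σ μ * star (jac f q.1 τ ν) *
        dAnti (logDet g' (horVec g' σ (tangentLift f ζ q))) (tangentLift f ζ q)
          (horVec g' τ (tangentLift f ζ q)) := by
  obtain ⟨L, hL, hLe⟩ := hc.exists_hasFDerivAt_lift hq
  have hadd : ∀ (X Y : Pn n) p, logDet g' (X + Y) p = logDet g' X p + logDet g' Y p := fun X Y p => by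
    simp only [logDet, dHol_add_right, mul_add, Finset.sum_add_distrib]
  have hsmul : ∀ (c : ℂ) (X : Pn n) p, logDet g' (c • X) p = c * logDet g' X p := fun c X p => by
    simp only [logDet, dHol_smul_right, Finset.mul_sum, mul_left_comm]
  have hsum : ∀ (X : Fin n → Pn n) p, logDet g' (∑ i, X i) p = ∑ i, logDet g' (X i) p := by
    intro X p
    simp only [logDet, dHol_sum_right, Finset.mul_sum]
    calc _ = ∑ a, ∑ i, ∑ l, _ := Finset.sum_congr rfl fun _ _ => Finset.sum_comm
      _ = _ := Finset.sum_comm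
  have hpair : ∀ (u w : Cn n) p, logDet g' (u, w) p =
      (∑ α, u α * logDet g' (unit α, 0) p) + ∑ α, w α * logDet g' (0, unit α) p := by
    intro u w p
    have : ((u, w) : Pn n) = (u, 0) + (0, w) := by simp
    rw [this, hadd, sum_base, sum_fibre, hsum, hsum]
    simp only [hsmul]
  set X := horVec g μ q with hX
  set Z := horVec g ν q with hZ
  -- The image of the constant vector X under the derivative of the lift at a variable point r. Its
  -- components are holomorphic in r, so ∂̄ differentiates only the factors that involve G'.
  let Y : Pn n → Pn n := fun r => (fderiv ℂ f r.1 X.1,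
    ζ • (fderiv ℂ f r.1 X.2 + fderiv ℂ (fderiv ℂ f) r.1 X.1 r.2))
  have hYq : Y q = L X := (hLe X.1 X.2).symm
  have hY : DifferentiableAt ℂ Y q := by
    have hq1 := hc.isOpen.mem_nhds hq.1
    have h1 : DifferentiableAt ℂ (fun r : Pn n => fderiv ℂ f r.1) q :=
      (hc.differentiableAt_fderiv hq.1).comp q differentiableAt_fst
    have h2 : DifferentiableAt ℂ (fun r : Pn n => fderiv ℂ (fderiv ℂ f) r.1) q :=
      (((hc.contDiffOn_fderiv.fderiv_of_isOpen hc.isOpen (m := ω) (by simp)).contDiffAt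
        hq1).differentiableAt (by simp)).comp q differentiableAt_fst
    exact (h1.clm_apply (differentiableAt_const _)).prodMk
      (((h1.clm_apply (differentiableAt_const _)).add
        ((h2.clm_apply (differentiableAt_const _)).clm_apply differentiableAt_snd)).const_smul ζ)
  have hY1 : ∀ α, DifferentiableAt ℂ (fun r => (Y r).1 α) q := fun α =>
    differentiableAt_pi.1 hY.fst α
  have hY2 : ∀ α, DifferentiableAt ℂ (fun r => (Y r).2 α) q := fun α =>
    differentiableAt_pi.1 hY.snd α
  -- The correction ∂ log det J(X) is holomorphic near q and does not contribute to ∂̄.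
  have hhol : DifferentiableAt ℂ (fun r => dHol (fun q => (jac f q.1).det) r X / (jac f r.1).det) q := by
    have h1 := hc.contDiffOn_det_jac
    have h2 : DifferentiableAt ℂ (fun r => fderiv ℂ (fun q : Pn n => (jac f q.1).det) r X) q :=
      ((((h1.fderiv_of_isOpen hc.isOpen_slit (m := ω) (by simp))).contDiffAt
        (hc.isOpen_slit.mem_nhds hq)).differentiableAt (by simp)).clm_apply (differentiableAt_const _)
    have hd : ∀ r ∈ slit W, DifferentiableAt ℂ (fun q : Pn n => (jac f q.1).det) r := fun r hr =>
      (h1.contDiffAt (hc.isOpen_slit.mem_nhds hr)).differentiableAt (by simp)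
    have h3 : (fun r => dHol (fun q => (jac f q.1).det) r X / (jac f r.1).det) =ᶠ[nhds q]
        fun r => fderiv ℂ (fun q : Pn n => (jac f q.1).det) r X / (jac f r.1).det := by
      filter_upwards [hc.isOpen_slit.mem_nhds hq] with r hr
      rw [dHol_of_hasFDerivAt (hd r hr).hasFDerivAt]
    have h4 := h2.fun_mul ((hd q hq).fun_inv (hc.det_jac_ne_zero hq.1))
    simp only [← div_eq_mul_inv] at h4
    exact h4.congr_of_eventuallyEq h3
  have hlog : Set.EqOn (logDet g X) (fun r =>
      dHol (fun q => (jac f q.1).det) r X / (jac f r.1).det +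
      ((∑ α, (Y r).1 α * logDet g' (unit α, 0) (tangentLift f ζ r)) +
        ∑ α, (Y r).2 α * logDet g' (0, unit α) (tangentLift f ζ r))) (slit W) := by
    intro r hr
    obtain ⟨L', hL', hLe'⟩ := hc.exists_hasFDerivAt_lift hr
    simp only
    rw [hc.logDet_eq hg hg' hWU hr hL', ← hpair]
    congr 2
    exact hLe' X.1 X.2
  have hcd : ∀ E, ContDiffOn ℝ ∞ (logDet g' E) (slit U') := fun E => hg'.contDiffOn_logDet E
  have hd' : ∀ E, DifferentiableAt ℝ (fun r => logDet g' E (tangentLift f ζ r)) q := fun E =>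
    hc.differentiableAt_comp hg' (hcd E) hq
  have hd2 : ∀ E, DifferentiableAt ℝ (logDet g' E) (tangentLift f ζ q) := fun E =>
    hg'.differentiableAt (hcd E) (hc.lift_mem hq)
  have hterm : ∀ (y : Pn n → ℂ) (E : Pn n), DifferentiableAt ℂ y q →
      dAnti (fun r => y r * logDet g' E (tangentLift f ζ r)) q Z =
        y q * dAnti (logDet g' E) (tangentLift f ζ q) (L Z) := by
    intro y E hy
    rw [dAnti_mul (hy.restrictScalars ℝ) (hd' E), dAnti_of_differentiableAt hy,
      dAnti_comp (hd2 E) hL]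
    ring
  have hr1 := fun α => ((hY1 α).restrictScalars ℝ).fun_mul (hd' (unit α, 0))
  have hr2 := fun α => ((hY2 α).restrictScalars ℝ).fun_mul (hd' (0, unit α))
  have main : dAnti (logDet g X) q Z =
      dAnti (logDet g' (L X)) (tangentLift f ζ q) (L Z) := by
    have e : logDet g' (L X) = fun p => (∑ α, (Y q).1 α * logDet g' (unit α, 0) p) +
        ∑ α, (Y q).2 α * logDet g' (0, unit α) p := by
      funext p
      rw [← hpair, ← hYq]
    rw [e, dAnti_congr_on hc.isOpen_slit hq hlog,
      dAnti_add (hhol.restrictScalars ℝ) ((DifferentiableAt.fun_sum fun α _ => hr1 α).fun_add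
        (DifferentiableAt.fun_sum fun α _ => hr2 α)), dAnti_of_differentiableAt hhol, zero_add,
      dAnti_add (DifferentiableAt.fun_sum fun α _ => hr1 α) (DifferentiableAt.fun_sum fun α _ => hr2 α),
      dAnti_sum fun α _ => hr1 α, dAnti_sum fun α _ => hr2 α,
      dAnti_add (DifferentiableAt.fun_sum fun α _ => (hd2 _).const_mul _)
        (DifferentiableAt.fun_sum fun α _ => (hd2 _).const_mul _),
      dAnti_sum fun α _ => (hd2 _).const_mul _, dAnti_sum fun α _ => (hd2 _).const_mul _]
    congr 1
    · exact Finset.sum_congr rfl fun α _ => by rw [hterm _ _ (hY1 α), dAnti_const_mul _ (hd2 _)]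
    · exact Finset.sum_congr rfl fun α _ => by rw [hterm _ _ (hY2 α), dAnti_const_mul _ (hd2 _)]
  have e : logDet g' (L X) = fun p => ∑ σ, jac f q.1 σ μ *
      logDet g' (horVec g' σ (tangentLift f ζ q)) p := by
    funext p
    rw [hX, hc.lift_horVec hg hg' hWU hq μ hL, hsum]
    simp only [hsmul]
  rw [main, e, dAnti_sum fun σ _ => (hd2 _).const_mul _]
  refine Finset.sum_congr rfl fun σ _ => ?_
  rw [dAnti_const_mul _ (hd2 _), hZ, hc.lift_horVec hg hg' hWU hq ν hL, dAnti_sum_right,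
    Finset.mul_sum]
  refine Finset.sum_congr rfl fun τ _ => ?_
  rw [dAnti_smul_right]; ring

end IsChange

end Change

end ComplexFinsler

namespace ComplexFinsler

/-! ### Homogeneity and the divergence of horizontal fields -/

section Homogeneity

variable {n : ℕ}

theorem jac_id (z : Cn n) (σ α : Fin n) : jac id z σ α = if σ = α then 1 else 0 := by
  simp [jac, unit, Pi.single_apply]

theorem tangentLift_id (ζ : ℂ) (q : Pn n) : tangentLift id ζ q = (q.1, ζ • q.2) := by
  simp [tangentLift]

/-- Euler's relation along a complex fibre direction. -/
theorem fderiv_fibre_of_homogeneous {f : Pn n → ℂ} {q : Pn n} (hf : DifferentiableAt ℝ f q)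
    {φ : ℂ → ℂ} {φ' : ℂ →L[ℝ] ℂ} (hφ : HasFDerivAt φ φ' 1)
    (h : ∀ ζ : ℂ, ζ ≠ 0 → f (q.1, ζ • q.2) = φ ζ * f q) (c : ℂ) :
    fderiv ℝ f q (0, c • q.2) = φ' c * f q := by
  let m : ℂ → Pn n := fun ζ => (q.1, ζ • q.2)
  have hm : HasFDerivAt m (((0 : ℂ →L[ℝ] Cn n)).prod
      ((ContinuousLinearMap.toSpanSingleton ℂ q.2).restrictScalars ℝ)) 1 := by
    refine (hasFDerivAt_const q.1 1).prodMk ?_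
    exact ((ContinuousLinearMap.toSpanSingleton ℂ q.2).restrictScalars ℝ).hasFDerivAt
  have hm1 : m 1 = q := by simp [m]
  have h1 : HasFDerivAt (f ∘ m) _ 1 := HasFDerivAt.comp 1 (by rw [hm1]; exact hf.hasFDerivAt) hm
  have h2 : HasFDerivAt (f ∘ m) (f q • φ') 1 := by
    refine (hφ.mul_const (f q)).congr_of_eventuallyEq ?_
    filter_upwards [isOpen_ne.mem_nhds (one_ne_zero (α := ℂ))] with ζ hζ using h ζ hζ
  have := congrArg (fun L => L c) (h1.unique h2)
  simpa [mul_comm] using this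

namespace IsLocalMetric

variable {U : Set (Cn n)} {g : Pn n → ℝ} (hg : IsLocalMetric U g) {q : Pn n}
include hg

/-- Dilations of the fibres. -/
theorem isChange_dilation {ζ : ℂ} (hζ : ζ ≠ 0) : IsChange U U g g id ζ where
  isOpen := hg.isOpen
  smooth := contDiff_id.contDiffOn
  mapsTo := Set.mapsTo_id U
  injective z _ v h := by simpa using h
  ne_zero := hζ
  eq q hq := by rw [tangentLift_id, hg.homog _ hq.1]

/-- Homogeneity of the derivatives of G is the transformation law for the change with identity base
map and fibre factor ζ. -/
theorem gBar_smul {ζ : ℂ} (hζ : ζ ≠ 0) (hq : q ∈ slit U) (β : Fin n) :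
    gBar g β (q.1, ζ • q.2) = ζ * gBar g β q := by
  rw [(hg.isChange_dilation hζ).gBar_eq hg hg subset_rfl hq]
  simp [jac_id, tangentLift_id, apply_ite]

theorem gCoef_smul {ζ : ℂ} (hζ : ζ ≠ 0) (hq : q ∈ slit U) (α β : Fin n) :
    gCoef g α β (q.1, ζ • q.2) = gCoef g α β q := by
  rw [(hg.isChange_dilation hζ).gCoef_eq' hg hg subset_rfl hq]
  simp [jac_id, tangentLift_id, apply_ite]

theorem levi_smul {ζ : ℂ} (hζ : ζ ≠ 0) (hq : q ∈ slit U) :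
    levi g (q.1, ζ • q.2) = levi g q := by
  ext α β; exact hg.gCoef_smul hζ hq α β

/-- `G_{αβ̄} v^α = G_β̄`. -/
theorem sum_gCoef_mul (hq : q ∈ slit U) (β : Fin n) :
    ∑ α, q.2 α * gCoef g α β q = gBar g β q := by
  have hd := hg.differentiableAt (hg.contDiffOn_gBar β) hq
  have h := fderiv_fibre_of_homogeneous hd (hasFDerivAt_id (𝕜 := ℝ) (1 : ℂ))
    (fun ζ hζ => hg.gBar_smul hζ hq β)
  have h1 : dHol (gBar g β) q (0, q.2) = gBar g β q := by
    have h2 : (Complex.I • ((0, q.2) : Pn n)) = (0, Complex.I • q.2) := by simp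
    have h3 := h 1
    rw [one_smul] at h3
    rw [dHol, h2, h, h3]
    simp only [ContinuousLinearMap.id_apply]
    linear_combination (-1 / 2) * gBar g β q * Complex.I_mul_I
  rw [← h1, dHol_fibre]; rfl

/-- `G_β̄ v̄^β = G`. -/
theorem sum_gBar_mul (hq : q ∈ slit U) : ∑ β, star (q.2 β) * gBar g β q = g q := by
  have hd := hg.differentiableAt hg.contDiffOn_coe hq
  have hφ : HasFDerivAt (fun ζ : ℂ => ζ * star ζ)
      (ContinuousLinearMap.id ℝ ℂ + ((starL' ℝ : ℂ ≃L[ℝ] ℂ) : ℂ →L[ℝ] ℂ)) 1 := by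
    have := (hasFDerivAt_id (𝕜 := ℝ) (1 : ℂ)).mul
      ((starL' ℝ : ℂ ≃L[ℝ] ℂ) : ℂ →L[ℝ] ℂ).hasFDerivAt
    refine this.congr_fderiv ?_
    ext; simp [add_comm]
  have h := fderiv_fibre_of_homogeneous hd hφ (fun ζ hζ => by
    rw [hg.homog _ hq.1]
    have : ζ * star ζ = (‖ζ‖ ^ 2 : ℂ) := Complex.mul_conj' ζ
    rw [this]; push_cast; rfl)
  have h1 : dAnti (fun r => (g r : ℂ)) q (0, q.2) = g q := by
    have h2 : (Complex.I • ((0, q.2) : Pn n)) = (0, Complex.I • q.2) := by simp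
    have h3 := h 1
    rw [one_smul] at h3
    rw [dAnti, h2, h, h3]
    simp
    ring
  rw [← h1, dAnti_fibre]; rfl

/-- `δ_μ G = 0`. -/
theorem dHol_coe_horVec (hq : q ∈ slit U) (μ : Fin n) :
    dHol (fun r => (g r : ℂ)) q (horVec g μ q) = 0 := by
  have hd : ∀ β, DifferentiableAt ℂ (fun r : Pn n => r.2 β) q := fun β =>
    differentiableAt_pi.1 differentiableAt_snd β
  have hs : ∀ β, DifferentiableAt ℝ (fun r : Pn n => star (r.2 β)) q := fun β =>
    ((hd β).restrictScalars ℝ).star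
  have hb := fun β => hg.differentiableAt (hg.contDiffOn_gBar β) hq
  -- Write G = v̄^β G_β̄: v̄^β is antiholomorphic and δ_μ annihilates G_β̄.
  rw [dHol_congr_on hg.isOpen_slit hq (fun r hr => (hg.sum_gBar_mul hr).symm),
    dHol_sum fun β _ => (hs β).fun_mul (hb β)]
  refine Finset.sum_eq_zero fun β _ => ?_
  rw [dHol_mul (hs β) (hb β), dHol_star_of_differentiableAt (hd β), hg.dHol_gBar_horVec hq]
  ring

/-- `∂Γ^σ_{;μ} / ∂v^β = G^{λ̄σ} δ_μ G_{βλ̄}`. -/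
theorem dHol_nonlin (hq : q ∈ slit U) (σ μ β : Fin n) :
    dHol (nonlin g σ μ) q (0, unit β) =
      ∑ l, gInv g q l σ * dHol (gCoef g β l) q (horVec g μ q) := by
  have hN := fun α => hg.differentiableAt (hg.contDiffOn_nonlin α μ) hq
  have hC := fun α l => hg.differentiableAt (hg.contDiffOn_gCoef α l) hq
  have hB := fun l => hg.differentiableAt
    (contDiffOn_dHol hg.isOpen_slit (hg.contDiffOn_gBar l) (unit μ, 0)) hq
  have key : ∀ l, ∑ α, dHol (nonlin g α μ) q (0, unit β) * gCoef g α l q =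
      dHol (gCoef g β l) q (horVec g μ q) := by
    intro l
    -- Differentiate the identity δ_μ G_λ̄ = 0 in v^β; exchanging the order of derivatives turns all
    -- terms except those with ∂Γ/∂v^β into δ_μ G_{βλ̄}.
    have h0 : dHol (fun r => dHol (gBar g l) r (unit μ, 0) - ∑ α, nonlin g α μ r * gCoef g α l r)
        q (0, unit β) = 0 := by
      rw [dHol_congr_on (h := fun _ => 0) hg.isOpen_slit hq, dHol_const]
      intro r hr
      have := hg.dHol_gBar_horVec hr l μ
      rwa [dHol_horVec] at this
    rw [dHol_sub (hB l) (DifferentiableAt.fun_sum fun α _ => (hN α).fun_mul (hC α l)),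
      dHol_sum fun α _ => (hN α).fun_mul (hC α l),
      dHol_dHol_comm hg.isOpen_slit (hg.contDiffOn_gBar l) hq] at h0
    simp only [dHol_mul (hN _) (hC _ l), Finset.sum_add_distrib] at h0
    rw [dHol_horVec]
    have hcomm : ∀ α, dHol (gCoef g α l) q (0, unit β) = dHol (gCoef g β l) q (0, unit α) :=
      fun α => dHol_dHol_comm hg.isOpen_slit (hg.contDiffOn_gBar l) hq _ _
    simp only [hcomm] at h0
    simp only [gCoef_eq g β l] at h0 ⊢
    linear_combination -h0
  simp only [← key, Finset.mul_sum]
  rw [Finset.sum_comm]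
  have : ∀ α, ∑ l, gInv g q l σ * (dHol (nonlin g α μ) q (0, unit β) * gCoef g α l q) =
      dHol (nonlin g α μ) q (0, unit β) * if α = σ then 1 else 0 := by
    intro α
    rw [← hg.sum_gCoef_mul_gInv hq, Finset.mul_sum]
    exact Finset.sum_congr rfl fun l _ => by ring
  simp [this]

/-- The fibre divergence of Γ. In the divergence theorem it cancels one of the two logarithmic
derivatives coming from det². -/
theorem sum_dHol_nonlin (hq : q ∈ slit U) (μ : Fin n) :
    ∑ σ, dHol (nonlin g σ μ) q (0, unit σ) = logDet g (horVec g μ q) q := by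
  simp only [hg.dHol_nonlin hq, logDet]

theorem dHol_gInv (hq : q ∈ slit U) (β α : Fin n) (X : Pn n) :
    dHol (fun q => gInv g q β α) q X =
      -∑ σ, ∑ l, gInv g q β σ * dHol (gCoef g σ l) q X * gInv g q l α := by
  have hI := fun l α => hg.differentiableAt (hg.contDiffOn_gInv l α) hq
  have hC := fun α l => hg.differentiableAt (hg.contDiffOn_gCoef α l) hq
  have key : ∀ l, ∑ σ, dHol (fun q => gInv g q β σ) q X * gCoef g σ l q =
      -∑ σ, gInv g q β σ * dHol (gCoef g σ l) q X := by
    intro l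
    have h0 : dHol (fun r => ∑ σ, gInv g r β σ * gCoef g σ l r) q X = 0 := by
      rw [dHol_congr_on hg.isOpen_slit hq (fun r hr => hg.sum_gInv_mul_gCoef hr β l), dHol_const]
    rw [dHol_sum fun σ _ => (hI β σ).fun_mul (hC σ l)] at h0
    simp only [dHol_mul (hI β _) (hC _ l), Finset.sum_add_distrib] at h0
    linear_combination h0
  have e : dHol (fun q => gInv g q β α) q X =
      ∑ l, (∑ σ, dHol (fun q => gInv g q β σ) q X * gCoef g σ l q) * gInv g q l α := by
    simp only [Finset.sum_mul]
    rw [Finset.sum_comm]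
    simp only [mul_assoc, ← Finset.mul_sum, hg.sum_gCoef_mul_gInv hq]
    simp
  rw [e]
  simp only [key, neg_mul, Finset.sum_neg_distrib, Finset.sum_mul]
  rw [Finset.sum_comm]

omit hg in
theorem tors_eq_sub (δ : Fin n) :
    tors g δ q = (∑ α, ∑ l, gInv g q l α * dHol (gCoef g δ l) q (horVec g α q)) -
      logDet g (horVec g δ q) q := by
  simp only [tors, logDet, mul_sub, Finset.sum_sub_distrib]

/-- The divergence of the horizontal field `X^α δ_α` dual to a horizontal `(0,1)`-form. -/
theorem divergence_dual {ψ : Fin n → Pn n → ℂ} (hψ : ∀ β, ContDiffOn ℝ ∞ (ψ β) (slit U))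
    (hq : q ∈ slit U) :
    ∑ α, (dHol (fun q => ∑ β, ψ β q * gInv g q β α) q (horVec g α q) +
        (∑ β, ψ β q * gInv g q β α) * logDet g (horVec g α q) q) =
      ∑ α, ∑ β, gInv g q β α * dHol (ψ β) q (horVec g α q) -
        ∑ α, ∑ β, gInv g q β α * (ψ β q * tors g α q) := by
  have hI := fun l α => hg.differentiableAt (hg.contDiffOn_gInv l α) hq
  have hP := fun β => hg.differentiableAt (hψ β) hq
  simp only [dHol_sum fun β _ => (hP β).fun_mul (hI β _), dHol_mul (hP _) (hI _ _),
    hg.dHol_gInv hq, tors_eq_sub, Finset.sum_add_distrib, mul_sub, Finset.sum_sub_distrib]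
  -- The derivative of the inverse metric supplies the first sum in the torsion trace; the log det
  -- term supplies the second.
  have e1 : ∑ α, ∑ β, ψ β q * -∑ σ, ∑ l, gInv g q β σ * dHol (gCoef g σ l) q (horVec g α q) *
      gInv g q l α = -∑ α, ∑ β, gInv g q β α * (ψ β q * ∑ σ, ∑ l, gInv g q l σ *
        dHol (gCoef g α l) q (horVec g σ q)) := by
    simp only [mul_neg, Finset.sum_neg_distrib, Finset.mul_sum]
    congr 1
    calc _ = ∑ α, ∑ σ, ∑ β, ∑ l, _ := Finset.sum_congr rfl fun _ _ => Finset.sum_comm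
      _ = ∑ σ, ∑ α, ∑ β, ∑ l, _ := Finset.sum_comm
      _ = ∑ σ, ∑ β, ∑ α, ∑ l, _ := Finset.sum_congr rfl fun _ _ => Finset.sum_comm
      _ = _ := Finset.sum_congr rfl fun _ _ => Finset.sum_congr rfl fun _ _ =>
        Finset.sum_congr rfl fun _ _ => Finset.sum_congr rfl fun _ _ => by ring
  have e2 : ∑ α, (∑ β, ψ β q * gInv g q β α) * logDet g (horVec g α q) q =
      ∑ α, ∑ β, gInv g q β α * (ψ β q * logDet g (horVec g α q) q) := by
    simp only [Finset.sum_mul]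
    exact Finset.sum_congr rfl fun _ _ => Finset.sum_congr rfl fun _ _ => by ring
  have e3 : ∑ α, ∑ β, dHol (ψ β) q (horVec g α q) * gInv g q β α =
      ∑ α, ∑ β, gInv g q β α * dHol (ψ β) q (horVec g α q) :=
    Finset.sum_congr rfl fun _ _ => Finset.sum_congr rfl fun _ _ => by ring
  rw [e1, e2, e3]
  ring

end IsLocalMetric

end Homogeneity

/-! ### The difference of the Ricci curvatures -/

section Curvature

variable {n : ℕ}

/-- The trace of the curvature is the curvature of the trace. -/
theorem sum_curv_unit (A : ConnForm n) (X Y : CField n) (p : Pn n) :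
    ∑ γ, curv A X Y (fun _ => unit γ) p γ =
      ∑ γ, act X (fun q => A q (Y q) γ γ) p - ∑ γ, act Y (fun q => A q (X q) γ γ) p -
        ∑ γ, A p (bracket X Y p) γ γ := by
  have hcov : ∀ (Z : CField n) γ, cov A Z (fun _ => unit γ) = fun q α => A q (Z q) α γ := by
    intro Z γ
    funext q α
    simp [cov, act, dHol_const, dAnti_const, unit, Pi.single_apply]
  have h2 : ∀ γ, curv A X Y (fun _ => unit γ) p γ =
      (act X (fun q => A q (Y q) γ γ) p + ∑ β, A p (X p) γ β * A p (Y p) β γ) -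
      (act Y (fun q => A q (X q) γ γ) p + ∑ β, A p (Y p) γ β * A p (X p) β γ) -
      A p (bracket X Y p) γ γ := by
    intro γ
    simp only [curv, hcov, Pi.sub_apply]
    rfl
  simp only [h2, Finset.sum_sub_distrib, Finset.sum_add_distrib]
  -- The quadratic terms are tr(A_X A_Y) and tr(A_Y A_X), so the commutator has trace zero.
  have : ∑ γ, ∑ β, A p (Y p) γ β * A p (X p) β γ = ∑ γ, ∑ β, A p (X p) γ β * A p (Y p) β γ := by
    rw [Finset.sum_comm]
    exact Finset.sum_congr rfl fun _ _ => Finset.sum_congr rfl fun _ _ => mul_comm _ _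
  rw [this]; ring

/-- The base components of δ_μ and δ_ν̄ are constant, so their bracket is vertical; its (1,0)-part
comes only from differentiating Γ_{;μ} along δ_ν̄. -/
theorem bracket_hor_horBar_fst (g : Pn n → ℝ) (μ ν : Fin n) (p : Pn n) :
    (bracket (hor g μ) (horBar g ν) p).1 =
      (0, fun α => dAnti (nonlin g α μ) p (horVec g ν p)) := by
  refine Prod.ext ?_ ?_
  · funext i
    simp [bracket, hor, horBar, act, dHol_const, dAnti_const]
  · funext i
    simp only [bracket, act_horBar]
    simp [hor, horBar, act, dHol_const, dAnti_const, dAnti_neg]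

theorem bracket_hor_horBar_snd_fst (g : Pn n → ℝ) (μ ν : Fin n) (p : Pn n) :
    (bracket (hor g μ) (horBar g ν) p).2.1 = 0 := by
  funext i
  simp [bracket, hor, horBar, act, dHol_const, dAnti_const]

namespace IsLocalMetric

variable {U : Set (Cn n)} {g : Pn n → ℝ} (hg : IsLocalMetric U g) {q : Pn n}
include hg

/-- Lowering an index with G and contracting with the inverse undo each other, which leaves the
trace of the curvature endomorphism. -/
theorem ricciCoef_eq (hq : q ∈ slit U) (A : ConnForm n) (μ ν : Fin n) :
    ricciCoef g A μ ν q = ∑ γ, curv A (hor g μ) (horBar g ν) (fun _ => unit γ) q γ := by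
  simp only [ricciCoef, curvTensor]
  refine Finset.sum_congr rfl fun α _ => ?_
  simp only [Finset.mul_sum]
  rw [Finset.sum_comm]
  have : ∀ γ, ∑ β, gInv g q β α * (curv A (hor g μ) (horBar g ν) (fun _ => unit α) q γ *
      gCoef g γ β q) = curv A (hor g μ) (horBar g ν) (fun _ => unit α) q γ *
        if γ = α then 1 else 0 := by
    intro γ
    rw [← hg.sum_gCoef_mul_gInv hq, Finset.mul_sum]
    exact Finset.sum_congr rfl fun β _ => by ring
  simp [this]

/-- The forms θ are of type (1,0) with trace ∂ log det G, so of the three terms in the curvature of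
the trace the one with θ(δ_ν̄) vanishes. -/
theorem ricciCoef_chernFinsler' (hq : q ∈ slit U) (μ ν : Fin n) :
    ricciCoef g (chernFinsler g) μ ν q =
      -dAnti (fun r => logDet g (horVec g μ r) r) q (horVec g ν q) -
        logDet g (0, fun α => dAnti (nonlin g α μ) q (horVec g ν q)) q := by
  have hd : ∀ γ, DifferentiableAt ℝ
      (fun r => ∑ l, gInv g r l γ * dHol (gCoef g γ l) r (horVec g μ r)) q := fun γ =>
    hg.differentiableAt (ContDiffOn.sum fun l _ => (hg.contDiffOn_gInv l γ).mul
      (hg.contDiffOn_dHol_horVec (hg.contDiffOn_gCoef γ l) μ)) hq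
  rw [hg.ricciCoef_eq hq, sum_curv_unit]
  simp only [act_hor, act_horBar, chernFinsler, bracket_hor_horBar_fst]
  have e1 : ∀ γ r, ∑ l, gInv g r l γ * dHol (gCoef g γ l) r (horBar g ν r).1 = 0 := by
    intro γ r; simp [horBar, dHol_zero_right]
  simp only [e1, dHol_const, Finset.sum_const_zero, zero_sub]
  have e2 := dAnti_sum (s := Finset.univ) (u := horVec g ν q) fun γ _ => hd γ
  rw [logDet]
  congr 2
  exact e2.symm

/-- Freezing the direction δ_μ at its value at q absorbs the bracket term, which is exactly the
derivative of the coefficients Γ_{;μ} of δ_μ. What remains is minus the Levi form of log det G on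
horizontal vectors, whose invariance can be checked without transforming the connection. -/
theorem ricciCoef_chernFinsler (hq : q ∈ slit U) (μ ν : Fin n) :
    ricciCoef g (chernFinsler g) μ ν q =
      -dAnti (logDet g (horVec g μ q)) q (horVec g ν q) := by
  have hadd : ∀ (X : Pn n) r, logDet g X r = (∑ α, X.1 α * logDet g (unit α, 0) r) +
      ∑ α, X.2 α * logDet g (0, unit α) r := by
    intro X r
    have : ∀ (f : Pn n → ℂ), dHol f r X = (∑ α, X.1 α * dHol f r (unit α, 0)) +
        ∑ α, X.2 α * dHol f r (0, unit α) := by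
      intro f
      rw [← dHol_base, ← dHol_fibre, ← dHol_pair]
    simp only [logDet, this, mul_add, Finset.sum_add_distrib, Finset.mul_sum]
    congr 1
    · calc _ = ∑ a, ∑ i, ∑ l, _ := Finset.sum_congr rfl fun _ _ => Finset.sum_comm
        _ = ∑ i, ∑ a, ∑ l, _ := Finset.sum_comm
        _ = _ := Finset.sum_congr rfl fun _ _ => Finset.sum_congr rfl fun _ _ =>
          Finset.sum_congr rfl fun _ _ => by ring
    · calc _ = ∑ a, ∑ i, ∑ l, _ := Finset.sum_congr rfl fun _ _ => Finset.sum_comm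
        _ = ∑ i, ∑ a, ∑ l, _ := Finset.sum_comm
        _ = _ := Finset.sum_congr rfl fun _ _ => Finset.sum_congr rfl fun _ _ =>
          Finset.sum_congr rfl fun _ _ => by ring
  have hN := fun α => hg.differentiableAt (hg.contDiffOn_nonlin α μ) hq
  have hL := fun E => hg.differentiableAt (hg.contDiffOn_logDet E) hq
  rw [hg.ricciCoef_chernFinsler' hq]
  have e1 : (fun r => logDet g (horVec g μ r) r) = fun r => logDet g (unit μ, 0) r -
      ∑ α, nonlin g α μ r * logDet g (0, unit α) r := by
    funext r
    rw [hadd]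
    simp [horVec, unit, Pi.single_apply, sub_eq_add_neg]
  have e2 : logDet g (horVec g μ q) = fun r => logDet g (unit μ, 0) r -
      ∑ α, nonlin g α μ q * logDet g (0, unit α) r := by
    funext r
    rw [hadd]
    simp [horVec, unit, Pi.single_apply, sub_eq_add_neg]
  rw [e1, e2, dAnti_sub (hL _) (DifferentiableAt.fun_sum fun α _ => (hN α).fun_mul (hL _)),
    dAnti_sub (hL _) (DifferentiableAt.fun_sum fun α _ => (hL _).const_mul _),
    dAnti_sum fun α _ => (hN α).fun_mul (hL _), dAnti_sum fun α _ => (hL _).const_mul _,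
    hadd (0, _)]
  simp only [dAnti_mul (hN _) (hL _), dAnti_const_mul _ (hL _), Finset.sum_add_distrib]
  simp
  ring

omit hg in
-- Half of the symmetrized expression is the trace of D; the other half has the indices β and μ
-- exchanged and differs from that trace by T_μ.
theorem sum_coefL (μ : Fin n) :
    ∑ γ, coefL g γ γ μ q = logDet g (horVec g μ q) q + (1 / 2) * tors g μ q := by
  simp only [coefL, act_hor, mul_add, Finset.sum_add_distrib, tors_eq_sub, logDet]
  simp only [← Finset.mul_sum]
  ring

theorem star_dHol_gCoef (hq : q ∈ slit U) (α β : Fin n) (X : Pn n) :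
    star (dHol (gCoef g α β) q X) = dAnti (gCoef g β α) q X := by
  rw [← dAnti_star]
  exact dAnti_congr_on hg.isOpen_slit hq fun r hr => hg.star_gCoef hr α β

/-- Hermitian symmetry turns the antisymmetrized δ_ν̄-derivatives of G into conjugates of those that
define T_ν, with the opposite sign. -/
theorem sum_coefLBar (hq : q ∈ slit U) (ν : Fin n) :
    ∑ γ, coefLBar g γ γ ν q = -(1 / 2) * star (tors g ν q) := by
  simp only [coefLBar, act_horBar, tors, star_sum, star_mul', star_sub, hg.star_gInv hq,
    hg.star_dHol_gCoef hq]
  rw [← Finset.mul_sum, Finset.sum_comm, neg_mul, ← mul_neg, ← Finset.sum_neg_distrib]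
  congr 1
  refine Finset.sum_congr rfl fun _ _ => ?_
  rw [← Finset.sum_neg_distrib]
  exact Finset.sum_congr rfl fun _ _ => by ring

theorem contDiffOn_coefL (γ μ : Fin n) : ContDiffOn ℝ ∞ (coefL g γ γ μ) (slit U) := by
  unfold coefL
  simp only [act_hor]
  exact contDiffOn_const.mul (ContDiffOn.sum fun l _ => (hg.contDiffOn_gInv l γ).mul
    ((hg.contDiffOn_dHol_horVec (hg.contDiffOn_gCoef _ _) _).add
      (hg.contDiffOn_dHol_horVec (hg.contDiffOn_gCoef _ _) _)))

theorem contDiffOn_coefLBar (γ μ : Fin n) : ContDiffOn ℝ ∞ (coefLBar g γ γ μ) (slit U) := by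
  unfold coefLBar
  simp only [act_horBar]
  refine contDiffOn_const.mul (ContDiffOn.sum fun l _ => (hg.contDiffOn_gInv l γ).mul
    ((hg.contDiffOn_dAnti_horVec (hg.contDiffOn_gCoef _ _) _).sub
      (hg.contDiffOn_dAnti_horVec (hg.contDiffOn_gCoef _ _) _)))

/-- On the vertical bracket only the coefficients C act, and their trace is the vertical part of ∂
log det G. The bracket term is therefore the same as for D and cancels in the difference. -/
theorem ricciCoef_canonical (hq : q ∈ slit U) (μ ν : Fin n) :
    ricciCoef g (canonical g) μ ν q =
      dHol (fun r => ∑ γ, coefLBar g γ γ ν r) q (horVec g μ q) -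
      dAnti (fun r => ∑ γ, coefL g γ γ μ r) q (horVec g ν q) -
        logDet g (0, fun α => dAnti (nonlin g α μ) q (horVec g ν q)) q := by
  rw [hg.ricciCoef_eq hq, sum_curv_unit]
  have hdel : ∀ r σ, deltaV g r (hor g μ r) σ = 0 := by
    intro r σ
    simp [deltaV, hor, unit, Pi.single_apply]
  have hdelB : ∀ r σ, deltaV g r (horBar g ν r) σ = 0 := by
    intro r σ
    simp [deltaV, horBar]
  have e1 : ∀ γ r, canonical g r (horBar g ν r) γ γ = coefLBar g γ γ ν r := by
    intro γ r
    simp only [canonical, hdelB]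
    simp [horBar, unit, Pi.single_apply]
  have e2 : ∀ γ r, canonical g r (hor g μ r) γ γ = coefL g γ γ μ r := by
    intro γ r
    simp only [canonical, hdel]
    simp [hor, unit, Pi.single_apply]
  have e3 : ∑ γ, canonical g q (bracket (hor g μ) (horBar g ν) q) γ γ =
      logDet g (0, fun α => dAnti (nonlin g α μ) q (horVec g ν q)) q := by
    simp only [canonical, deltaV, bracket_hor_horBar_fst, bracket_hor_horBar_snd_fst]
    simp only [Pi.zero_apply, mul_zero, Finset.sum_const_zero, zero_add, add_zero, coefC, act_vert,
      logDet, dHol_fibre _ _ (fun α => dAnti (nonlin g α μ) q (horVec g ν q))]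
    refine Finset.sum_congr rfl fun γ _ => ?_
    simp only [Finset.sum_mul, Finset.mul_sum]
    rw [Finset.sum_comm]
    exact Finset.sum_congr rfl fun _ _ => Finset.sum_congr rfl fun _ _ => by ring
  simp only [act_hor, act_horBar, e1, e2, e3]
  rw [dHol_sum fun γ _ => hg.differentiableAt (hg.contDiffOn_coefLBar γ ν) hq,
    dAnti_sum fun γ _ => hg.differentiableAt (hg.contDiffOn_coefL γ μ) hq]

/-- The difference of the Ricci curvatures of the two connections. -/
theorem ricciCoef_sub (hq : q ∈ slit U) (μ ν : Fin n) :
    ricciCoef g (chernFinsler g) μ ν q - ricciCoef g (canonical g) μ ν q =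
      (1 / 2) * (dHol (fun r => star (tors g ν r)) q (horVec g μ q) +
        dAnti (tors g μ) q (horVec g ν q)) := by
  have hT := fun δ => hg.differentiableAt (hg.contDiffOn_tors δ) hq
  have hL : DifferentiableAt ℝ (fun r => logDet g (horVec g μ r) r) q :=
    hg.differentiableAt (ContDiffOn.sum fun γ _ => ContDiffOn.sum fun l _ =>
      (hg.contDiffOn_gInv l γ).mul (hg.contDiffOn_dHol_horVec (hg.contDiffOn_gCoef γ l) μ)) hq
  rw [hg.ricciCoef_chernFinsler' hq, hg.ricciCoef_canonical hq,
    dHol_congr_on hg.isOpen_slit hq (fun r hr => hg.sum_coefLBar hr ν),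
    dAnti_congr_on hg.isOpen_slit hq (fun r _ => sum_coefL μ),
    dHol_const_mul _ (hT ν).star, dAnti_add hL ((hT μ).const_mul _), dAnti_const_mul _ (hT μ)]
  ring

end IsLocalMetric

end Curvature

end ComplexFinsler

namespace ComplexFinsler

/-! ### Integration in local coordinates -/

section Integration

variable {n : ℕ}

/-- A point lies in the open set S, where the extension is f, or outside the closed set C, where it
is zero nearby. -/
theorem contDiff_indicator {S C : Set (Pn n)} (hS : IsOpen S) (hC : IsClosed C) (hCS : C ⊆ S)
    {f : Pn n → ℂ} (hf : ContDiffOn ℝ ∞ f S) (h0 : ∀ q ∈ S, q ∉ C → f q = 0) :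
    ContDiff ℝ ∞ (S.indicator f) := by
  rw [contDiff_iff_contDiffAt]
  intro q
  by_cases hq : q ∈ S
  · refine (hf.contDiffAt (hS.mem_nhds hq)).congr_of_eventuallyEq ?_
    filter_upwards [hS.mem_nhds hq] with r hr using Set.indicator_of_mem hr f
  · refine (contDiffAt_const (c := (0 : ℂ))).congr_of_eventuallyEq ?_
    filter_upwards [hC.isOpen_compl.mem_nhds fun h => hq (hCS h)] with r hr
    by_cases hrS : r ∈ S
    · rw [Set.indicator_of_mem hrS, h0 r hrS hr]
    · exact Set.indicator_of_notMem hrS f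

theorem hasCompactSupport_indicator {S C : Set (Pn n)} (hC : IsCompact C)
    {f : Pn n → ℂ} (h0 : ∀ q ∈ S, q ∉ C → f q = 0) :
    HasCompactSupport (S.indicator f) := by
  refine HasCompactSupport.intro hC fun r hr => ?_
  by_cases hrS : r ∈ S
  · rw [Set.indicator_of_mem hrS, h0 r hrS hr]
  · exact Set.indicator_of_notMem hrS f

theorem continuous_indicator_of_isOpen {S C : Set (Pn n)} (hS : IsOpen S) (hC : IsClosed C)
    (hCS : C ⊆ S) {f : Pn n → ℂ} (hf : ContinuousOn f S) (h0 : ∀ q ∈ S, q ∉ C → f q = 0) :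
    Continuous (S.indicator f) := by
  rw [continuous_iff_continuousAt]
  intro q
  by_cases hq : q ∈ S
  · refine (hf.continuousAt (hS.mem_nhds hq)).congr ?_
    filter_upwards [hS.mem_nhds hq] with r hr using (Set.indicator_of_mem hr f).symm
  · refine (continuousAt_const (y := (0 : ℂ))).congr ?_
    filter_upwards [hC.isOpen_compl.mem_nhds fun h => hq (hCS h)] with r hr
    by_cases hrS : r ∈ S
    · rw [Set.indicator_of_mem hrS, h0 r hrS hr]
    · exact (Set.indicator_of_notMem hrS f).symm

theorem integrableOn_of_compact {S C : Set (Pn n)} (hS : IsOpen S) (hC : IsCompact C)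
    (hCS : C ⊆ S) {f : Pn n → ℂ} (hf : ContinuousOn f S) (h0 : ∀ q ∈ S, q ∉ C → f q = 0) :
    IntegrableOn f S := by
  rw [← integrable_indicator_iff hS.measurableSet]
  exact (continuous_indicator_of_isOpen hS hC.isClosed hCS hf h0).integrable_of_hasCompactSupport
    (hasCompactSupport_indicator hC h0)

/-- The integral of a derivative of a compactly supported function vanishes. -/
theorem setIntegral_dHol_eq_zero {S C : Set (Pn n)} (hS : IsOpen S) (hC : IsCompact C)
    (hCS : C ⊆ S) {f : Pn n → ℂ} (hf : ContDiffOn ℝ ∞ f S) (h0 : ∀ q ∈ S, q ∉ C → f q = 0)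
    (u : Pn n) : IntegrableOn (fun q => dHol f q u) S ∧ ∫ q in S, dHol f q u = 0 := by
  have hsm := contDiff_indicator hS hC.isClosed hCS hf h0
  have hcs := hasCompactSupport_indicator hC h0
  have hd : Differentiable ℝ (S.indicator f) := hsm.differentiable (by simp)
  have hint : ∀ w, Integrable (fun q => fderiv ℝ (S.indicator f) q w) := fun w =>
    ((hsm.continuous_fderiv (by simp)).clm_apply continuous_const).integrable_of_hasCompactSupport
      (hcs.fderiv_apply ℝ w)
  have : (volume : Measure (Pn n)).IsAddHaarMeasure := Measure.prod.instIsAddHaarMeasure _ _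
  have hzero : ∀ w, ∫ q, fderiv ℝ (S.indicator f) q w = 0 := by
    intro w
    -- Integration by parts against the constant function 1.
    have := integral_smul_fderiv_eq_neg_fderiv_smul_of_integrable (μ := (volume : Measure (Pn n)))
      (𝕜 := ℝ) (f := fun _ => (1 : ℝ)) (g := S.indicator f) (v := w)
      (by simp) (by simpa using hint w)
      (by simpa using hsm.continuous.integrable_of_hasCompactSupport hcs)
      (fun _ _ => differentiableAt_const _) (fun _ _ => hd _)
    simpa using this
  have heq : (S.indicator fun q => dHol f q u) = fun q => dHol (S.indicator f) q u := by
    funext q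
    by_cases hq : q ∈ S
    · rw [Set.indicator_of_mem hq]
      exact dHol_congr_on hS hq fun r hr => (Set.indicator_of_mem hr f).symm
    · rw [Set.indicator_of_notMem hq]
      have : S.indicator f =ᶠ[nhds q] fun _ => (0 : ℂ) := by
        filter_upwards [hC.isClosed.isOpen_compl.mem_nhds fun h => hq (hCS h)] with r hr
        by_cases hrS : r ∈ S
        · rw [Set.indicator_of_mem hrS, h0 r hrS hr]
        · exact Set.indicator_of_notMem hrS f
      rw [dHol_congr this, dHol_const]
  have hi2 : Integrable (fun q => dHol (S.indicator f) q u) := by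
    unfold dHol
    exact ((hint _).sub ((hint _).const_mul _)).const_mul _
  refine ⟨?_, ?_⟩
  · rw [← integrable_indicator_iff hS.measurableSet, heq]; exact hi2
  · rw [← integral_indicator hS.measurableSet, heq]
    unfold dHol
    rw [integral_const_mul, integral_sub (hint _) ((hint _).const_mul _), integral_const_mul,
      hzero, hzero]
    simp

/-- The radial cut-off function. -/
def radial : ContDiffBump (2 : ℝ) := ⟨1 / 2, 1, by norm_num, by norm_num⟩

/-- The bump has centre 2 and outer radius 1. The region where G lies in [1, 3] avoids the zero
section and is bounded in each fibre. -/
theorem radial_eq_zero {t : ℝ} (ht : t ∉ Set.Icc (1 : ℝ) 3) : radial t = 0 := by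
  refine radial.zero_of_le_dist ?_
  rw [Real.dist_eq]
  change 1 ≤ _
  by_contra! h
  rw [abs_lt] at h
  exact ht ⟨by linarith, by linarith⟩

theorem radial_two : 0 < radial 2 := by
  rw [radial.one_of_mem_closedBall (by simp [radial])]; norm_num

/-- The density `κ(G) det(G_{αβ̄})²` on the slit tangent bundle. -/
def slitDensity (g : Pn n → ℝ) (q : Pn n) : ℝ := radial (g q) * ((levi g q).det.re) ^ 2

theorem slitDensity_nonneg (g : Pn n → ℝ) (q : Pn n) : 0 ≤ slitDensity g q :=
  mul_nonneg radial.nonneg (sq_nonneg _)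

namespace IsLocalMetric

variable {U : Set (Cn n)} {g : Pn n → ℝ} (hg : IsLocalMetric U g) {q : Pn n}
include hg

theorem det_levi_re (hq : q ∈ slit U) : ((levi g q).det.re : ℂ) = (levi g q).det :=
  (Complex.eq_re_of_ofReal_le (r := 0) (by simpa using (hg.posDef q hq).det_pos.le)).symm

theorem coe_slitDensity (hq : q ∈ slit U) :
    (slitDensity g q : ℂ) = (radial (g q) : ℂ) * ((levi g q).det * (levi g q).det) := by
  rw [slitDensity]; push_cast; rw [hg.det_levi_re hq]; ring

theorem contDiffOn_radial : ContDiffOn ℝ ∞ (fun q => (radial (g q) : ℂ)) (slit U) :=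
  Complex.ofRealCLM.contDiff.comp_contDiffOn (radial.contDiff.comp_contDiffOn hg.smooth)

theorem contDiffOn_det : ContDiffOn ℝ ∞ (fun q => (levi g q).det) (slit U) :=
  ComplexFinsler.contDiffOn_det fun i j => hg.contDiffOn_gCoef i j

theorem contDiffOn_slitDensity : ContDiffOn ℝ ∞ (fun q => (slitDensity g q : ℂ)) (slit U) :=
  (hg.contDiffOn_radial.mul (hg.contDiffOn_det.mul hg.contDiffOn_det)).congr
    fun _ hq => hg.coe_slitDensity hq

theorem continuousOn_slitDensity : ContinuousOn (slitDensity g) (slit U) :=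
  (Complex.continuous_re.comp_continuousOn hg.contDiffOn_slitDensity.continuousOn).congr
    fun _ _ => (Complex.ofReal_re _).symm

/-- Over a compact set of the base, the density is compactly supported. -/
theorem exists_compact {K : Set (Cn n)} (hK : IsCompact K) (hKU : K ⊆ U) :
    ∃ C ⊆ slit U, IsCompact C ∧ ∀ q ∈ slit U, q.1 ∈ K → q ∉ C → slitDensity g q = 0 := by
  have hcomp : IsCompact (K ×ˢ Metric.sphere (0 : Cn n) 1) := hK.prod (isCompact_sphere 0 1)
  have hsub : K ×ˢ Metric.sphere (0 : Cn n) 1 ⊆ slit U := by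
    rintro ⟨z, v⟩ ⟨hz, hv⟩
    refine ⟨hKU hz, ?_⟩
    rintro rfl
    simp at hv
  have hcont := hg.smooth.continuousOn.mono hsub
  obtain ⟨m, hm, hmle⟩ : ∃ m > 0, ∀ q ∈ K ×ˢ Metric.sphere (0 : Cn n) 1, m ≤ g q := by
    rcases (K ×ˢ Metric.sphere (0 : Cn n) 1).eq_empty_or_nonempty with h | h
    · exact ⟨1, one_pos, by simp [h]⟩
    · obtain ⟨q0, hq0, hmin⟩ := hcomp.exists_isMinOn h hcont
      exact ⟨g q0, hg.pos _ (hsub hq0), fun q hq => hmin hq⟩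
  obtain ⟨B, hB⟩ := hcomp.bddAbove_image hcont
  -- The maximum with 1 keeps the bound positive even when the compact set is empty.
  set B' := max B 1 with hB'
  have hB1 : ∀ q ∈ K ×ˢ Metric.sphere (0 : Cn n) 1, g q ≤ B' := fun q hq =>
    (hB ⟨q, hq, rfl⟩).trans (le_max_left _ _)
  have hBpos : 0 < B' := lt_of_lt_of_le one_pos (le_max_right _ _)
  -- With m ≤ G ≤ B' on unit vectors over K, homogeneity and 1 ≤ G ≤ 3 give 1/B' ≤ ‖v‖² ≤ 3/m, a
  -- closed annulus in the fibre.
  refine ⟨K ×ˢ (Metric.closedBall 0 (Real.sqrt (3 / m)) \ Metric.ball 0 (Real.sqrt (1 / B'))),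
    ?_, hK.prod ((isCompact_closedBall _ _).diff Metric.isOpen_ball), ?_⟩
  · rintro ⟨z, v⟩ ⟨hz, hv⟩
    refine ⟨hKU hz, ?_⟩
    rintro rfl
    exact hv.2 (by simpa using hBpos)
  · rintro ⟨z, v⟩ hq hz hn
    rw [slitDensity, radial_eq_zero, zero_mul]
    rintro ⟨h1, h3⟩
    refine hn ⟨hz, ?_⟩
    have hv : v ≠ 0 := hq.2
    have hv0 : 0 < ‖v‖ := norm_pos_iff.2 hv
    have hs : (z, ((‖v‖⁻¹ : ℝ) : ℂ) • v) ∈ K ×ˢ Metric.sphere (0 : Cn n) 1 := by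
      refine ⟨hz, ?_⟩
      simp [norm_smul, hv0.ne']
    have e : g (z, v) = ‖v‖ ^ 2 * g (z, ((‖v‖⁻¹ : ℝ) : ℂ) • v) := by
      rw [hg.homog z hq.1]
      simp [hv0.ne']
    have l1 := hmle _ hs
    have l2 := hB1 _ hs
    rw [e] at h1 h3
    have hsq : 0 < ‖v‖ ^ 2 := by positivity
    constructor
    · rw [mem_closedBall_zero_iff]
      apply Real.le_sqrt_of_sq_le
      rw [le_div_iff₀ hm]
      nlinarith
    · rw [mem_ball_zero_iff, not_lt]
      apply Real.sqrt_le_iff.2 ⟨hv0.le, ?_⟩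
      rw [div_le_iff₀ hBpos]
      nlinarith

theorem integrableOn_mul_slitDensity {K : Set (Cn n)} (hK : IsCompact K) (hKU : K ⊆ U)
    {f : Pn n → ℂ} (hf : ContinuousOn f (slit U)) (h0 : ∀ q ∈ slit U, q.1 ∉ K → f q = 0) :
    IntegrableOn (fun q => f q * slitDensity g q) (slit U) := by
  obtain ⟨C, hCS, hC, hd⟩ := hg.exists_compact hK hKU
  refine integrableOn_of_compact hg.isOpen_slit hC hCS
    (hf.mul hg.contDiffOn_slitDensity.continuousOn) fun q hq hqC => ?_
  by_cases hqK : q.1 ∈ K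
  · rw [hd q hq hqK hqC]; simp
  · rw [h0 q hq hqK]; simp

/-- `δ_μ (κ(G) det²) = 2 κ(G) det² δ_μ log det G`. -/
theorem dHol_slitDensity (hq : q ∈ slit U) (μ : Fin n) :
    dHol (fun q => (slitDensity g q : ℂ)) q (horVec g μ q) =
      2 * logDet g (horVec g μ q) q * slitDensity g q := by
  have hR := hg.differentiableAt hg.contDiffOn_radial hq
  have hD := hg.differentiableAt hg.contDiffOn_det hq
  -- By the chain rule this is a multiple of δ_μ G = 0: a cut-off depending only on G is invisible
  -- to horizontal derivatives.
  have hr : dHol (fun q => (radial (g q) : ℂ)) q (horVec g μ q) = 0 := by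
    have hG : DifferentiableAt ℝ g q :=
      (hg.smooth.contDiffAt (hg.isOpen_slit.mem_nhds hq)).differentiableAt (by simp)
    have hk : HasDerivAt (fun t : ℝ => radial t) (deriv (fun t : ℝ => (radial t : ℝ)) (g q)) (g q) :=
      ((radial.contDiff (n := 1)).differentiable (by simp) _).hasDerivAt
    have h1 := (hk.comp_hasFDerivAt q hG.hasFDerivAt)
    have h2 : fderiv ℝ (fun q => (radial (g q) : ℂ)) q = _ :=
      (Complex.ofRealCLM.hasFDerivAt.comp q h1).fderiv
    have h3 : fderiv ℝ (fun q => (g q : ℂ)) q = _ :=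
      (Complex.ofRealCLM.hasFDerivAt.comp q hG.hasFDerivAt).fderiv
    have h4 := hg.dHol_coe_horVec hq μ
    simp only [dHol, h3] at h4
    simp only [dHol, h2]
    simp only [ContinuousLinearMap.comp_apply, smul_apply, smul_eq_mul,
      Complex.ofRealCLM_apply, Complex.ofReal_mul] at h4 ⊢
    linear_combination ((deriv (fun t : ℝ => (radial t : ℝ)) (g q) : ℝ) : ℂ) * h4
  rw [dHol_congr_on hg.isOpen_slit hq fun r hr => hg.coe_slitDensity hr,
    dHol_mul hR (hD.fun_mul hD), dHol_mul hD hD, hr, hg.dHol_det_levi hq, hg.coe_slitDensity hq]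
  ring

/-- The divergence theorem for horizontal fields with compact support in the base. -/
theorem setIntegral_divergence {K : Set (Cn n)} (hK : IsCompact K) (hKU : K ⊆ U)
    {X : Fin n → Pn n → ℂ} (hX : ∀ α, ContDiffOn ℝ ∞ (X α) (slit U))
    (h0 : ∀ α, ∀ q ∈ slit U, q.1 ∉ K → X α q = 0) :
    ∫ q in slit U, (∑ α, (dHol (X α) q (horVec g α q) + X α q * logDet g (horVec g α q) q)) *
      slitDensity g q = 0 := by
  obtain ⟨C, hCS, hC, hd⟩ := hg.exists_compact hK hKU
  have hS := hg.isOpen_slit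
  have hY : ∀ α, ContDiffOn ℝ ∞ (fun q => X α q * (slitDensity g q : ℂ)) (slit U) := fun α =>
    (hX α).mul hg.contDiffOn_slitDensity
  have hY0 : ∀ α, ∀ q ∈ slit U, q ∉ C → X α q * (slitDensity g q : ℂ) = 0 := by
    intro α q hq hqC
    by_cases hqK : q.1 ∈ K
    · rw [hd q hq hqK hqC]; simp
    · rw [h0 α q hq hqK]; simp
  have hZ : ∀ σ α, ContDiffOn ℝ ∞ (fun q => nonlin g σ α q * (X α q * (slitDensity g q : ℂ)))
      (slit U) := fun σ α => (hg.contDiffOn_nonlin σ α).mul (hY α)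
  have hZ0 : ∀ σ α, ∀ q ∈ slit U, q ∉ C →
      nonlin g σ α q * (X α q * (slitDensity g q : ℂ)) = 0 := fun σ α q hq hqC => by
    rw [hY0 α q hq hqC, mul_zero]
  have hA := fun α => setIntegral_dHol_eq_zero hS hC hCS (hY α) (hY0 α) (unit α, 0)
  have hB := fun α σ => setIntegral_dHol_eq_zero hS hC hCS (hZ σ α) (hZ0 σ α) (0, unit σ)
  -- The integrand is a sum of coordinate derivatives of compactly supported functions: moving Γ
  -- inside the fibre derivative costs δ_α log det G, which reduces the factor 2 from det² to 1.
  have hpt : Set.EqOn (fun q => (∑ α, (dHol (X α) q (horVec g α q) +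
      X α q * logDet g (horVec g α q) q)) * (slitDensity g q : ℂ))
      (fun q => ∑ α, (dHol (fun q => X α q * (slitDensity g q : ℂ)) q (unit α, 0) -
        ∑ σ, dHol (fun q => nonlin g σ α q * (X α q * (slitDensity g q : ℂ))) q (0, unit σ)))
      (slit U) := by
    intro q hq
    simp only [Finset.sum_mul]
    refine Finset.sum_congr rfl fun α _ => ?_
    have h1 : dHol (fun q => X α q * (slitDensity g q : ℂ)) q (horVec g α q) = _ :=
      dHol_mul (hg.differentiableAt (hX α) hq) (hg.differentiableAt hg.contDiffOn_slitDensity hq)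
    rw [hg.dHol_slitDensity hq, dHol_horVec] at h1
    simp only [dHol_mul (hg.differentiableAt (hg.contDiffOn_nonlin _ α) hq)
      (hg.differentiableAt (hY α) hq), Finset.sum_add_distrib]
    rw [← Finset.sum_mul, hg.sum_dHol_nonlin hq]
    linear_combination -h1
  have hAB : ∀ α, IntegrableOn (fun q => dHol (fun q => X α q * (slitDensity g q : ℂ)) q (unit α, 0) -
      ∑ σ, dHol (fun q => nonlin g σ α q * (X α q * (slitDensity g q : ℂ))) q (0, unit σ))
      (slit U) := fun α => (hA α).1.sub (integrable_finsetSum _ fun σ _ => (hB α σ).1)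
  rw [setIntegral_congr_fun hS.measurableSet hpt, integral_finsetSum _ fun α _ => hAB α]
  refine Finset.sum_eq_zero fun α _ => ?_
  rw [integral_sub (hA α).1 (integrable_finsetSum _ fun σ _ => (hB α σ).1), (hA α).2,
    integral_finsetSum _ fun σ _ => (hB α σ).1]
  simp [(hB α _).2]

/-- Integration by parts for the horizontal derivative of a horizontal `(0,1)`-form. -/
theorem setIntegral_dual {K : Set (Cn n)} (hK : IsCompact K) (hKU : K ⊆ U)
    {ψ : Fin n → Pn n → ℂ} (hψ : ∀ β, ContDiffOn ℝ ∞ (ψ β) (slit U))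
    (h0 : ∀ β, ∀ q ∈ slit U, q.1 ∉ K → ψ β q = 0) :
    ∫ q in slit U, (∑ α, ∑ β, gInv g q β α * dHol (ψ β) q (horVec g α q) -
      ∑ α, ∑ β, gInv g q β α * (ψ β q * tors g α q)) * slitDensity g q = 0 := by
  rw [← hg.setIntegral_divergence hK hKU (X := fun α q => ∑ β, ψ β q * gInv g q β α)
    (fun α => ContDiffOn.sum fun β _ => (hψ β).mul (hg.contDiffOn_gInv β α))
    (fun α q hq hqK => Finset.sum_eq_zero fun β _ => by rw [h0 β q hq hqK, zero_mul])]
  refine setIntegral_congr_fun hg.isOpen_slit.measurableSet fun q hq => ?_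
  simp only [← hg.divergence_dual hψ hq]

end IsLocalMetric

end Integration

end ComplexFinsler

namespace ComplexFinsler

/-! ### Charts of the manifold and of its projectivized tangent bundle -/

section Charts

variable {n : ℕ} {M : Type*} [TopologicalSpace M] [ChartedSpace (Cn n) M]

/-- The transition map between two charts. -/
def transition (e e' : OpenPartialHomeomorph M (Cn n)) (z : Cn n) : Cn n := e' (e.symm z)

/-- The domain of the transition map. -/
def transitionDomain (e e' : OpenPartialHomeomorph M (Cn n)) : Set (Cn n) :=
  e.target ∩ e.symm ⁻¹' e'.source

omit [ChartedSpace (Cn n) M] in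
theorem isOpen_transitionDomain (e e' : OpenPartialHomeomorph M (Cn n)) :
    IsOpen (transitionDomain e e') :=
  e.isOpen_inter_preimage_symm e'.open_source

variable {e e' e'' : OpenPartialHomeomorph M (Cn n)} {z : Cn n}

omit [ChartedSpace (Cn n) M] in
theorem transition_mem (hz : z ∈ transitionDomain e e') :
    transition e e' z ∈ transitionDomain e' e := by
  refine ⟨e'.map_source hz.2, ?_⟩
  change e'.symm (e' (e.symm z)) ∈ e.source
  rw [e'.left_inv hz.2]
  exact e.map_target hz.1

omit [ChartedSpace (Cn n) M] in
theorem symm_transition (hz : z ∈ transitionDomain e e') :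
    e'.symm (transition e e' z) = e.symm z := e'.left_inv hz.2

omit [ChartedSpace (Cn n) M] in
theorem transition_transition (hz : z ∈ transitionDomain e e') :
    transition e' e (transition e e' z) = z := by
  rw [transition, symm_transition hz, e.right_inv hz.1]

variable [IsManifold 𝓘(ℂ, Cn n) ω M]

theorem contDiffOn_transition (he : e ∈ atlas (Cn n) M) (he' : e' ∈ atlas (Cn n) M) :
    ContDiffOn ℂ ω (transition e e') (transitionDomain e e') := by
  have h := ModelWithCorners.contDiffOn_extendCoordChange (I := 𝓘(ℂ, Cn n)) (n := ω)
    (IsManifold.subset_maximalAtlas he) (IsManifold.subset_maximalAtlas he')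
  refine (h.mono ?_).congr ?_
  · intro z hz
    rw [ModelWithCorners.extendCoordChange_source]
    simpa [transitionDomain, OpenPartialHomeomorph.trans_source] using hz
  · intro z _
    simp [transition, ModelWithCorners.extendCoordChange]

theorem hasFDerivAt_transition (he : e ∈ atlas (Cn n) M) (he' : e' ∈ atlas (Cn n) M)
    (hz : z ∈ transitionDomain e e') :
    HasFDerivAt (transition e e') (fderiv ℂ (transition e e') z) z :=
  (((contDiffOn_transition he he').contDiffAt
    ((isOpen_transitionDomain e e').mem_nhds hz)).differentiableAt (by simp)).hasFDerivAt

theorem fderiv_transition_comp (he : e ∈ atlas (Cn n) M) (he' : e' ∈ atlas (Cn n) M)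
    (he'' : e'' ∈ atlas (Cn n) M) (hz : z ∈ transitionDomain e e') (hz' : e.symm z ∈ e''.source)
    (v : Cn n) :
    fderiv ℂ (transition e' e'') (transition e e' z) (fderiv ℂ (transition e e') z v) =
      fderiv ℂ (transition e e'') z v := by
  have h2 : transition e e' z ∈ transitionDomain e' e'' := by
    refine ⟨(transition_mem hz).1, ?_⟩
    change e'.symm (transition e e' z) ∈ e''.source
    rwa [symm_transition hz]
  have hcomp := (hasFDerivAt_transition he' he'' h2).comp z (hasFDerivAt_transition he he' hz)
  have heq : transition e e'' =ᶠ[nhds z] transition e' e'' ∘ transition e e' := by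
    filter_upwards [(isOpen_transitionDomain e e').mem_nhds hz] with y hy
    simp only [Function.comp, transition]
    rw [e'.left_inv hy.2]
  rw [(hcomp.congr_of_eventuallyEq heq).fderiv]
  rfl

omit [ChartedSpace (Cn n) M] [IsManifold 𝓘(ℂ, Cn n) ω M] in
theorem fderiv_transition_self (hz : z ∈ e.target) (v : Cn n) :
    fderiv ℂ (transition e e) z v = v := by
  have heq : transition e e =ᶠ[nhds z] id := by
    filter_upwards [e.open_target.mem_nhds hz] with y hy using e.right_inv hy
  rw [heq.fderiv_eq]; simp

theorem fderiv_transition_symm (he : e ∈ atlas (Cn n) M) (he' : e' ∈ atlas (Cn n) M)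
    (hz : z ∈ transitionDomain e e') (v : Cn n) :
    fderiv ℂ (transition e' e) (transition e e' z) (fderiv ℂ (transition e e') z v) = v := by
  rw [fderiv_transition_comp he he' he hz (e.map_target hz.1), fderiv_transition_self hz.1]

/-- Tangent vectors at a point are stored as their components in the preferred chart there, so `vec`
is the derivative of the transition map to that chart. -/
theorem vec_eq (he : e ∈ atlas (Cn n) M) (hz : z ∈ e.target) (v : Cn n) :
    vec e z v = fderiv ℂ (transition e (chartAt (Cn n) (e.symm z))) z v := by
  have hd : MDifferentiableAt 𝓘(ℂ, Cn n) 𝓘(ℂ, Cn n) e.symm z := mdifferentiableAt_atlas_symm he hz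
  refine (congrArg (fun L => L v) hd.mfderiv).trans ?_
  change fderivWithin ℂ (writtenInExtChartAt 𝓘(ℂ, Cn n) 𝓘(ℂ, Cn n) z e.symm)
    (Set.range 𝓘(ℂ, Cn n)) (extChartAt 𝓘(ℂ, Cn n) z z) v = _
  simp only [writtenInExtChartAt, extChartAt_model_space_eq_id, ModelWithCorners.range_eq_univ,
    fderivWithin_univ]
  rfl

omit [IsManifold 𝓘(ℂ, Cn n) ω M] in
theorem mem_transitionDomain_chartAt (hz : z ∈ e.target) :
    z ∈ transitionDomain e (chartAt (Cn n) (e.symm z)) := ⟨hz, mem_chart_source _ _⟩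

omit [IsManifold 𝓘(ℂ, Cn n) ω M] in
theorem vec_smul (e : OpenPartialHomeomorph M (Cn n)) (z v : Cn n) (ζ : ℂ) :
    vec e z (ζ • v) = ζ • vec e z v := map_smul (mfderiv 𝓘(ℂ, Cn n) 𝓘(ℂ, Cn n) e.symm z) ζ v

theorem vec_ne_zero (he : e ∈ atlas (Cn n) M) (hz : z ∈ e.target) {v : Cn n} (hv : v ≠ 0) :
    vec e z v ≠ 0 := by
  rw [vec_eq he hz]
  intro h
  apply hv
  rw [← fderiv_transition_symm he (chart_mem_atlas (Cn n) (e.symm z))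
    (mem_transitionDomain_chartAt hz) v]
  change fderiv ℂ (transition e (chartAt (Cn n) (e.symm z))) z v = 0 at h
  rw [h, map_zero]

/-- The vector `v` in the coordinates `z` and its image in other coordinates agree. -/
theorem vec_transition (he : e ∈ atlas (Cn n) M) (he' : e' ∈ atlas (Cn n) M)
    (hz : z ∈ transitionDomain e e') (v : Cn n) :
    (vec e' (transition e e' z) (fderiv ℂ (transition e e') z v) : Cn n) = (vec e z v : Cn n) := by
  rw [vec_eq he' (transition_mem hz).1, vec_eq he hz.1]
  change fderiv ℂ (transition e' (chartAt (Cn n) (e'.symm (transition e e' z))))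
    (transition e e' z) (fderiv ℂ (transition e e') z v) = _
  rw [symm_transition hz]
  exact fderiv_transition_comp he he' (chart_mem_atlas _ _) hz (mem_chart_source _ _) v

/-- The point of the projectivized tangent bundle with given base point and direction. -/
def mkPTM (x : M) (u : Cn n) (hu : u ≠ 0) : PTM n M :=
  ⟨x, Projectivization.mk ℂ (show TangentSpace 𝓘(ℂ, Cn n) x from u) hu⟩

omit [IsManifold 𝓘(ℂ, Cn n) ω M] in
-- Lines over base points that are equal but not definitionally so are compared through their
-- component vectors, which live in the fixed space ℂⁿ.
theorem mkPTM_congr {x x' : M} {u u' : Cn n} (hx : x = x') {ζ : ℂ} (hu : u' = ζ • u)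
    (h : u ≠ 0) (h' : u' ≠ 0) : mkPTM x' u' h' = mkPTM x u h := by
  subst hx
  unfold mkPTM
  congr 1
  exact (Projectivization.mk_eq_mk_iff' ℂ _ _ _ _).2 ⟨ζ, hu.symm⟩

omit [IsManifold 𝓘(ℂ, Cn n) ω M] in
theorem linePoint_eq (e : OpenPartialHomeomorph M (Cn n)) (z v : Cn n) (h : vec e z v ≠ 0) :
    linePoint e z v h = mkPTM (e.symm z) (vec e z v) h := rfl

theorem linePoint_congr {v : Cn n} (he : e ∈ atlas (Cn n) M) (he' : e' ∈ atlas (Cn n) M)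
    (hz : z ∈ transitionDomain e e') (h : vec e z v ≠ 0) {ζ : ℂ}
    (h' : vec e' (tangentLift (transition e e') ζ (z, v)).1
      (tangentLift (transition e e') ζ (z, v)).2 ≠ 0) :
    linePoint e' (tangentLift (transition e e') ζ (z, v)).1
      (tangentLift (transition e e') ζ (z, v)).2 h' = linePoint e z v h := by
  rw [linePoint_eq, linePoint_eq]
  refine mkPTM_congr (symm_transition hz).symm (ζ := ζ) ?_ _ _
  change vec e' (transition e e' z) (ζ • fderiv ℂ (transition e e') z v) = _
  rw [vec_smul]
  exact congrArg (ζ • ·) (vec_transition he he' hz v)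

/-! ### The metric in charts, preferred coordinates and coefficients of forms. -/

variable (F : FinslerMetric n M)

theorem isLocalMetric (he : e ∈ atlas (Cn n) M) : IsLocalMetric e.target (F.loc e) where
  isOpen := e.open_target
  smooth := F.smooth e he
  pos q hq := pow_pos (F.pos _ _ (vec_ne_zero he hq.1 hq.2)) 2
  homog z hz v ζ := by
    simp only [FinslerMetric.loc, gLoc]
    rw [vec_smul, F.homogeneous, mul_pow]
  posDef q hq := F.pseudoconvex e he q.1 hq.1 q.2 hq.2

theorem isChange_transition (he : e ∈ atlas (Cn n) M) (he' : e' ∈ atlas (Cn n) M) {ζ : ℂ}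
    (hζ : ζ ≠ 0) :
    IsChange (transitionDomain e e') e'.target (F.loc e) (F.loc e') (transition e e') ζ where
  isOpen := isOpen_transitionDomain e e'
  smooth := contDiffOn_transition he he'
  mapsTo _ hz := (transition_mem hz).1
  injective z hz v hv := by
    rw [← fderiv_transition_symm he he' hz v, hv, map_zero]
  ne_zero := hζ
  eq q hq := by
    -- Stated for variable base points, so that their equality can be substituted before homogeneity
    -- is applied in the dependent fibre.
    have hF : ∀ (x x' : M) (u u' : Cn n), x' = x → u' = ζ • u →
        F.toFun ⟨x', u'⟩ = ‖ζ‖ * F.toFun ⟨x, u⟩ := by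
      rintro x _ u _ rfl rfl
      exact F.homogeneous _ _ _
    simp only [FinslerMetric.loc, gLoc, ← mul_pow]
    congr 1
    refine hF _ _ _ _ (symm_transition hq.1) ?_
    change vec e' (transition e e' q.1) (ζ • fderiv ℂ (transition e e') q.1 q.2) = _
    rw [vec_smul]
    exact congrArg (ζ • ·) (vec_transition he he' hq.1 q.2)

theorem comp_apply (x : M) (X : TangentSpace 𝓘(ℂ, Cn n) x) : comp x X = X := by
  have h := mfderiv_chartAt_eq_tangentCoordChange (I := 𝓘(ℂ, Cn n)) (mem_chart_source (Cn n) x)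
  rw [comp, h]
  exact tangentCoordChange_self (by simp)

theorem comp_eq_id (x : M) : comp (n := n) x = ContinuousLinearMap.id ℂ (Cn n) := by
  ext1 X; exact comp_apply x X

theorem frame_eq (x : M) (α : Fin n) : (frame x α : Cn n) = unit α := by
  rw [frame]
  rw [comp_eq_id]
  exact congrArg (fun L => L (unit α)) (ContinuousLinearMap.inverse_id (R := ℂ) (M := Cn n))

theorem coord_eq (p : PTM n M) : coord p = (chartAt (Cn n) p.base p.base, p.line.rep) := by
  rw [coord, comp_apply]; rfl

theorem sesq_frame (x : M) (c : Fin n → Fin n → ℂ) (α β : Fin n) :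
    sesq x c (frame x α) (frame x β) = c α β := by
  have h : ∀ α, comp (n := n) x (frame x α) = unit α := fun α =>
    (comp_apply x _).trans (frame_eq x α)
  simp only [sesq, LinearMap.mk₂'ₛₗ_apply, h]
  simp [unit, Pi.single_apply]

theorem coord_mem (p : PTM n M) : coord p ∈ slit (chartAt (Cn n) p.base).target := by
  rw [coord_eq]
  exact ⟨mem_chart_target _ _, p.line.rep_nonzero⟩

theorem vec_coord (x : M) (v : Cn n) :
    (vec (chartAt (Cn n) x) (chartAt (Cn n) x x) v : Cn n) = v := by
  rw [vec_eq (chart_mem_atlas _ _) (mem_chart_target _ _)]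
  change fderiv ℂ (transition (chartAt (Cn n) x) (chartAt (Cn n)
    ((chartAt (Cn n) x).symm (chartAt (Cn n) x x)))) (chartAt (Cn n) x x) v = v
  rw [(chartAt (Cn n) x).left_inv (mem_chart_source _ _)]
  exact fderiv_transition_self (mem_chart_target _ _) v

theorem linePoint_coord (p : PTM n M)
    (h : vec (chartAt (Cn n) p.base) (coord p).1 (coord p).2 ≠ 0) :
    linePoint (chartAt (Cn n) p.base) (coord p).1 (coord p).2 h = p := by
  have h1 : p = mkPTM p.base p.line.rep p.line.rep_nonzero := by
    unfold mkPTM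
    exact PTM.ext rfl p.line.mk_rep.symm
  rw [linePoint_eq]
  conv_rhs => rw [h1]
  refine mkPTM_congr ?_ (ζ := 1) ?_ _ _
  · rw [coord_eq]; exact ((chartAt (Cn n) p.base).left_inv (mem_chart_source _ _)).symm
  · rw [coord_eq]; exact (vec_coord _ _).trans (one_smul ℂ _).symm

/-- The preferred coordinates of a point in terms of the coordinates of another chart. -/
theorem coord_linePoint {q : Pn n} (he : e ∈ atlas (Cn n) M) (hq : q ∈ slit e.target)
    (h : vec e q.1 q.2 ≠ 0) :
    ∃ ζ : ℂ, ζ ≠ 0 ∧ coord (linePoint e q.1 q.2 h) =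
      tangentLift (transition e (chartAt (Cn n) (e.symm q.1))) ζ q := by
  -- The representative of a line is a choice, known only up to a nonzero factor; this is the
  -- dilation that `IsChange` carries.
  obtain ⟨a, ha⟩ := Projectivization.exists_smul_eq_mk_rep ℂ (vec e q.1 q.2) h
  refine ⟨a, a.ne_zero, ?_⟩
  rw [coord_eq]
  refine Prod.ext rfl ?_
  change (Projectivization.mk ℂ (vec e q.1 q.2) h).rep = _
  rw [← ha, vec_eq he hq.1]
  rfl

omit [IsManifold 𝓘(ℂ, Cn n) ω M] in
theorem slit_transitionDomain {q : Pn n} (hq : q ∈ slit e.target) :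
    q ∈ slit (transitionDomain e (chartAt (Cn n) (e.symm q.1))) :=
  ⟨mem_transitionDomain_chartAt hq.1, hq.2⟩

/-! Coefficients of horizontal forms. -/

omit [IsManifold 𝓘(ℂ, Cn n) ω M] in
theorem raw01_congr (φ : Raw01 n M) {p p' : PTM n M} (hp : p = p') {u u' : Cn n} (hu : u = u') :
    φ p u = φ p' u' := by subst hp hu; rfl

omit [IsManifold 𝓘(ℂ, Cn n) ω M] in
theorem coef01_eq (φ : Raw01 n M) {q : Pn n} (h : vec e q.1 q.2 ≠ 0) (β : Fin n) :
    coef01 φ e β q = φ (linePoint e q.1 q.2 h) (vec e q.1 (unit β)) := dif_pos h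

omit [IsManifold 𝓘(ℂ, Cn n) ω M] in
theorem coef10_eq (φ : Raw10 n M) {q : Pn n} (h : vec e q.1 q.2 ≠ 0) (β : Fin n) :
    coef10 φ e β q = φ (linePoint e q.1 q.2 h) (vec e q.1 (unit β)) := dif_pos h

theorem vec_ne_zero_coord (p : PTM n M) :
    vec (chartAt (Cn n) p.base) (coord p).1 (coord p).2 ≠ 0 :=
  vec_ne_zero (chart_mem_atlas _ _) (coord_mem p).1 (coord_mem p).2

theorem raw01_frame (φ : Raw01 n M) (p : PTM n M) (β : Fin n) :
    φ p (frame p.base β) = coef01 φ (chartAt (Cn n) p.base) β (coord p) := by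
  rw [coef01_eq φ (vec_ne_zero_coord p)]
  refine raw01_congr φ (linePoint_coord p _).symm ?_
  rw [frame_eq, coord_eq]
  exact (vec_coord _ _).symm

omit [IsManifold 𝓘(ℂ, Cn n) ω M] in
theorem raw01_sum (φ : Raw01 n M) (p : PTM n M) (L : Cn n →ₗ[ℂ] TangentSpace 𝓘(ℂ, Cn n) p.base)
    (u : Cn n) : φ p (L u) = ∑ τ, star (u τ) * φ p (L (unit τ)) := by
  conv_lhs => rw [eq_sum_unit u, map_sum, map_sum]
  refine Finset.sum_congr rfl fun τ _ => ?_
  rw [map_smul, LinearMap.map_smulₛₗ]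
  rfl

/-- The form depends only on the line, so both sides evaluate it at the same point on the same
vector whatever the factor ζ is. -/
theorem coef01_transition (φ : Raw01 n M) (he : e ∈ atlas (Cn n) M) (he' : e' ∈ atlas (Cn n) M)
    {q : Pn n} (hq : q ∈ slit (transitionDomain e e')) {ζ : ℂ} (hζ : ζ ≠ 0) (β : Fin n) :
    coef01 φ e β q = ∑ τ, star (jac (transition e e') q.1 τ β) *
      coef01 φ e' τ (tangentLift (transition e e') ζ q) := by
  have h : vec e q.1 q.2 ≠ 0 := vec_ne_zero he hq.1.1 hq.2
  have hv : fderiv ℂ (transition e e') q.1 q.2 ≠ 0 := fun h0 => hq.2 (by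
    rw [Set.mem_singleton_iff, ← fderiv_transition_symm he he' hq.1 q.2, h0, map_zero])
  have h' : vec e' (tangentLift (transition e e') ζ q).1 (tangentLift (transition e e') ζ q).2 ≠ 0 :=
    vec_ne_zero he' (transition_mem hq.1).1 (smul_ne_zero hζ hv)
  simp only [coef01_eq φ h']
  rw [coef01_eq φ h, raw01_congr φ (linePoint_congr he he' hq.1 h h').symm
    (vec_transition he he' hq.1 (unit β)).symm]
  exact raw01_sum φ _ (mfderiv 𝓘(ℂ, Cn n) 𝓘(ℂ, Cn n) e'.symm (transition e e' q.1)).toLinearMap _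

end Charts

end ComplexFinsler

namespace ComplexFinsler

/-! ### Topology of the projectivized tangent bundle -/

section Topology

variable {n : ℕ} {M : Type*} [TopologicalSpace M] [ChartedSpace (Cn n) M]
  [IsManifold 𝓘(ℂ, Cn n) ω M] {e e' : OpenPartialHomeomorph M (Cn n)}

/-- The map is the inverse of the local trivialization of the tangent bundle attached to the chart.
-/
theorem continuousOn_totalParam (he : e ∈ atlas (Cn n) M) :
    ContinuousOn (fun q : Pn n => (⟨e.symm q.1, vec e q.1 q.2⟩ : TangentBundle 𝓘(ℂ, Cn n) M))
      (e.target ×ˢ Set.univ) := by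
  have h1 := ((tangentBundleCore 𝓘(ℂ, Cn n) M).localTriv
    ⟨e, he⟩).toOpenPartialHomeomorph.continuousOn_symm
  have h2 : ContinuousOn (fun q : Pn n => (e.symm q.1, q.2)) (e.target ×ˢ Set.univ) :=
    (e.continuousOn_symm.comp continuousOn_fst fun q hq => hq.1).prodMk continuousOn_snd
  have h3 : Set.MapsTo (fun q : Pn n => (e.symm q.1, q.2)) (e.target ×ˢ Set.univ)
      ((tangentBundleCore 𝓘(ℂ, Cn n) M).localTriv ⟨e, he⟩).toOpenPartialHomeomorph.target := by
    intro q hq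
    exact ⟨e.map_target hq.1, Set.mem_univ _⟩
  refine (h1.comp h2 h3).congr fun q hq => ?_
  have hv := vec_eq he hq.1 q.2
  refine Bundle.TotalSpace.ext rfl (heq_of_eq ?_)
  refine hv.trans ?_
  change _ = fderivWithin ℂ (((chartAt (Cn n) (e.symm q.1)).extend 𝓘(ℂ, Cn n)) ∘
    (e.extend 𝓘(ℂ, Cn n)).symm) (Set.range 𝓘(ℂ, Cn n)) (e.extend 𝓘(ℂ, Cn n) (e.symm q.1)) q.2
  simp only [ModelWithCorners.range_eq_univ, fderivWithin_univ]
  have h4 : e.extend 𝓘(ℂ, Cn n) (e.symm q.1) = q.1 := by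
    simp [e.right_inv hq.1]
  rw [h4]
  rfl

/-- The points of the projectivized tangent bundle over the domain of a chart. -/
def overSource (e : OpenPartialHomeomorph M (Cn n)) : Set (PTM n M) := {p | p.base ∈ e.source}

theorem continuous_base : Continuous (PTM.base : PTM n M → M) := by
  refine continuous_coinduced_dom.2 ?_
  exact (FiberBundle.continuous_proj (Cn n) (TangentSpace 𝓘(ℂ, Cn n) (M := M))).comp
    continuous_subtype_val

theorem isOpen_overSource (e : OpenPartialHomeomorph M (Cn n)) : IsOpen (overSource (n := n) e) :=
  e.open_source.preimage continuous_base

theorem continuous_linePoint {Z : Type*} [TopologicalSpace Z] {k : Z → Pn n}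
    (hk : Continuous k) (he : e ∈ atlas (Cn n) M) (hks : ∀ x, k x ∈ slit e.target) :
    Continuous fun x => linePoint e (k x).1 (k x).2 (vec_ne_zero he (hks x).1 (hks x).2) := by
  have h1 : Continuous fun x => (⟨e.symm (k x).1, vec e (k x).1 (k x).2⟩ :
      TangentBundle 𝓘(ℂ, Cn n) M) :=
    (continuousOn_totalParam he).comp_continuous hk fun x => ⟨(hks x).1, Set.mem_univ _⟩
  have h2 : Continuous (toPTM : Slit n M → PTM n M) := continuous_coinduced_rng
  exact h2.comp (h1.subtype_mk fun x => vec_ne_zero he (hks x).1 (hks x).2)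

theorem vec_coordinate (he : e ∈ atlas (Cn n) M) {x : M} (hx : x ∈ e.source) (v : Cn n) :
    (vec e (e x) (fderiv ℂ (transition (chartAt (Cn n) x) e) (chartAt (Cn n) x x) v) : Cn n) =
      v := by
  have hz : chartAt (Cn n) x x ∈ transitionDomain (chartAt (Cn n) x) e := by
    refine ⟨mem_chart_target _ _, ?_⟩
    change (chartAt (Cn n) x).symm (chartAt (Cn n) x x) ∈ e.source
    rwa [(chartAt (Cn n) x).left_inv (mem_chart_source _ _)]
  have h := vec_transition (chart_mem_atlas (Cn n) x) he hz v
  have h2 : transition (chartAt (Cn n) x) e (chartAt (Cn n) x x) = e x := by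
    rw [transition, (chartAt (Cn n) x).left_inv (mem_chart_source _ _)]
  rw [h2] at h
  exact h.trans (vec_coord x v)

/-- A function with continuous coordinate expressions is continuous. -/
theorem continuous_of_local {f : PTM n M → ℂ} {fe : OpenPartialHomeomorph M (Cn n) → Pn n → ℂ}
    (hc : ∀ e ∈ atlas (Cn n) M, ContinuousOn (fe e) (slit e.target))
    (hf : ∀ e ∈ atlas (Cn n) M, ∀ q ∈ slit e.target, ∀ h,
      f (linePoint e q.1 q.2 h) = fe e q) : Continuous f := by
  -- For the quotient topology it suffices to test on the slit bundle, where a local trivialization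
  -- provides continuous coordinates `k` of a vector in a fixed chart.
  refine continuous_coinduced_dom.2 (continuous_iff_continuousAt.2 fun s => ?_)
  set e := chartAt (Cn n) s.1.1 with hedef
  have he : e ∈ atlas (Cn n) M := chart_mem_atlas _ _
  set triv := (tangentBundleCore 𝓘(ℂ, Cn n) M).localTriv ⟨e, he⟩ with htriv
  let k : Slit n M → Pn n := fun s' => (e s'.1.1, (triv s'.1).2)
  have hproj : Continuous fun s' : Slit n M => s'.1.1 :=
    (FiberBundle.continuous_proj (Cn n) (TangentSpace 𝓘(ℂ, Cn n) (M := M))).comp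
      continuous_subtype_val
  have hs : s.1.1 ∈ e.source := mem_chart_source _ _
  have hk : ContinuousAt k s := by
    refine (ContinuousAt.comp (f := fun s' : Slit n M => s'.1.1) (x := s)
      (e.continuousAt hs) hproj.continuousAt).prodMk ?_
    refine continuous_snd.continuousAt.comp ?_
    have : s.1 ∈ triv.toOpenPartialHomeomorph.source := hs
    exact ContinuousAt.comp (f := fun s' : Slit n M => s'.1) (x := s)
      (triv.toOpenPartialHomeomorph.continuousAt this) continuous_subtype_val.continuousAt
  have hk2 : ∀ s' : Slit n M, (k s').2 =
      fderiv ℂ (transition (chartAt (Cn n) s'.1.1) e) (chartAt (Cn n) s'.1.1 s'.1.1) s'.1.2 := by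
    intro s'
    change fderivWithin ℂ ((e.extend 𝓘(ℂ, Cn n)) ∘
      ((chartAt (Cn n) s'.1.1).extend 𝓘(ℂ, Cn n)).symm) (Set.range 𝓘(ℂ, Cn n))
        ((chartAt (Cn n) s'.1.1).extend 𝓘(ℂ, Cn n) s'.1.1) s'.1.2 = _
    simp only [ModelWithCorners.range_eq_univ, fderivWithin_univ]
    rfl
  have hkv : ∀ s' : Slit n M, s'.1.1 ∈ e.source → (vec e (k s').1 (k s').2 : Cn n) = s'.1.2 := by
    intro s' hs'
    rw [hk2]
    exact vec_coordinate he hs' s'.1.2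
  have hkm : ∀ s' : Slit n M, s'.1.1 ∈ e.source → k s' ∈ slit e.target := by
    intro s' hs'
    refine ⟨e.map_source hs', fun h0 => s'.2 ?_⟩
    have h1 := hkv s' hs'
    rw [Set.mem_singleton_iff] at h0
    rw [h0] at h1
    have h2 : vec e (k s').1 0 = 0 := map_zero (mfderiv 𝓘(ℂ, Cn n) 𝓘(ℂ, Cn n) e.symm (k s').1)
    exact h1.symm.trans h2
  have hev : f ∘ toPTM =ᶠ[nhds s] fe e ∘ k := by
    filter_upwards [(e.open_source.preimage hproj).mem_nhds hs] with s' hs'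
    have hm := hkm s' hs'
    have hv := vec_ne_zero he hm.1 hm.2
    simp only [Function.comp_apply]
    rw [← hf e he _ hm hv]
    congr 1
    rw [linePoint_eq]
    change mkPTM s'.1.1 s'.1.2 s'.2 = _
    refine mkPTM_congr (e.left_inv hs') (ζ := 1) ?_ _ _
    exact (hkv s' hs').symm.trans (one_smul ℂ _).symm
  refine ContinuousAt.congr ?_ hev.symm
  exact ((hc e he).continuousAt ((e.open_target.prod isOpen_compl_singleton).mem_nhds
    (hkm s hs))).comp hk

/-! ### Parametrizing the projectivized bundle by nonzero vectors over a chart. -/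

section Param

variable [NeZero n]

open Classical in
/-- The parametrization of the projectivized tangent bundle by nonzero vectors over a chart. -/
def slitParam (e : OpenPartialHomeomorph M (Cn n)) (q : Pn n) : PTM n M :=
  if h : vec e q.1 q.2 ≠ 0 then linePoint e q.1 q.2 h
  else mkPTM (e.symm q.1) (affVec 0 0) (affVec_ne_zero 0 0)

theorem slitParam_eq (he : e ∈ atlas (Cn n) M) {q : Pn n} (hq : q ∈ slit e.target) :
    slitParam e q = linePoint e q.1 q.2 (vec_ne_zero he hq.1 hq.2) :=
  dif_pos (vec_ne_zero he hq.1 hq.2)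

omit [IsManifold 𝓘(ℂ, Cn n) ω M] in
theorem slitParam_base (e : OpenPartialHomeomorph M (Cn n)) (q : Pn n) :
    (slitParam e q).base = e.symm q.1 := by
  unfold slitParam
  split_ifs <;> rfl

theorem slitParam_smul (he : e ∈ atlas (Cn n) M) {q : Pn n} (hq : q ∈ slit e.target) {ζ : ℂ}
    (hζ : ζ ≠ 0) : slitParam e (q.1, ζ • q.2) = slitParam e q := by
  have hq' : (q.1, ζ • q.2) ∈ slit e.target := ⟨hq.1, smul_ne_zero hζ hq.2⟩
  rw [slitParam_eq he hq, slitParam_eq he hq', linePoint_eq, linePoint_eq]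
  exact mkPTM_congr rfl (vec_smul e q.1 q.2 ζ) _ _

theorem continuousOn_slitParam (he : e ∈ atlas (Cn n) M) :
    ContinuousOn (slitParam e) (slit e.target) := by
  rw [continuousOn_iff_continuous_domRestrict]
  have := continuous_linePoint (Z := slit e.target) continuous_subtype_val he fun x => x.2
  refine this.congr fun x => ?_
  exact (slitParam_eq he x.2).symm

theorem slitParam_transition (he : e ∈ atlas (Cn n) M) (he' : e' ∈ atlas (Cn n) M) {q : Pn n}
    (hq : q ∈ slit (transitionDomain e e')) :
    slitParam e' (tangentLift (transition e e') 1 q) = slitParam e q := by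
  have hq1 : q ∈ slit e.target := ⟨hq.1.1, hq.2⟩
  have hq2 : tangentLift (transition e e') 1 q ∈ slit e'.target := by
    refine ⟨(transition_mem hq.1).1, fun h0 => hq.2 ?_⟩
    rw [Set.mem_singleton_iff, ← fderiv_transition_symm he he' hq.1 q.2]
    have : fderiv ℂ (transition e e') q.1 q.2 = 0 := by simpa [tangentLift] using h0
    rw [this, map_zero]
  rw [slitParam_eq he hq1, slitParam_eq he' hq2]
  exact linePoint_congr he he' hq.1 _ _

theorem affParam_eq (he : e ∈ atlas (Cn n) M) (i : Fin n) {q : Cn n × ({α : Fin n // α ≠ i} → ℂ)}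
    (hq : q.1 ∈ e.target) : affParam e i q = slitParam e (q.1, affVec i q.2) := by
  have h : vec e q.1 (affVec i q.2) ≠ 0 := vec_ne_zero he hq (affVec_ne_zero i q.2)
  rw [slitParam_eq (q := (q.1, affVec i q.2)) he ⟨hq, affVec_ne_zero i q.2⟩, affParam, dif_pos h]

end Param

end Topology

end ComplexFinsler

namespace ComplexFinsler

/-! ### Integration along the fibres -/

section Fibre

variable {n : ℕ}

/-- The real determinant of a complex linear map is the squared modulus of the complex one. -/
theorem det_restrictScalars_eq {V : Type*} [AddCommGroup V] [Module ℂ V] (L : V →ₗ[ℂ] V) :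
    LinearMap.det (L.restrictScalars ℝ) = Complex.normSq (LinearMap.det L) := by
  rw [LinearMap.det_restrictScalars, Algebra.norm_complex_apply]

theorem lintegral_complex_smul {ι : Type*} [Fintype ι] {ζ : ℂ} (hζ : ζ ≠ 0)
    (H : (ι → ℂ) → ENNReal) (hH : Measurable H) :
    ∫⁻ u, H u = ENNReal.ofReal (‖ζ‖ ^ (2 * Fintype.card ι)) * ∫⁻ w, H (ζ • w) := by
  let L : (ι → ℂ) →ₗ[ℝ] (ι → ℂ) := (ζ • (LinearMap.id : (ι → ℂ) →ₗ[ℂ] (ι → ℂ))).restrictScalars ℝ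
  have hdet : LinearMap.det L = ‖ζ‖ ^ (2 * Fintype.card ι) := by
    rw [det_restrictScalars_eq, LinearMap.det_smul, LinearMap.det_id, mul_one, Complex.normSq_eq_norm_sq,
      norm_pow, ← pow_mul, mul_comm]
    simp
  have hpos : (0 : ℝ) < ‖ζ‖ ^ (2 * Fintype.card ι) := pow_pos (norm_pos_iff.2 hζ) _
  have h := Measure.map_linearMap_addHaar_eq_smul_addHaar (f := L)
    (volume : Measure (ι → ℂ)) (by rw [hdet]; exact hpos.ne')
  have h2 : ∫⁻ u, H u ∂(Measure.map L volume) = ∫⁻ w, H (ζ • w) :=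
    lintegral_map hH (LinearMap.continuous_of_finiteDimensional L).measurable
  rw [← h2, h, lintegral_smul_measure, hdet, smul_eq_mul, ← mul_assoc, abs_of_pos (inv_pos.2 hpos),
    ← ENNReal.ofReal_mul hpos.le, mul_inv_cancel₀ hpos.ne', ENNReal.ofReal_one, one_mul]

/-- The vector of `ℂⁿ` with `i`-th coordinate `ζ` and the other coordinates given by `u`. -/
def insertVec (i : Fin n) (x : ℂ × ({α : Fin n // α ≠ i} → ℂ)) : Cn n :=
  fun α => if h : α = i then x.1 else x.2 ⟨α, h⟩

theorem insertVec_smul (i : Fin n) (ζ : ℂ) (w : {α : Fin n // α ≠ i} → ℂ) :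
    insertVec i (ζ, ζ • w) = ζ • affVec i w := by
  ext α
  simp only [insertVec, affVec, Pi.smul_apply, smul_eq_mul]
  split_ifs <;> simp

theorem measurePreserving_insertVec (i : Fin n) :
    MeasurePreserving (insertVec i) (volume.prod volume) (volume : Measure (Cn n)) := by
  have h1 := (volume_preserving_piEquivPiSubtypeProd (fun _ : Fin n => ℂ) (fun α => α = i)).symm
  have h2 := (volume_preserving_funUnique {α : Fin n // α = i} ℂ).symm
  -- Two instances of finiteness on the one-point index type have to be identified before the two
  -- measure-preserving maps compose.
  rw [show Subtype.fintype (fun α => α = i) = Fintype.subtypeEq i from Subsingleton.elim _ _] at h1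
  have h4 : MeasurePreserving (Prod.map (MeasurableEquiv.funUnique {α : Fin n // α = i} ℂ).symm id)
      ((volume : Measure ℂ).prod (volume : Measure ({α : Fin n // ¬ α = i} → ℂ))) volume :=
    h2.prod (MeasurePreserving.id (volume : Measure ({α : Fin n // ¬ α = i} → ℂ)))
  have h3 := h1.comp h4
  have h5 : insertVec i = (MeasurableEquiv.piEquivPiSubtypeProd (fun _ : Fin n => ℂ)
      (fun α => α = i)).symm ∘ Prod.map (MeasurableEquiv.funUnique {α : Fin n // α = i} ℂ).symm id := by
    funext x
    ext α
    by_cases h : α = i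
    · simp [h, insertVec, MeasurableEquiv.piEquivPiSubtypeProd, Equiv.piEquivPiSubtypeProd,
        MeasurableEquiv.funUnique]
    · simp [h, insertVec, MeasurableEquiv.piEquivPiSubtypeProd, Equiv.piEquivPiSubtypeProd]
  rw [h5]
  exact h3

theorem continuous_affVec (i : Fin n) : Continuous (affVec (n := n) i) := by
  refine continuous_pi fun α => ?_
  unfold affVec
  split_ifs
  · exact continuous_const
  · exact continuous_apply _

/-- Substitute v = ζ·(1, w) with the 1 in place i. For fixed ζ ≠ 0 the other n − 1 coordinates are
ζw, with real Jacobian |ζ|^{2(n−1)}, and ζ = 0 is a null set. -/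
theorem lintegral_fibre (i : Fin n) (H : Cn n → ENNReal) (hH : Measurable H) :
    ∫⁻ v, H v = ∫⁻ ζ : ℂ, ∫⁻ w : {α : Fin n // α ≠ i} → ℂ,
      ENNReal.ofReal (‖ζ‖ ^ (2 * Fintype.card {α : Fin n // α ≠ i})) * H (ζ • affVec i w) := by
  have hmp := measurePreserving_insertVec i
  have hHi : AEMeasurable (fun a => H (insertVec i a)) (volume.prod volume) :=
    (hH.comp hmp.measurable).aemeasurable
  rw [← hmp.lintegral_comp hH, lintegral_prod _ hHi]
  have hae : ∀ᵐ ζ : ℂ, ζ ≠ 0 := by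
    simp [ae_iff]
  refine lintegral_congr_ae ?_
  filter_upwards [hae] with ζ hζ
  have hm : Measurable fun u : {α : Fin n // α ≠ i} → ℂ => H (insertVec i (ζ, u)) :=
    hH.comp (hmp.measurable.comp measurable_prodMk_left)
  rw [lintegral_complex_smul hζ _ hm, ← lintegral_const_mul']
  · simp only [insertVec_smul]
  · exact ENNReal.ofReal_ne_top

/-- The radial integral. -/
def radialConst (k : ℕ) : ENNReal :=
  ∫⁻ ζ : ℂ, ENNReal.ofReal (‖ζ‖ ^ (2 * k) * radial (‖ζ‖ ^ 2))

theorem continuous_radial_integrand (k : ℕ) (G : ℝ) :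
    Continuous fun ζ : ℂ => ‖ζ‖ ^ (2 * k) * radial (‖ζ‖ ^ 2 * G) :=
  (continuous_norm.pow _).mul (radial.continuous.comp ((continuous_norm.pow 2).mul continuous_const))

theorem radialConst_ne_top (k : ℕ) : radialConst k ≠ ⊤ := by
  have hc : Continuous fun ζ : ℂ => ‖ζ‖ ^ (2 * k) * radial (‖ζ‖ ^ 2) := by
    simpa using continuous_radial_integrand k 1
  have hs : HasCompactSupport fun ζ : ℂ => ‖ζ‖ ^ (2 * k) * radial (‖ζ‖ ^ 2) := by
    refine HasCompactSupport.intro (isCompact_closedBall (0 : ℂ) 3) fun ζ hζ => ?_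
    rw [mem_closedBall_zero_iff, not_le] at hζ
    rw [radial_eq_zero, mul_zero]
    rintro ⟨_, h⟩
    nlinarith
  have hi := hc.integrable_of_hasCompactSupport hs (μ := volume)
  have h0 : ∀ ζ : ℂ, 0 ≤ ‖ζ‖ ^ (2 * k) * radial (‖ζ‖ ^ 2) := fun ζ =>
    mul_nonneg (by positivity) radial.nonneg
  exact ((hasFiniteIntegral_iff_ofReal (Filter.Eventually.of_forall h0)).1 hi.2).ne

theorem radialConst_ne_zero (k : ℕ) : radialConst k ≠ 0 := by
  have hc : Continuous fun ζ : ℂ => ‖ζ‖ ^ (2 * k) * radial (‖ζ‖ ^ 2) := by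
    simpa using continuous_radial_integrand k 1
  intro h
  have hae := (lintegral_eq_zero_iff (ENNReal.continuous_ofReal.comp hc).measurable).1 h
  have hev := Continuous.ae_eq_iff_eq volume (ENNReal.continuous_ofReal.comp hc)
    (continuous_const (y := (0 : ENNReal))) |>.1 hae
  -- At |ζ|² = 2 the cut-off is positive, so the integrand, being continuous, is not almost
  -- everywhere zero.
  have := congrFun hev ((Real.sqrt 2 : ℝ) : ℂ)
  have h2 : ‖((Real.sqrt 2 : ℝ) : ℂ)‖ ^ 2 = 2 := by
    rw [Complex.norm_real, Real.norm_eq_abs, sq_abs, Real.sq_sqrt (by norm_num)]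
  simp only [Function.comp_apply, ENNReal.ofReal_eq_zero, pow_mul, h2] at this
  have h3 := radial_two
  have : (0 : ℝ) < 2 ^ k * radial 2 := by positivity
  linarith

/-- Rescale ζ by √G: the weight contributes G^{−k} and the area of ℂ one more factor G^{−1}. For k =
n − 1 this is the power Gⁿ in the density of dμ. -/
theorem lintegral_radial (k : ℕ) {G : ℝ} (hG : 0 < G) :
    ∫⁻ ζ : ℂ, ENNReal.ofReal (‖ζ‖ ^ (2 * k) * radial (‖ζ‖ ^ 2 * G)) =
      ENNReal.ofReal ((G ^ (k + 1))⁻¹) * radialConst k := by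
  set r := Real.sqrt G with hr
  have hr0 : 0 < r := Real.sqrt_pos.2 hG
  have hr2 : r ^ 2 = G := Real.sq_sqrt hG.le
  have hH : Measurable fun ζ : ℂ => ENNReal.ofReal (‖ζ‖ ^ (2 * k) * radial (‖ζ‖ ^ 2)) :=
    (ENNReal.continuous_ofReal.comp (by simpa using continuous_radial_integrand k 1)).measurable
  have h := Measure.map_addHaar_smul (volume : Measure ℂ) hr0.ne'
  have h2 : ∫⁻ ζ, ENNReal.ofReal (‖ζ‖ ^ (2 * k) * radial (‖ζ‖ ^ 2))
      ∂(Measure.map (fun ζ : ℂ => r • ζ) volume) = ∫⁻ ζ : ℂ, ENNReal.ofReal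
        (‖r • ζ‖ ^ (2 * k) * radial (‖r • ζ‖ ^ 2)) :=
    lintegral_map hH (measurable_const_smul r)
  rw [h, lintegral_smul_measure, Complex.finrank_real_complex] at h2
  have h3 : ∀ ζ : ℂ, ENNReal.ofReal (‖r • ζ‖ ^ (2 * k) * radial (‖r • ζ‖ ^ 2)) =
      ENNReal.ofReal (G ^ k) * ENNReal.ofReal (‖ζ‖ ^ (2 * k) * radial (‖ζ‖ ^ 2 * G)) := by
    intro ζ
    have e1 : ‖r • ζ‖ ^ 2 = ‖ζ‖ ^ 2 * G := by
      rw [norm_smul, Real.norm_eq_abs, abs_of_pos hr0, mul_pow, hr2, mul_comm]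
    rw [← ENNReal.ofReal_mul (pow_pos hG k).le, pow_mul, e1, mul_pow, pow_mul]
    congr 1; ring
  simp only [h3] at h2
  rw [lintegral_const_mul' _ _ ENNReal.ofReal_ne_top, smul_eq_mul] at h2
  have hGk : (0 : ℝ) < G ^ k := pow_pos hG k
  rw [hr2, abs_of_pos (inv_pos.2 hG)] at h2
  calc _ = ENNReal.ofReal ((G ^ k)⁻¹) * (ENNReal.ofReal (G ^ k) *
        ∫⁻ ζ : ℂ, ENNReal.ofReal (‖ζ‖ ^ (2 * k) * radial (‖ζ‖ ^ 2 * G))) := by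
        rw [← mul_assoc, ← ENNReal.ofReal_mul (inv_pos.2 hGk).le, inv_mul_cancel₀ hGk.ne',
          ENNReal.ofReal_one, one_mul]
    _ = _ := by
        rw [← h2, ← mul_assoc, ← ENNReal.ofReal_mul (inv_pos.2 hGk).le, pow_succ, mul_inv]
        rfl

end Fibre

/-! ### The volume density in affine coordinates -/

section Density

variable {n : ℕ}

/-- Since v^i = 1, row i may be replaced by the v-combination of all rows, which is b. Subtracting
multiples of it from the other rows produces the corrected entries. Replacing column i by the
v̄-combination of columns then leaves G in place i and zeros elsewhere in that column, and the
determinant splits. -/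
theorem det_eq_of_euler (A : Matrix (Fin n) (Fin n) ℂ) (i : Fin n) (v : Cn n) (hv : v i = 1)
    (b c : Fin n → ℂ) (G : ℂ) (hG : G ≠ 0) (hb : ∀ β, ∑ α, v α * A α β = b β)
    (hc : ∀ α, ∑ β, star (v β) * A α β = c α) (hbv : ∑ β, star (v β) * b β = G) :
    A.det = G * (Matrix.of fun α β : {α : Fin n // α ≠ i} =>
      A α β - c α * b β / G).det := by
  classical
  set A1 := A.updateRow i b with hA1
  have h1 : A1.det = A.det := by
    have := A.det_updateRow_sum i v
    rw [hv, one_smul] at this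
    rw [← this, hA1]
    congr 2
    ext β
    simp [← hb, Finset.sum_apply]
  set B : Matrix (Fin n) (Fin n) ℂ := Matrix.of fun α β =>
    A1 α β + (if α = i then 0 else -(c α / G)) * A1 i β with hB
  have h2 : B.det = A1.det :=
    Matrix.det_eq_of_forall_row_eq_smul_add_const (fun α => if α = i then 0 else -(c α / G)) i
      (by simp) fun _ _ => rfl
  have hBi : ∀ β, B i β = b β := by intro β; simp [hB, hA1]
  have hBa : ∀ α, α ≠ i → ∀ β, B α β = A α β - c α * b β / G := by
    intro α hα β
    simp [hB, hA1, hα]; ring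
  set B1 := B.updateCol i (fun α => ∑ β, star (v β) * B α β) with hB1
  have h3 : B1.det = B.det := by
    have := B.det_updateCol_sum i (fun β => star (v β))
    rw [hv, star_one, one_smul] at this
    rw [← this, hB1]
    rfl
  have hB1i : B1 i i = G := by
    simp only [hB1, Matrix.updateCol_self, hBi, hbv]
  have hB1a : ∀ α, α ≠ i → B1 α i = 0 := by
    intro α hα
    simp only [hB1, Matrix.updateCol_self, hBa α hα, mul_sub, Finset.sum_sub_distrib, hc]
    have : ∑ β, star (v β) * (c α * b β / G) = c α * (∑ β, star (v β) * b β) / G := by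
      rw [Finset.mul_sum, Finset.sum_div]
      exact Finset.sum_congr rfl fun _ _ => by ring
    rw [this, hbv]
    field_simp
    ring
  have h4 := Matrix.twoBlockTriangular_det B1 (fun α => α = i) (by
    rintro α hα β rfl
    exact hB1a α hα)
  rw [← h1, ← h2, ← h3, h4]
  congr 1
  · trans (B1.toSquareBlockProp fun α => α = i) ⟨i, rfl⟩ ⟨i, rfl⟩
    · convert Matrix.det_unique (B1.toSquareBlockProp fun α => α = i) <;>
        exact (default : {α : Fin n // α = i}).2.symm
    · exact hB1i
  · congr 1
    ext α β
    have hβ : (β : Fin n) ≠ i := β.2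
    rw [Matrix.of_apply, ← hBa _ α.2]
    change B1 α β = _
    rw [hB1]
    exact Matrix.updateCol_ne hβ

namespace IsLocalMetric

variable {U : Set (Cn n)} {g : Pn n → ℝ} (hg : IsLocalMetric U g) {q : Pn n}
include hg

/-- `(log G)_{αβ̄} = G_{αβ̄} / G - G_α G_β̄ / G²`. -/
theorem levi_log (hq : q ∈ slit U) (α β : Fin n) :
    levi (fun r => Real.log (g r)) q α β =
      gCoef g α β q / g q - star (gBar g α q) * gBar g β q / (g q) ^ 2 := by
  have hdg : ∀ r ∈ slit U, DifferentiableAt ℝ g r := fun r hr =>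
    (hg.smooth.contDiffAt (hg.isOpen_slit.mem_nhds hr)).differentiableAt (by simp)
  have hcoe : ∀ r ∈ slit U, fderiv ℝ (fun q => (g q : ℂ)) r =
      Complex.ofRealCLM.comp (fderiv ℝ g r) := fun r hr =>
    (Complex.ofRealCLM.hasFDerivAt.comp r (hdg r hr).hasFDerivAt).fderiv
  have h1 : ∀ r ∈ slit U, dAnti (fun q => ((Real.log (g q) : ℝ) : ℂ)) r (0, unit β) =
      gBar g β r * (g r : ℂ)⁻¹ := by
    intro r hr
    have hl : fderiv ℝ (fun q => ((Real.log (g q) : ℝ) : ℂ)) r = _ :=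
      (Complex.ofRealCLM.hasFDerivAt.comp r
        ((hdg r hr).hasFDerivAt.log (hg.pos r hr).ne')).fderiv
    simp only [gBar, dAnti, hl, hcoe r hr]
    simp
    ring
  have hb := hg.differentiableAt (hg.contDiffOn_gBar β) hq
  have hG := hg.differentiableAt hg.contDiffOn_coe hq
  have hne : (g q : ℂ) ≠ 0 := Complex.ofReal_ne_zero.2 (hg.pos q hq).ne'
  have hGi : DifferentiableAt ℝ (fun r => (g r : ℂ)⁻¹) q := hG.fun_inv hne
  have h2 : dHol (fun r => (g r : ℂ)⁻¹) q (0, unit α) = -star (gBar g α q) / (g q) ^ 2 := by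
    have hs : dHol (fun r => (g r : ℂ)) q (0, unit α) = star (gBar g α q) := by
      rw [gBar, ← dHol_star]
      congr 1
      funext r
      simp
    have h0 : dHol (fun r => (g r : ℂ) * (g r : ℂ)⁻¹) q (0, unit α) = 0 := by
      rw [dHol_congr_on (h := fun _ => 1) hg.isOpen_slit hq, dHol_const]
      intro r hr
      exact mul_inv_cancel₀ (Complex.ofReal_ne_zero.2 (hg.pos r hr).ne')
    rw [dHol_mul hG hGi, hs] at h0
    field_simp
    field_simp at h0
    linear_combination h0
  change dHol (fun r => dAnti (fun q => ((Real.log (g q) : ℝ) : ℂ)) r (0, unit β)) q (0, unit α) = _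
  rw [dHol_congr_on hg.isOpen_slit hq h1, dHol_mul hb hGi, h2, gCoef_eq]
  ring

/-- The determinants of the vertical and horizontal metrics at a point of an affine chart. -/
theorem det_submatrix_levi_log (i : Fin n) {z : Cn n} (hz : z ∈ U)
    (w : {α : Fin n // α ≠ i} → ℂ) :
    ((levi (fun r => Real.log (g r)) (z, affVec i w)).submatrix
        (fun a : {α : Fin n // α ≠ i} => a.1) (fun b : {α : Fin n // α ≠ i} => b.1)).det =
      ((g (z, affVec i w) : ℂ) ^ (Fintype.card {α : Fin n // α ≠ i} + 1))⁻¹ *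
        (levi g (z, affVec i w)).det := by
  set q : Pn n := (z, affVec i w) with hqdef
  have hq : q ∈ slit U := ⟨hz, affVec_ne_zero i w⟩
  have hne : (g q : ℂ) ≠ 0 := Complex.ofReal_ne_zero.2 (hg.pos q hq).ne'
  have h := det_eq_of_euler (levi g q) i (affVec i w) (by simp [affVec])
    (fun β => gBar g β q) (fun α => star (gBar g α q)) (g q) hne
    (fun β => hg.sum_gCoef_mul hq β)
    (fun α => by
      have := congrArg star (hg.sum_gCoef_mul hq α)
      rw [star_sum] at this
      rw [← this]
      refine Finset.sum_congr rfl fun β _ => ?_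
      rw [star_mul', hg.star_gCoef hq]
      rfl)
    (hg.sum_gBar_mul hq)
  rw [h]
  have hN : ((levi (fun r => Real.log (g r)) q).submatrix
      (fun a : {α : Fin n // α ≠ i} => a.1) (fun b : {α : Fin n // α ≠ i} => b.1)) =
      (g q : ℂ)⁻¹ • (Matrix.of fun α β : {α : Fin n // α ≠ i} =>
        levi g q α β - star (gBar g α q) * gBar g β q / (g q : ℂ)) := by
    ext α β
    rw [Matrix.submatrix_apply, hg.levi_log hq, Matrix.smul_apply, smul_eq_mul, Matrix.of_apply,
      gCoef]
    field_simp
  rw [hN, Matrix.det_smul, pow_succ, mul_inv, inv_pow, mul_assoc, inv_mul_cancel_left₀ hne]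

end IsLocalMetric

end Density

end ComplexFinsler

namespace ComplexFinsler

/-! ### The volume measure over a chart -/

section SlitMeasure

theorem measurable_indicator_of_isOpen {X : Type*} [TopologicalSpace X] [MeasurableSpace X]
    [BorelSpace X] {s : Set X} (hs : IsOpen s) {h : X → ENNReal}
    (hh : Measurable fun x : s => h x) : Measurable (s.indicator h) := by
  refine measurable_of_restrict_of_restrict_compl hs.measurableSet ?_ ?_
  · convert hh using 1
    funext x
    exact Set.indicator_of_mem x.2 h
  · convert measurable_const (a := (0 : ENNReal)) using 1
    funext x
    exact Set.indicator_of_notMem x.2 h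

/-- The matrix is block triangular with J twice on the diagonal. Applied to the tangent lift of a
transition map, where the second derivative is the off-diagonal block. -/
theorem det_tangent {n : ℕ} (J B : (Fin n → ℂ) →ₗ[ℂ] (Fin n → ℂ))
    (L : (Fin n → ℂ) × (Fin n → ℂ) →ₗ[ℂ] (Fin n → ℂ) × (Fin n → ℂ))
    (hL : ∀ u w, L (u, w) = (J u, J w + B u)) : LinearMap.det L = LinearMap.det J ^ 2 := by
  classical
  let b := Pi.basisFun ℂ (Fin n)
  have h : LinearMap.toMatrix (b.prod b) (b.prod b) L =
      Matrix.fromBlocks (LinearMap.toMatrix b b J) 0 (LinearMap.toMatrix b b B)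
        (LinearMap.toMatrix b b J) := by
    ext i j
    rcases i with i | i <;> rcases j with j | j <;>
      simp [LinearMap.toMatrix_apply, hL]
  rw [← LinearMap.det_toMatrix (b.prod b), h, Matrix.det_fromBlocks_zero₁₂,
    LinearMap.det_toMatrix, sq]

variable {n : ℕ} {M : Type*} [TopologicalSpace M] [ChartedSpace (Cn n) M]
  [IsManifold 𝓘(ℂ, Cn n) ω M] {e e' : OpenPartialHomeomorph M (Cn n)} (F : FinslerMetric n M)

theorem IsLocalMetric.slitDensity_smul {U : Set (Cn n)} {g : Pn n → ℝ} (hg : IsLocalMetric U g)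
    {q : Pn n} {ζ : ℂ} (hζ : ζ ≠ 0) (hq : q ∈ slit U) :
    slitDensity g (q.1, ζ • q.2) = radial (‖ζ‖ ^ 2 * g q) * ((levi g q).det.re) ^ 2 := by
  rw [slitDensity, hg.levi_smul hζ hq, hg.homog q.1 hq.1]

/-- The two determinants in dμ combine to det²/Gⁿ, the shape produced by integrating the slit
density over the multiples of a vector. -/
theorem IsLocalMetric.volDensity_factor {U : Set (Cn n)} {g : Pn n → ℝ} (hg : IsLocalMetric U g)
    (i : Fin n) {z : Cn n} (hz : z ∈ U) (w : {α : Fin n // α ≠ i} → ℂ) :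
    (((levi (fun r => Real.log (g r)) (z, affVec i w)).submatrix
        (fun a : {α : Fin n // α ≠ i} => a.1) (fun b : {α : Fin n // α ≠ i} => b.1)).det *
      (levi g (z, affVec i w)).det).re =
      ((g (z, affVec i w)) ^ (Fintype.card {α : Fin n // α ≠ i} + 1))⁻¹ *
        ((levi g (z, affVec i w)).det.re) ^ 2 := by
  rw [hg.det_submatrix_levi_log i hz w,
    ← hg.det_levi_re (q := (z, affVec i w)) ⟨hz, affVec_ne_zero i w⟩]
  norm_cast
  ring

section

variable [NeZero n]

/-- The measure on the projectivized tangent bundle over a chart that is obtained by integrating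
along the fibres of the slit tangent bundle. -/
def slitMeas (e : OpenPartialHomeomorph M (Cn n)) : Measure (PTM n M) :=
  ((volume.restrict (slit e.target)).withDensity
    fun q => ENNReal.ofReal (slitDensity (F.loc e) q)).map (slitParam e)

theorem measurable_slitParam_coe (he : e ∈ atlas (Cn n) M) :
    Measurable fun q : slit e.target => slitParam e (q : Pn n) :=
  (continuousOn_iff_continuous_domRestrict.1 (continuousOn_slitParam he)).measurable

omit [ChartedSpace (Cn n) M] [IsManifold 𝓘(ℂ, Cn n) ω M] [NeZero n] in
theorem measurableSet_slit (e : OpenPartialHomeomorph M (Cn n)) :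
    MeasurableSet (slit e.target) :=
  (e.open_target.prod isOpen_compl_singleton).measurableSet

theorem aemeasurable_slitParam (he : e ∈ atlas (Cn n) M) :
    AEMeasurable (slitParam e) (volume.restrict (slit e.target)) :=
  aemeasurable_restrict_of_measurable_subtype (measurableSet_slit e) (measurable_slitParam_coe he)

omit [NeZero n] in
theorem aemeasurable_slitDensity (he : e ∈ atlas (Cn n) M) :
    AEMeasurable (fun q => ENNReal.ofReal (slitDensity (F.loc e) q))
      (volume.restrict (slit e.target)) :=
  ((isLocalMetric F he).continuousOn_slitDensity.aemeasurable (measurableSet_slit e)).ennreal_ofReal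

theorem lintegral_slitMeas (he : e ∈ atlas (Cn n) M) {f : PTM n M → ENNReal} (hf : Measurable f) :
    ∫⁻ p, f p ∂(slitMeas F e) =
      ∫⁻ q in slit e.target, ENNReal.ofReal (slitDensity (F.loc e) q) * f (slitParam e q) := by
  have hp := aemeasurable_slitParam he
  rw [slitMeas, lintegral_map' hf.aemeasurable
    (hp.mono_ac (withDensity_absolutelyContinuous _ _)),
    lintegral_withDensity_eq_lintegral_mul₀ (aemeasurable_slitDensity F he)
      (g := fun q => f (slitParam e q)) (hf.comp_aemeasurable hp)]
  rfl

omit [NeZero n] in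
theorem continuousOn_affParam (he : e ∈ atlas (Cn n) M) (i : Fin n) :
    ContinuousOn (affParam e i) (e.target ×ˢ Set.univ) := by
  have : NeZero n := ⟨fun h => by subst h; exact i.elim0⟩
  have h : ContinuousOn (fun q : Cn n × ({α : Fin n // α ≠ i} → ℂ) => ((q.1, affVec i q.2) : Pn n))
      (e.target ×ˢ Set.univ) :=
    continuousOn_fst.prodMk ((continuous_affVec i).comp continuous_snd).continuousOn
  exact ((continuousOn_slitParam he).comp h fun q hq => ⟨hq.1, affVec_ne_zero i q.2⟩).congr
    fun q hq => affParam_eq he i hq.1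

omit [NeZero n] in
theorem volDensity_eq (he : e ∈ atlas (Cn n) M) (i : Fin n)
    {q : Cn n × ({α : Fin n // α ≠ i} → ℂ)} (hq : q.1 ∈ e.target) :
    volDensity F e i q = 2 ^ Fintype.card {α : Fin n // α ≠ i} * 2 ^ n *
      (((F.loc e (q.1, affVec i q.2)) ^ (Fintype.card {α : Fin n // α ≠ i} + 1))⁻¹ *
        ((levi (F.loc e) (q.1, affVec i q.2)).det.re) ^ 2) := by
  rw [volDensity, (isLocalMetric F he).volDensity_factor i hq]

omit [NeZero n] in
theorem continuousOn_volDensity (he : e ∈ atlas (Cn n) M) (i : Fin n) :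
    ContinuousOn (volDensity F e i) (e.target ×ˢ Set.univ) := by
  have hg := isLocalMetric F he
  have h : ContinuousOn (fun q : Cn n × ({α : Fin n // α ≠ i} → ℂ) => ((q.1, affVec i q.2) : Pn n))
      (e.target ×ˢ Set.univ) :=
    continuousOn_fst.prodMk ((continuous_affVec i).comp continuous_snd).continuousOn
  have hm : Set.MapsTo (fun q : Cn n × ({α : Fin n // α ≠ i} → ℂ) => ((q.1, affVec i q.2) : Pn n))
      (e.target ×ˢ Set.univ) (slit e.target) := fun q hq => ⟨hq.1, affVec_ne_zero i q.2⟩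
  refine ContinuousOn.congr ?_ fun q hq => volDensity_eq F he i hq.1
  refine continuousOn_const.mul (ContinuousOn.mul (ContinuousOn.inv₀ (ContinuousOn.pow
    (hg.smooth.continuousOn.comp h hm) _) fun q hq => (pow_pos (hg.pos _ (hm hq)) _).ne') ?_)
  exact (Complex.continuous_re.comp_continuousOn (hg.contDiffOn_det.continuousOn.comp h hm)).pow 2

omit [ChartedSpace (Cn n) M] [IsManifold 𝓘(ℂ, Cn n) ω M] [NeZero n] in
theorem measurableSet_affDomain (e : OpenPartialHomeomorph M (Cn n)) (i : Fin n) :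
    MeasurableSet (e.target ×ˢ (Set.univ : Set ({α : Fin n // α ≠ i} → ℂ))) :=
  (e.open_target.prod isOpen_univ).measurableSet

omit [NeZero n] in
theorem lintegral_chartVol (he : e ∈ atlas (Cn n) M) (i : Fin n) {f : PTM n M → ENNReal}
    (hf : Measurable f) :
    ∫⁻ p, f p ∂(chartVol F e i) =
      ∫⁻ q in e.target ×ˢ Set.univ, ENNReal.ofReal (volDensity F e i q) * f (affParam e i q) := by
  have hm := measurableSet_affDomain e i
  have hp := (continuousOn_affParam he i).aemeasurable hm (μ := volume)
  have hd : AEMeasurable (fun q => ENNReal.ofReal (volDensity F e i q))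
      (volume.restrict (e.target ×ˢ Set.univ)) :=
    ((continuousOn_volDensity F he i).aemeasurable hm).ennreal_ofReal
  rw [chartVol, lintegral_map' hf.aemeasurable
    (hp.mono_ac (withDensity_absolutelyContinuous _ _)),
    lintegral_withDensity_eq_lintegral_mul₀ hd (g := fun q => f (affParam e i q))
      (hf.comp_aemeasurable hp)]
  rfl

/-- Integration along the fibres. -/
theorem lintegral_slitMeas_eq (he : e ∈ atlas (Cn n) M) (i : Fin n) {f : PTM n M → ENNReal}
    (hf : Measurable f) :
    ENNReal.ofReal (2 ^ Fintype.card {α : Fin n // α ≠ i} * 2 ^ n) * ∫⁻ p, f p ∂(slitMeas F e) =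
      radialConst (Fintype.card {α : Fin n // α ≠ i}) * ∫⁻ p, f p ∂(chartVol F e i) := by
  have hg := isLocalMetric F he
  set k := Fintype.card {α : Fin n // α ≠ i} with hk
  have hopen : IsOpen (slit e.target) := hg.isOpen_slit
  set h : Pn n → ENNReal := fun q =>
    ENNReal.ofReal (slitDensity (F.loc e) q) * f (slitParam e q) with hh
  set H := (slit e.target).indicator h with hH
  have hHm : Measurable H := by
    refine measurable_indicator_of_isOpen hopen (Measurable.mul ?_ ?_)
    · exact (continuousOn_iff_continuous_domRestrict.1
        hg.continuousOn_slitDensity).measurable.ennreal_ofReal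
    · exact hf.comp (measurable_slitParam_coe he)
  have hleft : ∫⁻ p, f p ∂(slitMeas F e) = ∫⁻ z in e.target, ∫⁻ v, H (z, v) := by
    rw [lintegral_slitMeas F he hf, ← lintegral_indicator (measurableSet_slit e),
      Measure.volume_eq_prod, lintegral_prod _ hHm.aemeasurable,
      ← lintegral_indicator e.open_target.measurableSet]
    refine lintegral_congr fun z => ?_
    by_cases hz : z ∈ e.target
    · rw [Set.indicator_of_mem hz]
    · rw [Set.indicator_of_notMem hz]
      refine (lintegral_congr fun v => ?_).trans lintegral_zero
      exact Set.indicator_of_notMem (fun hq => hz hq.1) _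
  have hright : ∫⁻ p, f p ∂(chartVol F e i) = ∫⁻ z in e.target,
      ∫⁻ w, ENNReal.ofReal (volDensity F e i (z, w)) * f (affParam e i (z, w)) := by
    rw [lintegral_chartVol F he i hf, Measure.volume_eq_prod, ← Measure.prod_restrict,
      Measure.restrict_univ, lintegral_prod]
    rw [← Measure.restrict_univ (μ := (volume : Measure ({α : Fin n // α ≠ i} → ℂ))),
      Measure.prod_restrict, ← Measure.volume_eq_prod]
    have hm := measurableSet_affDomain e i
    exact ((continuousOn_volDensity F he i).aemeasurable hm).ennreal_ofReal.mul
      (hf.comp_aemeasurable ((continuousOn_affParam he i).aemeasurable hm))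
  rw [hleft, hright, ← lintegral_const_mul' _ _ ENNReal.ofReal_ne_top,
    ← lintegral_const_mul' _ _ (radialConst_ne_top k)]
  refine setLIntegral_congr_fun e.open_target.measurableSet fun z hz => ?_
  have hHz : Measurable fun v => H (z, v) := hHm.comp measurable_prodMk_left
  -- In each fibre, integrate over the scalar ζ first. The function on the projectivized bundle and
  -- det² are constant along the line, so only the radial integral remains.
  rw [lintegral_fibre i _ hHz, lintegral_lintegral_swap, ← lintegral_const_mul' _ _
    ENNReal.ofReal_ne_top, ← lintegral_const_mul' _ _ (radialConst_ne_top k)]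
  · refine lintegral_congr fun w => ?_
    set q : Pn n := (z, affVec i w) with hq
    have hqs : q ∈ slit e.target := ⟨hz, affVec_ne_zero i w⟩
    have hG := hg.pos q hqs
    have hae : ∀ᵐ ζ : ℂ, ζ ≠ 0 := by simp [ae_iff]
    have h1 : ∫⁻ ζ : ℂ, ENNReal.ofReal (‖ζ‖ ^ (2 * k)) * H (z, ζ • affVec i w) =
        ∫⁻ ζ : ℂ, ENNReal.ofReal (‖ζ‖ ^ (2 * k) * radial (‖ζ‖ ^ 2 * F.loc e q)) *
          (ENNReal.ofReal ((levi (F.loc e) q).det.re ^ 2) * f (affParam e i (z, w))) := by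
      refine lintegral_congr_ae ?_
      filter_upwards [hae] with ζ hζ
      have hm : (z, ζ • affVec i w) ∈ slit e.target :=
        ⟨hz, smul_ne_zero hζ (affVec_ne_zero i w)⟩
      have e1 := hg.slitDensity_smul hζ hqs
      have e2 := slitParam_smul he hqs hζ
      have e3 : affParam e i (z, w) = slitParam e q := affParam_eq he i hz
      simp only [hq] at e1 e2
      rw [hH, Set.indicator_of_mem hm, hh]
      simp only
      rw [e1, e2, e3, ENNReal.ofReal_mul radial.nonneg, ENNReal.ofReal_mul (by positivity)]
      ring
    have hmr : Measurable fun ζ : ℂ =>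
        ENNReal.ofReal (‖ζ‖ ^ (2 * k) * radial (‖ζ‖ ^ 2 * F.loc e q)) :=
      (continuous_radial_integrand k _).measurable.ennreal_ofReal
    rw [h1, lintegral_mul_const _ hmr, lintegral_radial k hG,
      volDensity_eq F he i (q := (z, w)) hz, ENNReal.ofReal_mul (by positivity) (q := _ * _),
      ENNReal.ofReal_mul (inv_pos.2 (pow_pos hG _)).le]
    ring
  · refine Measurable.aemeasurable (Measurable.mul ?_ ?_)
    · exact ((continuous_norm.pow _).comp continuous_fst).measurable.ennreal_ofReal
    · exact hHz.comp (continuous_fst.smul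
        ((continuous_affVec i).comp continuous_snd)).measurable

/-- The measures over two charts agree over their intersection. -/
theorem lintegral_slitMeas_overlap (he : e ∈ atlas (Cn n) M) (he' : e' ∈ atlas (Cn n) M)
    {f : PTM n M → ENNReal} (hf : Measurable f) (h0 : ∀ p ∉ overSource e', f p = 0)
    (h0' : ∀ p ∉ overSource e, f p = 0) :
    ∫⁻ p, f p ∂(slitMeas F e) = ∫⁻ p, f p ∂(slitMeas F e') := by
  have hc := isChange_transition F he he' (one_ne_zero (α := ℂ))
  have hg := isLocalMetric F he
  have hg' := isLocalMetric F he'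
  have hWU : transitionDomain e e' ⊆ e.target := fun z hz => hz.1
  -- A function vanishing off the points over the other chart domain is integrated only over the
  -- domain of the transition map.
  have key : ∀ {e e' : OpenPartialHomeomorph M (Cn n)} (he : e ∈ atlas (Cn n) M)
      (he' : e' ∈ atlas (Cn n) M) (h0 : ∀ p ∉ overSource e', f p = 0),
      ∫⁻ p, f p ∂(slitMeas F e) = ∫⁻ q in slit (transitionDomain e e'),
        ENNReal.ofReal (slitDensity (F.loc e) q) * f (slitParam e q) := by
    intro e e' he he' h0
    rw [lintegral_slitMeas F he hf, ← lintegral_indicator (measurableSet_slit e),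
      ← lintegral_indicator (isChange_transition F he he'
        (one_ne_zero (α := ℂ))).isOpen_slit.measurableSet]
    refine lintegral_congr fun q => ?_
    by_cases hq : q ∈ slit (transitionDomain e e')
    · have hq1 : q ∈ slit e.target := ⟨hq.1.1, hq.2⟩
      rw [Set.indicator_of_mem hq1, Set.indicator_of_mem hq]
    · rw [Set.indicator_of_notMem hq]
      by_cases hq1 : q ∈ slit e.target
      · rw [Set.indicator_of_mem hq1, h0, mul_zero]
        intro hp
        have hp' : (slitParam e q).base ∈ e'.source := hp
        rw [slitParam_base] at hp'
        exact hq ⟨⟨hq1.1, hp'⟩, hq1.2⟩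
      · exact Set.indicator_of_notMem hq1 _
  rw [key he he' h0, key he' he h0']
  choose! L hL hL2 using fun q (hq : q ∈ slit (transitionDomain e e')) =>
    hc.exists_hasFDerivAt_lift hq
  have hinv : ∀ {e e' : OpenPartialHomeomorph M (Cn n)} (he : e ∈ atlas (Cn n) M)
      (he' : e' ∈ atlas (Cn n) M), ∀ q ∈ slit (transitionDomain e e'),
      tangentLift (transition e' e) 1 (tangentLift (transition e e') 1 q) = q := by
    intro e e' he he' q hq
    refine Prod.ext (transition_transition hq.1) ?_
    simp only [tangentLift, one_smul]
    exact fderiv_transition_symm he he' hq.1 q.2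
  have hmaps : ∀ {e e' : OpenPartialHomeomorph M (Cn n)} (he : e ∈ atlas (Cn n) M)
      (he' : e' ∈ atlas (Cn n) M), ∀ q ∈ slit (transitionDomain e e'),
      tangentLift (transition e e') 1 q ∈ slit (transitionDomain e' e) := by
    intro e e' he he' q hq
    exact ⟨transition_mem hq.1,
      ((isChange_transition F he he' (one_ne_zero (α := ℂ))).lift_mem hq).2⟩
  have himg : tangentLift (transition e e') 1 '' slit (transitionDomain e e') =
      slit (transitionDomain e' e) := by
    ext q
    constructor
    · rintro ⟨r, hr, rfl⟩
      exact hmaps he he' r hr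
    · intro hq
      exact ⟨_, hmaps he' he q hq, hinv he' he q hq⟩
  have : (volume : Measure (Pn n)).IsAddHaarMeasure :=
    Measure.prod.instIsAddHaarMeasure volume volume
  rw [← himg, lintegral_image_eq_lintegral_abs_det_fderiv_mul volume
    hc.isOpen_slit.measurableSet
    (fun q hq => ((hL q hq).restrictScalars ℝ).hasFDerivWithinAt)
    (Set.LeftInvOn.injOn (hinv he he'))]
  refine setLIntegral_congr_fun hc.isOpen_slit.measurableSet fun q hq => ?_
  rw [slitParam_transition he he' hq, ← mul_assoc, ← ENNReal.ofReal_mul (abs_nonneg _)]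
  congr 2
  have hq' := hmaps he he' q hq
  have hq'' : tangentLift (transition e e') 1 q ∈ slit e'.target := ⟨hq'.1.1, hq'.2⟩
  have hqe : q ∈ slit e.target := ⟨hq.1.1, hq.2⟩
  set J := jac (transition e e') q.1 with hJ
  have hdetJ : LinearMap.det ((fderiv ℂ (transition e e') q.1 : Cn n →L[ℂ] Cn n) : Cn n →ₗ[ℂ] Cn n)
      = J.det := by
    rw [← LinearMap.det_toLin' J]
    congr 1
    ext1 α
    ext1
    rw [Matrix.toLin'_apply', LinearMap.comp_apply, LinearMap.comp_apply, Matrix.mulVecLin_apply,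
      hJ, jac_mulVec]
    rfl
  -- The real Jacobian of the tangent lift is |det J|⁴, and det G = |det J|² det G'; so the square
  -- of det G in the slit density is what makes it a density invariant under transition maps.
  have hdet : ((L q).restrictScalars ℝ).det = Complex.normSq J.det ^ 2 := by
    have := det_tangent (fderiv ℂ (transition e e') q.1 : Cn n →ₗ[ℂ] Cn n)
      ((fderiv ℂ (fderiv ℂ (transition e e')) q.1).flip q.2 : Cn n →ₗ[ℂ] Cn n)
      (L q : Pn n →ₗ[ℂ] Pn n) (fun u w => by
        simpa using hL2 q hq u w)
    change LinearMap.det ((L q : Pn n →ₗ[ℂ] Pn n).restrictScalars ℝ) = _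
    rw [det_restrictScalars_eq, this, hdetJ, map_pow]
  have hd := hc.det_levi_eq hg hg' hWU hq
  have hd2 : (levi (F.loc e) q).det.re = Complex.normSq J.det *
      (levi (F.loc e') (tangentLift (transition e e') 1 q)).det.re := by
    rw [hd, ← hg'.det_levi_re hq'', ← starRingEnd_apply, Complex.mul_conj, ← Complex.ofReal_mul,
      Complex.ofReal_re, Complex.ofReal_re]
  have hgeq := hc.eq q hq
  rw [norm_one, one_pow, one_mul] at hgeq
  rw [hdet, slitDensity, slitDensity, hgeq, hd2, abs_of_nonneg (by positivity)]
  ring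

end

end SlitMeasure

end ComplexFinsler

namespace ComplexFinsler

/-! ### Partitions of unity and the volume measure -/

section Gluing

variable {n : ℕ} {M : Type*} [TopologicalSpace M] [ChartedSpace (Cn n) M]

variable (n M) in
/-- A finite smooth partition of unity subordinate to the preferred charts. -/
structure ChartPartition where
  index : Finset M
  toFun : M → M → ℝ
  nonneg : ∀ j x, 0 ≤ toFun j x
  continuous : ∀ j, Continuous (toFun j)
  smooth : ∀ e ∈ atlas (Cn n) M, ∀ j, ContDiffOn ℝ ∞ (fun z => toFun j (e.symm z)) e.target
  sum_eq_one : ∀ x, ∑ j ∈ index, toFun j x = 1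
  tsupport_subset : ∀ j, tsupport (toFun j) ⊆ (chartAt (Cn n) j).source
  exists_compact : ∀ j, ∃ K ⊆ (chartAt (Cn n) j).target, IsCompact K ∧
    ∀ z ∈ (chartAt (Cn n) j).target, z ∉ K → toFun j ((chartAt (Cn n) j).symm z) = 0

theorem ChartPartition.eq_zero (P : ChartPartition n M) (j : M) {x : M}
    (hx : x ∉ (chartAt (Cn n) j).source) : P.toFun j x = 0 :=
  image_eq_zero_of_notMem_tsupport fun h => hx (P.tsupport_subset j h)

variable [IsManifold 𝓘(ℂ, Cn n) ω M]

variable (n M) in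
-- Partitions of unity need the underlying real smooth structure; holomorphic transition maps are
-- real smooth.
theorem isManifold_real : IsManifold 𝓘(ℝ, Cn n) ∞ M := by
  refine isManifold_of_contDiffOn 𝓘(ℝ, Cn n) ∞ M fun e e' he he' => ?_
  have h := ((contDiffOn_transition he he').restrict_scalars ℝ).of_le (m := ∞) (by simp)
  refine h.mono fun z hz => ?_
  have h2 : z ∈ (e.symm ≫ₕ e').source := by simpa using hz
  rw [OpenPartialHomeomorph.trans_source] at h2
  exact h2

theorem nonempty_chartPartition [T2Space M] [CompactSpace M] : Nonempty (ChartPartition n M) := by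
  have := isManifold_real n M
  obtain ⟨f, hf⟩ := SmoothPartitionOfUnity.exists_isSubordinate_chartAt_source 𝓘(ℝ, Cn n) M
  have hfin := f.locallyFinite'.finite_nonempty_of_compact
  refine ⟨{
    index := hfin.toFinset
    toFun := fun j x => f j x
    nonneg := fun j x => f.nonneg j x
    continuous := fun j => (f j).contMDiff.continuous
    smooth := fun e he j => ?_
    sum_eq_one := fun x => ?_
    tsupport_subset := hf
    exists_compact := fun j => ?_ }⟩
  · exact contMDiffOn_iff_contDiffOn.1 ((f j).contMDiff.comp_contMDiffOn
      (contMDiffOn_symm_of_mem_maximalAtlas (IsManifold.subset_maximalAtlas he)))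
  · rw [← f.sum_eq_one (Set.mem_univ x)]
    refine (finsum_eq_sum_of_support_subset _ fun j hj => ?_).symm
    exact hfin.mem_toFinset.2 ⟨x, hj⟩
  · refine ⟨chartAt (Cn n) j '' tsupport (f j), ?_, ?_, ?_⟩
    · rintro _ ⟨x, hx, rfl⟩
      exact (chartAt (Cn n) j).map_source (hf j hx)
    · exact (isClosed_tsupport _).isCompact.image_of_continuousOn
        ((chartAt (Cn n) j).continuousOn.mono (hf j))
    · intro z hz hzK
      refine image_eq_zero_of_notMem_tsupport fun h => hzK ⟨_, h, ?_⟩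
      exact (chartAt (Cn n) j).right_inv hz

variable {e e' : OpenPartialHomeomorph M (Cn n)} (F : FinslerMetric n M)

theorem card_ne (i : Fin n) : Fintype.card {α : Fin n // α ≠ i} = n - 1 := by
  simp [Fintype.card_subtype_compl]

/-- Both integrals are the same finite nonzero multiple of the fibre integral over the slit bundle,
for which independence of the chart is known. This also compares different affine indices. -/
theorem lintegral_chartVol_overlap (he : e ∈ atlas (Cn n) M) (he' : e' ∈ atlas (Cn n) M)
    (i i' : Fin n) {f : PTM n M → ENNReal} (hf : Measurable f) (h0 : ∀ p ∉ overSource e, f p = 0)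
    (h0' : ∀ p ∉ overSource e', f p = 0) :
    ∫⁻ p, f p ∂(chartVol F e i) = ∫⁻ p, f p ∂(chartVol F e' i') := by
  have : NeZero n := ⟨fun h => by subst h; exact i.elim0⟩
  have h1 := lintegral_slitMeas_eq F he i hf
  have h2 := lintegral_slitMeas_eq F he' i' hf
  rw [← lintegral_slitMeas_overlap F he he' hf h0' h0, card_ne] at h2
  rw [card_ne] at h1
  exact (ENNReal.mul_right_inj (radialConst_ne_zero _) (radialConst_ne_top _)).1 (h1.symm.trans h2)

theorem measurableSet_overSource (e : OpenPartialHomeomorph M (Cn n)) :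
    MeasurableSet (overSource (n := n) e) := (isOpen_overSource e).measurableSet

theorem lintegral_chartVol_indicator (he : e ∈ atlas (Cn n) M) (i : Fin n) {f : PTM n M → ENNReal}
    (hf : Measurable f) :
    ∫⁻ p, f p ∂(chartVol F e i) = ∫⁻ p, (overSource e).indicator f p ∂(chartVol F e i) := by
  rw [lintegral_chartVol F he i hf,
    lintegral_chartVol F he i (hf.indicator (measurableSet_overSource e))]
  refine setLIntegral_congr_fun (measurableSet_affDomain e i) fun q hq => ?_
  have : NeZero n := ⟨fun h => by subst h; exact i.elim0⟩
  have hm : affParam e i q ∈ overSource e := by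
    rw [affParam_eq he i hq.1]
    change (slitParam e (q.1, affVec i q.2)).base ∈ e.source
    rw [slitParam_base]
    exact e.map_target hq.1
  rw [Set.indicator_of_mem hm]

theorem chartVol_le (he : e ∈ atlas (Cn n) M) (i : Fin n) : chartVol F e i ≤ volPTM F :=
  le_iSup₂_of_le e he (le_iSup (fun i => chartVol F e i) i)

/-- A supremum of measures is squeezed. It is at least each chart measure; it is at most the measure
ν glued from chart measures by a partition of unity, because ν coincides over each chart domain with
the chart measure. -/
theorem lintegral_volPTM [T2Space M] [CompactSpace M] (he : e ∈ atlas (Cn n) M) (i : Fin n)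
    {f : PTM n M → ENNReal} (hf : Measurable f) (h0 : ∀ p ∉ overSource e, f p = 0) :
    ∫⁻ p, f p ∂(volPTM F) = ∫⁻ p, f p ∂(chartVol F e i) := by
  obtain ⟨P⟩ := nonempty_chartPartition (n := n) (M := M)
  set r : M → PTM n M → ENNReal := fun j p => ENNReal.ofReal (P.toFun j p.base) with hr
  have hrm : ∀ j, Measurable (r j) := fun j =>
    ((P.continuous j).comp continuous_base).measurable.ennreal_ofReal
  have hr1 : ∀ p, ∑ j ∈ P.index, r j p = 1 := by
    intro p
    rw [hr, ← ENNReal.ofReal_sum_of_nonneg fun j _ => P.nonneg j _, P.sum_eq_one,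
      ENNReal.ofReal_one]
  set ν : Measure (PTM n M) :=
    ∑ j ∈ P.index, (chartVol F (chartAt (Cn n) j) i).withDensity (r j) with hν
  have hνf : ∀ {e : OpenPartialHomeomorph M (Cn n)} (he : e ∈ atlas (Cn n) M) (i' : Fin n)
      {f : PTM n M → ENNReal} (hf : Measurable f) (h0 : ∀ p ∉ overSource e, f p = 0),
      ∫⁻ p, f p ∂ν = ∫⁻ p, f p ∂(chartVol F e i') := by
    intro e he i' f hf h0
    rw [hν, lintegral_finsetSum_measure]
    have h1 : ∀ j ∈ P.index, ∫⁻ p, f p ∂((chartVol F (chartAt (Cn n) j) i).withDensity (r j)) =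
        ∫⁻ p, r j p * f p ∂(chartVol F e i') := by
      intro j _
      rw [lintegral_withDensity_eq_lintegral_mul _ (hrm j) hf]
      refine lintegral_chartVol_overlap F (chart_mem_atlas _ j) he i i' ((hrm j).mul hf) ?_ ?_
      · intro p hp
        simp only [Pi.mul_apply, hr]
        rw [P.eq_zero j hp, ENNReal.ofReal_zero, zero_mul]
      · intro p hp
        rw [Pi.mul_apply, h0 p hp, mul_zero]
    rw [Finset.sum_congr rfl h1, ← lintegral_finsetSum (f := fun j p => r j p * f p) _
      fun j _ => (hrm j).mul hf]
    refine lintegral_congr fun p => ?_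
    rw [← Finset.sum_mul, hr1, one_mul]
  have hle : volPTM F ≤ ν := by
    refine iSup₂_le fun e he => iSup_le fun i' => Measure.le_iff.2 fun A hA => ?_
    have hAm : Measurable (A.indicator (1 : PTM n M → ENNReal)) := measurable_one.indicator hA
    rw [← lintegral_indicator_one hA, ← lintegral_indicator_one hA,
      lintegral_chartVol_indicator F he i' hAm,
      ← hνf he i' (hAm.indicator (measurableSet_overSource e)) fun p hp =>
        Set.indicator_of_notMem hp _]
    exact lintegral_mono (Set.indicator_le_self _ _)
  refine le_antisymm ?_ (lintegral_mono' (chartVol_le F he i) le_rfl)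
  rw [← hνf he i hf h0]
  exact lintegral_mono' hle le_rfl

/-! ### Integrals over the projectivized bundle as integrals over the slit bundle. -/

section

variable [NeZero n] [T2Space M] [CompactSpace M]

variable (n) in
/-- The ratio between the volume of the projectivized tangent bundle and the fibre integral over
the slit tangent bundle. -/
def slitRatio : ENNReal := ENNReal.ofReal (2 ^ (n - 1) * 2 ^ n) / radialConst (n - 1)

omit [NeZero n] in
theorem slitRatio_ne_top : slitRatio n ≠ ⊤ :=
  ENNReal.div_ne_top ENNReal.ofReal_ne_top (radialConst_ne_zero _)

omit [NeZero n] in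
theorem slitRatio_ne_zero : slitRatio n ≠ 0 :=
  ENNReal.div_ne_zero.2 ⟨by simp, radialConst_ne_top _⟩

theorem volPTM_restrict (he : e ∈ atlas (Cn n) M) :
    (volPTM F).restrict (overSource e) = slitRatio n • slitMeas F e := by
  refine Measure.ext_of_lintegral _ fun f hf => ?_
  have hfi := hf.indicator (measurableSet_overSource (n := n) e)
  rw [← lintegral_indicator (measurableSet_overSource e),
    lintegral_volPTM F he 0 hfi fun p hp => Set.indicator_of_notMem hp _,
    ← lintegral_chartVol_indicator F he 0 hf, lintegral_smul_measure, smul_eq_mul, slitRatio]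
  have h := lintegral_slitMeas_eq F he 0 hf
  rw [card_ne] at h
  rw [ENNReal.div_eq_inv_mul, mul_assoc, h, ← mul_assoc,
    ENNReal.inv_mul_cancel (radialConst_ne_zero _) (radialConst_ne_top _), one_mul]

variable {f : PTM n M → ℂ}

theorem integrable_volPTM_of_local (he : e ∈ atlas (Cn n) M) (hf : Continuous f)
    (h0 : ∀ p ∉ overSource e, f p = 0)
    (hi : IntegrableOn (fun q => f (slitParam e q) * slitDensity (F.loc e) q) (slit e.target)) :
    Integrable f (volPTM F) := by
  have hp := aemeasurable_slitParam he
  have hd := aemeasurable_slitDensity F he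
  have h1 : Integrable f (slitMeas F e) := by
    rw [slitMeas, integrable_map_measure hf.aestronglyMeasurable
      (hp.mono_ac (withDensity_absolutelyContinuous _ _)),
      integrable_withDensity_iff_integrable_smul₀' hd (by simp)]
    refine hi.congr (Filter.Eventually.of_forall fun q => ?_)
    simp only [Function.comp_apply]
    rw [ENNReal.toReal_ofReal (slitDensity_nonneg _ _), Complex.real_smul, mul_comm]
  have h2 : IntegrableOn f (overSource e) (volPTM F) := by
    rw [IntegrableOn, volPTM_restrict F he]
    exact h1.smul_measure slitRatio_ne_top
  exact (integrableOn_iff_integrable_of_support_subset fun p hp => by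
    by_contra h; exact hp (h0 p h)).1 h2

theorem integral_volPTM_of_local (he : e ∈ atlas (Cn n) M) (hf : Continuous f)
    (h0 : ∀ p ∉ overSource e, f p = 0) :
    ∫ p, f p ∂(volPTM F) = (slitRatio n).toReal •
      ∫ q in slit e.target, f (slitParam e q) * slitDensity (F.loc e) q := by
  have hp := aemeasurable_slitParam he
  have hd := aemeasurable_slitDensity F he
  rw [← setIntegral_eq_integral_of_forall_compl_eq_zero h0, volPTM_restrict F he,
    integral_smul_measure, slitMeas, integral_map
      (hp.mono_ac (withDensity_absolutelyContinuous _ _)) hf.aestronglyMeasurable,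
    integral_withDensity_eq_integral_toReal_smul₀ hd (by simp)]
  congr 1
  refine integral_congr_ae (Filter.Eventually.of_forall fun q => ?_)
  simp only
  rw [ENNReal.toReal_ofReal (slitDensity_nonneg _ _), Complex.real_smul, mul_comm]

/-- Continuous functions on the projectivized tangent bundle are integrable. -/
theorem integrable_volPTM (hf : Continuous f) : Integrable f (volPTM F) := by
  obtain ⟨P⟩ := nonempty_chartPartition (n := n) (M := M)
  have hsum : f = fun p => ∑ j ∈ P.index, (P.toFun j p.base : ℂ) * f p := by
    funext p
    rw [← Finset.sum_mul, ← Complex.ofReal_sum, P.sum_eq_one, Complex.ofReal_one, one_mul]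
  rw [hsum]
  refine integrable_finsetSum _ fun j _ => ?_
  have he := chart_mem_atlas (Cn n) j
  obtain ⟨K, hKU, hK, hK0⟩ := P.exists_compact j
  have hc : Continuous fun p : PTM n M => (P.toFun j p.base : ℂ) * f p :=
    (Complex.continuous_ofReal.comp ((P.continuous j).comp continuous_base)).mul hf
  refine integrable_volPTM_of_local F he hc (fun p hp => ?_) ?_
  · rw [P.eq_zero j hp, Complex.ofReal_zero, zero_mul]
  · refine (isLocalMetric F he).integrableOn_mul_slitDensity hK hKU
      (hc.comp_continuousOn (continuousOn_slitParam he)) fun q hq hqK => ?_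
    rw [slitParam_base, hK0 q.1 hq.1 hqK, Complex.ofReal_zero, zero_mul]

/-- A nonnegative continuous function with integral zero vanishes. -/
theorem eq_zero_of_integral_volPTM (hf : Continuous f) (hre : ∀ p, 0 ≤ (f p).re)
    (him : ∀ p, (f p).im = 0) (hI : ∫ p, f p ∂(volPTM F) = 0) : f = 0 := by
  have hfr : Continuous fun p => (f p).re := Complex.continuous_re.comp hf
  have hint := (integrable_volPTM F hf).re
  have hz : ∫ p, (f p).re ∂(volPTM F) = 0 := by
    have := integral_re (integrable_volPTM F hf)
    simpa [hI] using this
  have hae := (integral_eq_zero_iff_of_nonneg hre hint).1 hz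
  funext p
  refine Complex.ext ?_ (him p)
  set e := chartAt (Cn n) p.base with hedef
  have he : e ∈ atlas (Cn n) M := chart_mem_atlas _ _
  have hg := isLocalMetric F he
  have hae2 : ∀ᵐ p ∂(slitMeas F e), (f p).re = 0 := by
    have h1 : ∀ᵐ p ∂((volPTM F).restrict (overSource e)), (f p).re = 0 := ae_restrict_of_ae hae
    rwa [volPTM_restrict F he, Filter.Eventually, Measure.ae_ennreal_smul_measure_eq slitRatio_ne_zero] at h1
  have hae3 : ∀ᵐ q ∂(volume.restrict (slit e.target)),
      ENNReal.ofReal (slitDensity (F.loc e) q) ≠ 0 → (f (slitParam e q)).re = 0 := by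
    have h1 := ae_of_ae_map ((aemeasurable_slitParam he).mono_ac
      (withDensity_absolutelyContinuous _ _)) hae2
    rwa [ae_withDensity_iff' (aemeasurable_slitDensity F he)] at h1
  have hcont : ContinuousOn (fun q => slitDensity (F.loc e) q * (f (slitParam e q)).re)
      (slit e.target) :=
    hg.continuousOn_slitDensity.mul (hfr.comp_continuousOn (continuousOn_slitParam he))
  -- Continuity on the open slit domain promotes almost everywhere vanishing to vanishing.
  have heq : Set.EqOn (fun q => slitDensity (F.loc e) q * (f (slitParam e q)).re) (fun _ => 0)
      (slit e.target) := by
    refine Measure.eqOn_open_of_ae_eq (μ := volume) ?_ hg.isOpen_slit hcont continuousOn_const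
    filter_upwards [hae3] with q hq
    by_cases h : slitDensity (F.loc e) q = 0
    · rw [h, zero_mul]
    · have := hq (by
        rw [Ne, ENNReal.ofReal_eq_zero, not_le]
        exact lt_of_le_of_ne (slitDensity_nonneg _ _) (Ne.symm h))
      rw [this, mul_zero]
  have hq := coord_mem p
  set q := coord p with hqdef
  have hG := hg.pos q hq
  -- The rescaled vector spans the same line and has G = 2, where the cut-off is positive.
  set t : ℝ := Real.sqrt (2 / F.loc e q) with ht
  have ht0 : 0 < t := Real.sqrt_pos.2 (by positivity)
  have htc : ((t : ℝ) : ℂ) ≠ 0 := Complex.ofReal_ne_zero.2 ht0.ne'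
  have hqt : (q.1, (t : ℂ) • q.2) ∈ slit e.target := ⟨hq.1, smul_ne_zero htc hq.2⟩
  have h := heq hqt
  simp only at h
  rw [hg.slitDensity_smul htc hq, slitParam_smul he hq htc, slitParam_eq he hq,
    Complex.norm_real, Real.norm_eq_abs, sq_abs, Real.sq_sqrt (by positivity),
    div_mul_cancel₀ _ hG.ne'] at h
  have hdet : (levi (F.loc e) q).det.re ≠ 0 := by
    intro h0
    have := hg.det_levi_re hq
    rw [h0, Complex.ofReal_zero] at this
    exact hg.det_ne_zero hq this.symm
  rw [linePoint_coord] at h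
  rcases mul_eq_zero.1 h with h | h
  · exact absurd h (mul_ne_zero radial_two.ne' (pow_ne_zero 2 hdet))
  · exact h

end

end Gluing

end ComplexFinsler

namespace ComplexFinsler

/-! ### Horizontal forms -/

section Forms

variable {n : ℕ} {M : Type*} [TopologicalSpace M] [ChartedSpace (Cn n) M]
  [IsManifold 𝓘(ℂ, Cn n) ω M] {e : OpenPartialHomeomorph M (Cn n)} (F : FinslerMetric n M)

/-- Contractions of horizontal tensors in an arbitrary chart and in the preferred one. -/
theorem contraction_linePoint (he : e ∈ atlas (Cn n) M) {q : Pn n} (hq : q ∈ slit e.target)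
    (h : vec e q.1 q.2 ≠ 0) (A : Fin n → Fin n → ℂ) (A' : Pn n → Fin n → Fin n → ℂ)
    (hA : ∀ ζ : ℂ, ζ ≠ 0 → ∀ α β, A α β = ∑ σ, ∑ τ,
      jac (transition e (chartAt (Cn n) (e.symm q.1))) q.1 σ α *
        star (jac (transition e (chartAt (Cn n) (e.symm q.1))) q.1 τ β) *
        A' (tangentLift (transition e (chartAt (Cn n) (e.symm q.1))) ζ q) σ τ) :
    ∑ σ, ∑ τ, gInvAt F (linePoint e q.1 q.2 h) τ σ * A' (coord (linePoint e q.1 q.2 h)) σ τ =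
      ∑ α, ∑ β, gInv (F.loc e) q β α * A α β := by
  obtain ⟨ζ, hζ, hco⟩ := coord_linePoint he hq h
  have he' := chart_mem_atlas (Cn n) (e.symm q.1)
  rw [(isChange_transition F he he' hζ).contraction_eq (isLocalMetric F he) (isLocalMetric F he')
    (fun z hz => hz.1) (slit_transitionDomain hq) A _ (hA ζ hζ)]
  unfold gInvAt
  rw [hco]
  rfl

theorem inner01_eq (φ ψ : Raw01 n M) (p : PTM n M) :
    inner01 F φ ψ p = ∑ δ, ∑ β, gInvAt F p β δ *
      (coef01 φ (chartAt (Cn n) p.base) β (coord p) *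
        star (coef01 ψ (chartAt (Cn n) p.base) δ (coord p))) := by
  rw [inner01, Finset.sum_comm]
  refine Finset.sum_congr rfl fun δ _ => Finset.sum_congr rfl fun β _ => ?_
  rw [raw01_frame, raw01_frame]
  ring

theorem inner01_linePoint (he : e ∈ atlas (Cn n) M) (φ ψ : Raw01 n M) {q : Pn n}
    (hq : q ∈ slit e.target) (h : vec e q.1 q.2 ≠ 0) :
    inner01 F φ ψ (linePoint e q.1 q.2 h) = ∑ δ, ∑ β, gInv (F.loc e) q β δ *
      (coef01 φ e β q * star (coef01 ψ e δ q)) := by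
  have he' := chart_mem_atlas (Cn n) (e.symm q.1)
  rw [inner01_eq]
  refine contraction_linePoint F he hq h (fun δ β => coef01 φ e β q * star (coef01 ψ e δ q))
    (fun r δ β => coef01 φ (chartAt (Cn n) (e.symm q.1)) β r *
      star (coef01 ψ (chartAt (Cn n) (e.symm q.1)) δ r)) fun ζ hζ δ β => ?_
  have hqt := slit_transitionDomain hq
  rw [coef01_transition φ he he' hqt hζ β, coef01_transition ψ he he' hqt hζ δ, star_sum,
    Finset.sum_mul_sum, Finset.sum_comm]
  refine Finset.sum_congr rfl fun σ _ => Finset.sum_congr rfl fun τ _ => ?_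
  rw [star_mul', star_star]
  ring

theorem sum_gInvAt_mul_gCoef (p : PTM n M) (α γ : Fin n) :
    ∑ β, gInvAt F p α β * gCoef (F.locAt p) β γ (coord p) = if α = γ then 1 else 0 :=
  (isLocalMetric F (chart_mem_atlas (Cn n) p.base)).sum_gInv_mul_gCoef (coord_mem p) α γ

/-- The trace of a `(1,1)`-form. -/
theorem inner11_omegaH (η : Raw11 n M) (p : PTM n M) :
    inner11 F η (omegaH F) p = -Complex.I * ∑ α, ∑ β, gInvAt F p β α *
      η p (frame p.base α) (frame p.base β) := by
  have hg : IsLocalMetric (chartAt (Cn n) p.base).target (F.locAt p) :=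
    isLocalMetric F (chart_mem_atlas (Cn n) p.base)
  rw [inner11, Finset.mul_sum]
  refine Finset.sum_congr rfl fun α _ => ?_
  rw [Finset.mul_sum]
  refine Finset.sum_congr rfl fun β _ => ?_
  have h1 : ∀ γ δ, star (omegaH F p (frame p.base γ) (frame p.base δ)) =
      -Complex.I * gCoef (F.locAt p) δ γ (coord p) := by
    intro γ δ
    rw [omegaH, sesq_frame, star_mul', hg.star_gCoef (coord_mem p)]
    simp
  simp only [h1]
  have h2 : ∀ γ, ∑ δ, η p (frame p.base α) (frame p.base β) * gInvAt F p γ α * gInvAt F p β δ *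
      (-Complex.I * gCoef (F.locAt p) δ γ (coord p)) =
      η p (frame p.base α) (frame p.base β) * gInvAt F p γ α * -Complex.I *
        (if β = γ then 1 else 0) := by
    intro γ
    rw [← sum_gInvAt_mul_gCoef F, Finset.mul_sum]
    exact Finset.sum_congr rfl fun _ _ => by ring
  simp only [h2]
  simp
  ring

theorem inner11_delH (ψ : Form01 n M) (p : PTM n M) :
    inner11 F (delH F ψ) (omegaH F) p = -Complex.I * ∑ α, ∑ β, gInvAt F p β α *
      dHol (coef01 ψ.toRaw (chartAt (Cn n) p.base) β) (coord p)
        (horVec (F.locAt p) α (coord p)) := by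
  rw [inner11_omegaH]
  simp only [delH, sesq_frame, act_hor]

theorem inner11_delH_linePoint (he : e ∈ atlas (Cn n) M) (ψ : Form01 n M) {q : Pn n}
    (hq : q ∈ slit e.target) (h : vec e q.1 q.2 ≠ 0) :
    inner11 F (delH F ψ) (omegaH F) (linePoint e q.1 q.2 h) =
      -Complex.I * ∑ α, ∑ β, gInv (F.loc e) q β α *
        dHol (coef01 ψ.toRaw e β) q (horVec (F.loc e) α q) := by
  have he' := chart_mem_atlas (Cn n) (e.symm q.1)
  rw [inner11_delH]
  congr 1
  refine contraction_linePoint F he hq h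
    (fun α β => dHol (coef01 ψ.toRaw e β) q (horVec (F.loc e) α q))
    (fun r α β => dHol (coef01 ψ.toRaw (chartAt (Cn n) (e.symm q.1)) β) r
      (horVec (F.loc (chartAt (Cn n) (e.symm q.1))) α r)) fun ζ hζ α β => ?_
  exact (isChange_transition F he he' hζ).dHol_horVec_anti (isLocalMetric F he)
    (isLocalMetric F he') (fun z hz => hz.1) (fun τ => ψ.smooth _ he' τ)
    (fun β r hr => coef01_transition ψ.toRaw he he' hr hζ β) (slit_transitionDomain hq) α β

theorem continuous_inner01 (φ ψ : Form01 n M) : Continuous (inner01 F φ.toRaw ψ.toRaw) := by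
  refine continuous_of_local (fe := fun e q => ∑ δ, ∑ β, gInv (F.loc e) q β δ *
      (coef01 φ.toRaw e β q * star (coef01 ψ.toRaw e δ q))) (fun e he => ?_)
    fun e he q hq h => inner01_linePoint F he _ _ hq h
  refine continuousOn_finsetSum _ fun δ _ => continuousOn_finsetSum _ fun β _ =>
    ((isLocalMetric F he).contDiffOn_gInv β δ).continuousOn.mul
      ((φ.smooth e he β).continuousOn.mul (ψ.smooth e he δ).star'.continuousOn)

theorem continuous_inner11_delH (ψ : Form01 n M) :
    Continuous (inner11 F (delH F ψ) (omegaH F)) := by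
  refine continuous_of_local (fe := fun e q => -Complex.I * ∑ α, ∑ β, gInv (F.loc e) q β α *
        dHol (coef01 ψ.toRaw e β) q (horVec (F.loc e) α q)) (fun e he => ?_)
    fun e he q hq h => inner11_delH_linePoint F he ψ hq h
  refine continuousOn_const.mul (continuousOn_finsetSum _ fun α _ =>
    continuousOn_finsetSum _ fun β _ =>
      ((isLocalMetric F he).contDiffOn_gInv β α).continuousOn.mul
        ((isLocalMetric F he).contDiffOn_dHol_horVec (ψ.smooth e he β) α).continuousOn)

/-! ### Conjugation -/

/-- The conjugate of a `(0,1)`-form. -/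
def Form01.conj (φ : Form01 n M) : Form10 n M where
  toRaw p :=
    { toFun := fun X => star (φ.toRaw p X)
      map_add' := fun X Y => by rw [map_add, star_add]
      map_smul' := fun c X => by simp }
  smooth e he α := by
    refine (φ.smooth e he α).star'.congr fun q hq => ?_
    have h : vec e q.1 q.2 ≠ 0 := vec_ne_zero he hq.1 hq.2
    rw [coef10_eq _ h, coef01_eq _ h]
    rfl

/-- The conjugate of a `(1,0)`-form. -/
def Form10.conj (φ : Form10 n M) : Form01 n M where
  toRaw p :=
    { toFun := fun X => star (φ.toRaw p X)
      map_add' := fun X Y => by rw [map_add, star_add]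
      map_smul' := fun c X => by simp }
  smooth e he α := by
    refine (φ.smooth e he α).star'.congr fun q hq => ?_
    have h : vec e q.1 q.2 ≠ 0 := vec_ne_zero he hq.1 hq.2
    rw [coef01_eq _ h, coef10_eq _ h]
    rfl

theorem Form01.conj_apply (φ : Form01 n M) (p : PTM n M)
    (X : TangentSpace 𝓘(ℂ, Cn n) p.base) : φ.conj.toRaw p X = star (φ.toRaw p X) := rfl

theorem Form10.conj_conj (φ : Form10 n M) : φ.conj.conj = φ := by
  refine Form10.ext (funext fun p => LinearMap.ext fun X => ?_)
  exact star_star _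

theorem coef10_conj (φ : Form01 n M) (e : OpenPartialHomeomorph M (Cn n)) (α : Fin n) :
    coef10 φ.conj.toRaw e α = fun q => star (coef01 φ.toRaw e α q) := by
  funext q
  unfold coef10 coef01
  split_ifs with h
  · rfl
  · exact star_zero ℂ |>.symm

theorem star_gInvAt (p : PTM n M) (α β : Fin n) : star (gInvAt F p α β) = gInvAt F p β α :=
  (isLocalMetric F (chart_mem_atlas (Cn n) p.base)).star_gInv (coord_mem p) α β

theorem inner10_conj (φ ψ : Form01 n M) (p : PTM n M) :
    inner10 F φ.conj.toRaw ψ.conj.toRaw p = star (inner01 F φ.toRaw ψ.toRaw p) := by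
  simp only [inner10, inner01, star_sum, star_mul', star_star, star_gInvAt, Form01.conj_apply]

/-- The minus sign in ∂̄_H compensates the sign from conjugating the factor −i of the trace against
ω_H. Hence each statement about ∂̄_H^*ω_H is the conjugate of one about ∂_H^*ω_H. -/
theorem inner11_delbarH_conj (ψ : Form01 n M) (p : PTM n M) :
    inner11 F (delbarH F ψ.conj) (omegaH F) p =
      star (inner11 F (delH F ψ) (omegaH F) p) := by
  rw [inner11_delH, inner11_omegaH, star_mul', star_sum, Finset.sum_comm, star_neg]
  simp only [delbarH, sesq_frame, act_horBar, coef10_conj, dAnti_star, star_sum, star_mul',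
    star_gInvAt, mul_neg, Finset.sum_neg_distrib]
  have : star Complex.I = -Complex.I := Complex.conj_I
  rw [this]
  ring

theorem isDelbarAdjoint_conj {φ : Form01 n M} (h : IsDelAdjoint F (omegaH F) φ) :
    IsDelbarAdjoint F (omegaH F) φ.conj := by
  intro ψ
  have h1 := h ψ.conj
  have h2 := congrArg (starRingEnd ℂ) h1
  rw [← integral_conj, ← integral_conj] at h2
  rw [← ψ.conj_conj]
  simp only [inner11_delbarH_conj, inner10_conj]
  exact h2

theorem isDelAdjoint_conj {φ : Form10 n M} (h : IsDelbarAdjoint F (omegaH F) φ) :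
    IsDelAdjoint F (omegaH F) φ.conj := by
  intro ψ
  have h1 := h ψ.conj
  rw [← φ.conj_conj] at h1
  simp only [inner11_delbarH_conj, inner10_conj] at h1
  have h2 := congrArg (starRingEnd ℂ) h1
  simp only [← starRingEnd_apply] at h2
  rw [← integral_conj, ← integral_conj] at h2
  simpa only [starRingEnd_self_apply] using h2

/-! ### The torsion form -/

/-- The form `i conj(T_δ) dz̄^δ`, before its smoothness is known. -/
def torsRaw : Raw01 n M := fun p =>
  { toFun := fun X => ∑ δ, Complex.I * star (tors (F.locAt p) δ (coord p)) * star (comp p.base X δ)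
    map_add' := fun X Y => by simp [mul_add, Finset.sum_add_distrib]
    map_smul' := fun c X => by
      simp only [map_smul, Pi.smul_apply, smul_eq_mul, star_mul', Finset.mul_sum]
      exact Finset.sum_congr rfl fun _ _ => by simp only [starRingEnd_apply]; ring }

/-- The form is defined pointwise through preferred charts and chosen vectors; covariance of T gives
it the expected expression, and hence smoothness, in every chart. -/
theorem coef01_torsRaw (he : e ∈ atlas (Cn n) M) (β : Fin n) {q : Pn n} (hq : q ∈ slit e.target) :
    coef01 (torsRaw F) e β q = Complex.I * star (tors (F.loc e) β q) := by
  have h : vec e q.1 q.2 ≠ 0 := vec_ne_zero he hq.1 hq.2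
  obtain ⟨ζ, hζ, hco⟩ := coord_linePoint he hq h
  have he' := chart_mem_atlas (Cn n) (e.symm q.1)
  rw [(isChange_transition F he he' hζ).tors_eq (isLocalMetric F he) (isLocalMetric F he')
    (fun z hz => hz.1) (slit_transitionDomain hq) β, coef01_eq _ h, star_sum, Finset.mul_sum]
  change ∑ δ, Complex.I * star (tors _ δ (coord (linePoint e q.1 q.2 h))) *
    star (comp (e.symm q.1) (vec e q.1 (unit β)) δ) = _
  refine Finset.sum_congr rfl fun δ _ => ?_
  rw [hco, comp_apply, vec_eq he hq.1, star_mul', mul_assoc, mul_comm (star (jac _ _ _ _))]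
  rfl

/-- The form `i conj(T_δ) dz̄^δ`. -/
def torsForm : Form01 n M where
  toRaw := torsRaw F
  smooth _ he β := ((contDiffOn_const (c := Complex.I)).mul
    ((isLocalMetric F he).contDiffOn_tors β).star').congr fun _ hq => coef01_torsRaw F he β hq

theorem coef01_torsForm (he : e ∈ atlas (Cn n) M) (β : Fin n) {q : Pn n} (hq : q ∈ slit e.target) :
    coef01 (torsForm F).toRaw e β q = Complex.I * star (tors (F.loc e) β q) :=
  coef01_torsRaw F he β hq

/-! ### Linear operations on forms -/

instance : Sub (Form01 n M) :=
  ⟨fun φ ψ => ⟨φ.toRaw - ψ.toRaw, fun e he β => by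
    refine ((φ.smooth e he β).sub (ψ.smooth e he β)).congr fun q hq => ?_
    have h : vec e q.1 q.2 ≠ 0 := vec_ne_zero he hq.1 hq.2
    rw [coef01_eq _ h, coef01_eq _ h, coef01_eq _ h]
    rfl⟩⟩

/-- The product of a form with a function on the base. -/
def Form01.mulBase (ψ : Form01 n M) (ρ : M → ℝ)
    (hρ : ∀ e ∈ atlas (Cn n) M, ContDiffOn ℝ ∞ (fun z => ρ (e.symm z)) e.target) :
    Form01 n M where
  toRaw p := (ρ p.base : ℂ) • ψ.toRaw p
  smooth e he β := by
    have h1 : ContDiffOn ℝ ∞ (fun q : Pn n => (ρ (e.symm q.1) : ℂ)) (e.target ×ˢ {0}ᶜ) :=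
      Complex.ofRealCLM.contDiff.comp_contDiffOn
        ((hρ e he).comp contDiff_fst.contDiffOn fun q hq => hq.1)
    refine (h1.mul (ψ.smooth e he β)).congr fun q hq => ?_
    have h : vec e q.1 q.2 ≠ 0 := vec_ne_zero he hq.1 hq.2
    rw [coef01_eq _ h, coef01_eq _ h]
    rfl

theorem coef01_mulBase (ψ : Form01 n M) (ρ : M → ℝ)
    (hρ : ∀ e ∈ atlas (Cn n) M, ContDiffOn ℝ ∞ (fun z => ρ (e.symm z)) e.target)
    (e : OpenPartialHomeomorph M (Cn n)) (β : Fin n) (q : Pn n) :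
    coef01 (ψ.mulBase ρ hρ).toRaw e β q = ρ (e.symm q.1) * coef01 ψ.toRaw e β q := by
  unfold coef01
  split_ifs
  · rfl
  · rw [mul_zero]

end Forms

end ComplexFinsler

namespace ComplexFinsler

/-! ### The formal adjoints and the curvature -/

section Adjoint

variable {n : ℕ} {M : Type*} [TopologicalSpace M] [ChartedSpace (Cn n) M]
  [IsManifold 𝓘(ℂ, Cn n) ω M] {e : OpenPartialHomeomorph M (Cn n)} (F : FinslerMetric n M)

theorem raw01_eq_zero (φ : Raw01 n M) (p : PTM n M) (h : ∀ β, φ p (frame p.base β) = 0) :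
    φ p = 0 := by
  refine LinearMap.ext fun X => ?_
  have h1 := raw01_sum φ p (LinearMap.id : Cn n →ₗ[ℂ] Cn n) X
  refine h1.trans (Finset.sum_eq_zero fun τ _ => mul_eq_zero_of_right _ ?_)
  have h2 : φ p ((LinearMap.id : Cn n →ₗ[ℂ] Cn n) (unit τ)) = φ p (frame p.base τ) :=
    raw01_congr φ rfl (frame_eq p.base τ).symm
  exact h2.trans (h τ)

/-- The value is the quadratic form of the positive definite matrix G⁻¹ on the conjugated
coefficients. -/
theorem inner01_self (φ : Raw01 n M) (p : PTM n M) :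
    0 ≤ inner01 F φ φ p ∧ (inner01 F φ φ p = 0 → φ p = 0) := by
  have hg : IsLocalMetric (chartAt (Cn n) p.base).target (F.locAt p) :=
    isLocalMetric F (chart_mem_atlas (Cn n) p.base)
  have hpd := (hg.posDef _ (coord_mem p)).inv
  set y : Fin n → ℂ := fun β => star (φ p (frame p.base β)) with hy
  have hin : inner01 F φ φ p = star y ⬝ᵥ ((levi (F.locAt p) (coord p))⁻¹.mulVec y) := by
    simp only [inner01, dotProduct, Matrix.mulVec, Finset.mul_sum, hy, Pi.star_apply, star_star]
    exact Finset.sum_congr rfl fun _ _ => Finset.sum_congr rfl fun _ _ => by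
      rw [mul_assoc]; rfl
  rw [hin]
  by_cases h0 : y = 0
  · refine ⟨by rw [h0]; simp, fun _ => raw01_eq_zero φ p fun β => ?_⟩
    have := congrFun h0 β
    simpa [hy] using this
  · have hpos := hpd.dotProduct_mulVec_pos h0
    exact ⟨hpos.le, fun h => absurd h hpos.ne'⟩

theorem inner01_mulBase (ψ φ : Form01 n M) (ρ : M → ℝ)
    (hρ : ∀ e ∈ atlas (Cn n) M, ContDiffOn ℝ ∞ (fun z => ρ (e.symm z)) e.target) (p : PTM n M) :
    inner01 F (ψ.mulBase ρ hρ).toRaw φ.toRaw p = ρ p.base * inner01 F ψ.toRaw φ.toRaw p := by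
  simp only [inner01, Finset.mul_sum]
  refine Finset.sum_congr rfl fun β _ => Finset.sum_congr rfl fun δ _ => ?_
  change (ρ p.base * ψ.toRaw p (frame p.base β)) * _ * _ = _
  ring

theorem inner01_sub_right (φ φ' ψ : Raw01 n M) (p : PTM n M) :
    inner01 F ψ (φ - φ') p = inner01 F ψ φ p - inner01 F ψ φ' p := by
  simp only [inner01, ← Finset.sum_sub_distrib]
  refine Finset.sum_congr rfl fun β _ => Finset.sum_congr rfl fun δ _ => ?_
  change _ * _ * star (φ p _ - φ' p _) = _
  rw [star_sub]
  ring

theorem coord_fst_symm (p : PTM n M) : (chartAt (Cn n) p.base).symm (coord p).1 = p.base := by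
  rw [coord_eq]
  exact (chartAt (Cn n) p.base).left_inv (mem_chart_source _ _)

/-! ### Cutting forms by a partition of unity. -/

section Partition

variable (P : ChartPartition n M)

/-- The product of a form with a member of a partition of unity. -/
def ChartPartition.cut (j : M) (ψ : Form01 n M) : Form01 n M :=
  ψ.mulBase (P.toFun j) fun e he => P.smooth e he j

/-- The derivatives of the cut-offs are not zero individually, but ∂_H is additive and the cut forms
sum to the original one. -/
theorem inner11_delH_eq_sum (ψ : Form01 n M) (p : PTM n M) :
    inner11 F (delH F ψ) (omegaH F) p =
      ∑ j ∈ P.index, inner11 F (delH F (P.cut j ψ)) (omegaH F) p := by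
  have he := chart_mem_atlas (Cn n) p.base
  have hg : IsLocalMetric (chartAt (Cn n) p.base).target (F.locAt p) := isLocalMetric F he
  simp only [inner11_delH]
  rw [← Finset.mul_sum, Finset.sum_comm (s := P.index)]
  congr 1
  refine Finset.sum_congr rfl fun α _ => ?_
  rw [Finset.sum_comm (s := P.index)]
  refine Finset.sum_congr rfl fun β _ => ?_
  have hsum := dHol_sum (s := P.index) (u := horVec (F.locAt p) α (coord p))
    (f := fun j => coef01 (P.cut j ψ).toRaw (chartAt (Cn n) p.base) β) fun j _ =>
      hg.differentiableAt ((P.cut j ψ).smooth _ he β) (coord_mem p)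
  rw [← Finset.mul_sum, ← hsum]
  congr 2
  funext q
  simp only [ChartPartition.cut, coef01_mulBase]
  rw [← Finset.sum_mul, ← Complex.ofReal_sum, P.sum_eq_one, Complex.ofReal_one, one_mul]

theorem inner01_eq_sum (ψ φ : Form01 n M) (p : PTM n M) :
    inner01 F ψ.toRaw φ.toRaw p = ∑ j ∈ P.index, inner01 F (P.cut j ψ).toRaw φ.toRaw p := by
  simp only [ChartPartition.cut, inner01_mulBase]
  rw [← Finset.sum_mul, ← Complex.ofReal_sum, P.sum_eq_one, Complex.ofReal_one, one_mul]

/-- A derivative is involved, so the cut-off must vanish near the base point; this is why its closed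
support has to lie in the chart domain. -/
theorem inner11_delH_cut_eq_zero (j : M) (ψ : Form01 n M) {p : PTM n M}
    (hp : p ∉ overSource (chartAt (Cn n) j)) :
    inner11 F (delH F (P.cut j ψ)) (omegaH F) p = 0 := by
  rw [inner11_delH]
  have h0 : ∀ β, coef01 (P.cut j ψ).toRaw (chartAt (Cn n) p.base) β =ᶠ[nhds (coord p)]
      fun _ => 0 := by
    intro β
    have hc : ContinuousAt (fun q : Pn n => (chartAt (Cn n) p.base).symm q.1) (coord p) :=
      ContinuousAt.comp (f := Prod.fst)
        ((chartAt (Cn n) p.base).continuousAt_symm (coord_mem p).1) continuousAt_fst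
    have hm : (tsupport (P.toFun j))ᶜ ∈ nhds ((chartAt (Cn n) p.base).symm (coord p).1) := by
      rw [coord_fst_symm]
      exact (isClosed_tsupport _).isOpen_compl.mem_nhds fun h => hp (P.tsupport_subset j h)
    filter_upwards [hc hm] with q hq
    rw [ChartPartition.cut, coef01_mulBase, image_eq_zero_of_notMem_tsupport hq,
      Complex.ofReal_zero, zero_mul]
  simp only [dHol_congr (h0 _), dHol_const, mul_zero, Finset.sum_const_zero]

theorem inner01_cut_eq_zero (j : M) (ψ φ : Form01 n M) {p : PTM n M}
    (hp : p ∉ overSource (chartAt (Cn n) j)) :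
    inner01 F (P.cut j ψ).toRaw φ.toRaw p = 0 := by
  rw [ChartPartition.cut, inner01_mulBase, P.eq_zero j hp, Complex.ofReal_zero, zero_mul]

variable [NeZero n] [T2Space M] [CompactSpace M]

/-- The local divergence theorem. Pairing with i conj(T) conjugates it to −iT, so −i is a common
factor of both terms. -/
theorem integral_cut (j : M) (ψ : Form01 n M) :
    ∫ p, (inner11 F (delH F (P.cut j ψ)) (omegaH F) p -
      inner01 F (P.cut j ψ).toRaw (torsForm F).toRaw p) ∂(volPTM F) = 0 := by
  set e := chartAt (Cn n) j with hedef
  have he : e ∈ atlas (Cn n) M := chart_mem_atlas _ _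
  have hg := isLocalMetric F he
  obtain ⟨K, hKU, hK, hK0⟩ := P.exists_compact j
  have hc : Continuous fun p => inner11 F (delH F (P.cut j ψ)) (omegaH F) p -
      inner01 F (P.cut j ψ).toRaw (torsForm F).toRaw p :=
    (continuous_inner11_delH F (P.cut j ψ)).sub (continuous_inner01 F (P.cut j ψ) (torsForm F))
  rw [integral_volPTM_of_local F he hc fun p hp => by
    rw [inner11_delH_cut_eq_zero F P j ψ hp, inner01_cut_eq_zero F P j ψ _ hp, sub_zero]]
  have h := hg.setIntegral_dual hK hKU (fun β => (P.cut j ψ).smooth e he β) fun β q hq hqK => by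
    rw [ChartPartition.cut, coef01_mulBase, hK0 q.1 hq.1 hqK, Complex.ofReal_zero, zero_mul]
  have h2 : ∫ q in slit e.target, (inner11 F (delH F (P.cut j ψ)) (omegaH F) (slitParam e q) -
      inner01 F (P.cut j ψ).toRaw (torsForm F).toRaw (slitParam e q)) * slitDensity (F.loc e) q =
      ∫ q in slit e.target, -Complex.I * ((∑ α, ∑ β, gInv (F.loc e) q β α *
        dHol (coef01 (P.cut j ψ).toRaw e β) q (horVec (F.loc e) α q) -
        ∑ α, ∑ β, gInv (F.loc e) q β α * (coef01 (P.cut j ψ).toRaw e β q * tors (F.loc e) α q)) *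
          slitDensity (F.loc e) q) := by
    refine setIntegral_congr_fun (measurableSet_slit e) fun q hq => ?_
    rw [slitParam_eq he hq, inner11_delH_linePoint F he _ hq, inner01_linePoint F he _ _ hq,
      ← mul_assoc, mul_sub]
    congr 2
    rw [Finset.mul_sum]
    refine Finset.sum_congr rfl fun α _ => ?_
    rw [Finset.mul_sum]
    refine Finset.sum_congr rfl fun β _ => ?_
    rw [coef01_torsForm F he α hq, star_mul', star_star]
    have : star Complex.I = -Complex.I := Complex.conj_I
    rw [this]
    ring
  rw [h2, integral_const_mul, h, mul_zero, smul_zero]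

end Partition

variable [NeZero n] [T2Space M] [CompactSpace M]

theorem isDelAdjoint_torsForm : IsDelAdjoint F (omegaH F) (torsForm F) := by
  intro ψ
  obtain ⟨P⟩ := nonempty_chartPartition (n := n) (M := M)
  have hi1 := fun ψ => integrable_volPTM F (continuous_inner11_delH F ψ)
  have hi2 := fun ψ => integrable_volPTM F (continuous_inner01 F ψ (torsForm F))
  rw [← sub_eq_zero, ← integral_sub (hi1 ψ) (hi2 ψ)]
  have h : ∀ p, inner11 F (delH F ψ) (omegaH F) p - inner01 F ψ.toRaw (torsForm F).toRaw p =
      ∑ j ∈ P.index, (inner11 F (delH F (P.cut j ψ)) (omegaH F) p -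
        inner01 F (P.cut j ψ).toRaw (torsForm F).toRaw p) := by
    intro p
    rw [inner11_delH_eq_sum F P, inner01_eq_sum F P, Finset.sum_sub_distrib]
  simp only [h]
  rw [integral_finsetSum (f := fun j p => inner11 F (delH F (P.cut j ψ)) (omegaH F) p -
    inner01 F (P.cut j ψ).toRaw (torsForm F).toRaw p) _ fun j _ => (hi1 _).sub (hi2 _)]
  exact Finset.sum_eq_zero fun j _ => integral_cut F P j ψ

theorem eq_zero_of_integral_inner01 {φ : Form01 n M}
    (h : ∫ p, inner01 F φ.toRaw φ.toRaw p ∂(volPTM F) = 0) (p : PTM n M) : φ.toRaw p = 0 := by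
  have h1 := fun p => Complex.le_def.1 (inner01_self F φ.toRaw p).1
  have h2 := eq_zero_of_integral_volPTM F (continuous_inner01 F φ φ) (fun p => (h1 p).1)
    (fun p => (h1 p).2.symm) h
  exact (inner01_self F φ.toRaw p).2 (congrFun h2 p)

/-- Testing both candidates on their difference shows that its norm is zero. -/
theorem IsDelAdjoint.eq {η : Raw11 n M} {φ φ' : Form01 n M} (h : IsDelAdjoint F η φ)
    (h' : IsDelAdjoint F η φ') : φ = φ' := by
  have h1 := (h (φ - φ')).symm.trans (h' (φ - φ'))
  rw [← sub_eq_zero, ← integral_sub (integrable_volPTM F (continuous_inner01 F _ _))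
    (integrable_volPTM F (continuous_inner01 F _ _))] at h1
  have h2 := eq_zero_of_integral_inner01 F (φ := φ - φ') (by
    rw [← h1]
    refine integral_congr_ae (Filter.Eventually.of_forall fun p => ?_)
    exact inner01_sub_right F _ _ _ p)
  refine Form01.ext (funext fun p => ?_)
  exact sub_eq_zero.1 (h2 p)

theorem existsUnique_isDelAdjoint : ∃! φ : Form01 n M, IsDelAdjoint F (omegaH F) φ :=
  ⟨torsForm F, isDelAdjoint_torsForm F, fun _ h => h.eq F (isDelAdjoint_torsForm F)⟩

theorem IsDelbarAdjoint.eq {φ : Form10 n M} (h : IsDelbarAdjoint F (omegaH F) φ) :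
    φ = (torsForm F).conj := by
  rw [← φ.conj_conj, (isDelAdjoint_conj F h).eq F (isDelAdjoint_torsForm F)]

theorem existsUnique_isDelbarAdjoint : ∃! φ : Form10 n M, IsDelbarAdjoint F (omegaH F) φ :=
  ⟨(torsForm F).conj, isDelbarAdjoint_conj F (isDelAdjoint_torsForm F), fun _ h => h.eq F⟩

theorem delStar_omegaH : delStar F (omegaH F) = torsForm F :=
  (Classical.epsilon_spec (p := IsDelAdjoint F (omegaH F)) ⟨_, isDelAdjoint_torsForm F⟩).eq F
    (isDelAdjoint_torsForm F)

theorem delbarStar_omegaH : delbarStar F (omegaH F) = (torsForm F).conj :=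
  (Classical.epsilon_spec (p := IsDelbarAdjoint F (omegaH F))
    ⟨_, isDelbarAdjoint_conj F (isDelAdjoint_torsForm F)⟩).eq F

end Adjoint

/-! ### The curvature identities and the equivalence of the three conditions. -/

section Curvature

variable {n : ℕ} {M : Type*} [TopologicalSpace M] [ChartedSpace (Cn n) M]
  [IsManifold 𝓘(ℂ, Cn n) ω M] {e : OpenPartialHomeomorph M (Cn n)} (F : FinslerMetric n M)

/-- In the local difference formula, i conj(T_ν) is a coefficient of the torsion form and −iT_μ one
of its conjugate, so the sum acquires the minus sign that ∂̄_H carries. -/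
theorem ricciCoef_sub_torsForm (p : PTM n M) (μ ν : Fin n) :
    Complex.I * ricciCoef (F.locAt p) (chernFinsler (F.locAt p)) μ ν (coord p) -
      Complex.I * ricciCoef (F.locAt p) (canonical (F.locAt p)) μ ν (coord p) =
    (1 / 2) * (act (hor (F.locAt p) μ) (coef01 (torsForm F).toRaw (chartAt (Cn n) p.base) ν)
        (coord p) -
      act (horBar (F.locAt p) ν) (coef10 (torsForm F).conj.toRaw (chartAt (Cn n) p.base) μ)
        (coord p)) := by
  have he := chart_mem_atlas (Cn n) p.base
  have hg : IsLocalMetric (chartAt (Cn n) p.base).target (F.locAt p) := isLocalMetric F he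
  have hq := coord_mem p
  have hd : ∀ α, DifferentiableAt ℝ (fun r => star (tors (F.locAt p) α r)) (coord p) := fun α =>
    hg.differentiableAt (hg.contDiffOn_tors α).star' hq
  have h1 : ∀ X, dHol (coef01 (torsForm F).toRaw (chartAt (Cn n) p.base) ν) (coord p) X =
      Complex.I * dHol (fun r => star (tors (F.locAt p) ν r)) (coord p) X := fun X => by
    rw [dHol_congr_on hg.isOpen_slit hq fun r hr => coef01_torsForm F he ν hr]
    exact dHol_const_mul _ (hd ν)
  have h2 : ∀ X, dHol (coef01 (torsForm F).toRaw (chartAt (Cn n) p.base) μ) (coord p) X =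
      Complex.I * dHol (fun r => star (tors (F.locAt p) μ r)) (coord p) X := fun X => by
    rw [dHol_congr_on hg.isOpen_slit hq fun r hr => coef01_torsForm F he μ hr]
    exact dHol_const_mul _ (hd μ)
  rw [← mul_sub, hg.ricciCoef_sub hq, act_hor, act_horBar, coef10_conj, dAnti_star, h1, h2,
    dHol_star (tors (F.locAt p) μ), star_mul', star_star]
  have : star Complex.I = -Complex.I := Complex.conj_I
  rw [this]
  ring

theorem ricD_sub_ricNabla : ricD F - ricNabla F =
    (1 / 2 : ℂ) • (delH F (torsForm F) + delbarH F (torsForm F).conj) := by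
  funext p
  refine LinearMap.ext fun X => LinearMap.ext fun Y => ?_
  change (∑ α, ∑ β, _ * _ * _) - (∑ α, ∑ β, _ * _ * _) =
    (1 / 2 : ℂ) * ((∑ α, ∑ β, _ * _ * _) + (∑ α, ∑ β, _ * _ * _))
  simp only [← Finset.sum_sub_distrib, ← Finset.sum_add_distrib, Finset.mul_sum]
  refine Finset.sum_congr rfl fun α _ => Finset.sum_congr rfl fun β _ => ?_
  have h := ricciCoef_sub_torsForm F p α β
  linear_combination (comp p.base X α * star (comp p.base Y β)) * h

theorem scalD_sub_scalNabla (p : PTM n M) : scalD F p - scalNabla F p =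
    (1 / 2) * inner11 F (delH F (torsForm F) + delbarH F (torsForm F).conj) (omegaH F) p := by
  have h : ∀ α β, (delH F (torsForm F) + delbarH F (torsForm F).conj) p (frame p.base α)
      (frame p.base β) = 2 * Complex.I *
        (ricciCoef (F.locAt p) (chernFinsler (F.locAt p)) α β (coord p) -
          ricciCoef (F.locAt p) (canonical (F.locAt p)) α β (coord p)) := by
    intro α β
    have h1 := ricciCoef_sub_torsForm F p α β
    change delH F (torsForm F) p (frame p.base α) (frame p.base β) +
      delbarH F (torsForm F).conj p (frame p.base α) (frame p.base β) = _
    rw [delH, delbarH, sesq_frame, sesq_frame]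
    linear_combination -2 * h1
  rw [inner11_omegaH]
  simp only [h, scalD, scalNabla, scalarCoef, Finset.mul_sum, ← Finset.sum_sub_distrib]
  refine Finset.sum_congr rfl fun α _ => Finset.sum_congr rfl fun β _ => ?_
  rw [gInvAt]
  linear_combination ((gInv (F.locAt p) (coord p) β α *
    (ricciCoef (F.locAt p) (chernFinsler (F.locAt p)) α β (coord p) -
      ricciCoef (F.locAt p) (canonical (F.locAt p)) α β (coord p)))) * Complex.I_mul_I

theorem inner11_add_left (η η' ψ : Raw11 n M) (p : PTM n M) :
    inner11 F (η + η') ψ p = inner11 F η ψ p + inner11 F η' ψ p := by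
  simp only [inner11, ← Finset.sum_add_distrib]
  refine Finset.sum_congr rfl fun _ _ => Finset.sum_congr rfl fun _ _ =>
    Finset.sum_congr rfl fun _ _ => Finset.sum_congr rfl fun _ _ => ?_
  change (η p _ _ + η' p _ _) * _ * _ * _ = _
  ring

theorem scalD_sub_scalNabla_eq (p : PTM n M) : scalD F p - scalNabla F p =
    (1 / 2) * (inner11 F (delH F (torsForm F)) (omegaH F) p +
      star (inner11 F (delH F (torsForm F)) (omegaH F) p)) := by
  rw [scalD_sub_scalNabla, inner11_add_left, inner11_delbarH_conj]

/-- The contraction is chart independent because the Ricci tensor of D is minus the Levi form of log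
det G on horizontal vectors, which is covariant. The purpose is continuity. -/
theorem scalD_linePoint (he : e ∈ atlas (Cn n) M) {q : Pn n} (hq : q ∈ slit e.target)
    (h : vec e q.1 q.2 ≠ 0) :
    scalD F (linePoint e q.1 q.2 h) = scalarCoef (F.loc e) (chernFinsler (F.loc e)) q := by
  have he' := chart_mem_atlas (Cn n) (e.symm q.1)
  have hg := isLocalMetric F he
  refine contraction_linePoint F he hq h
    (fun α β => ricciCoef (F.loc e) (chernFinsler (F.loc e)) α β q)
    (fun r α β => ricciCoef (F.loc (chartAt (Cn n) (e.symm q.1)))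
      (chernFinsler (F.loc (chartAt (Cn n) (e.symm q.1)))) α β r) fun ζ hζ α β => ?_
  have hg' := isLocalMetric F he'
  have hc := isChange_transition F he he' hζ
  have hqt := slit_transitionDomain hq
  have h1 := hc.levi_logDet_eq hg hg' (fun z hz => hz.1) hqt α β
  rw [hg.ricciCoef_chernFinsler hq, h1, ← Finset.sum_neg_distrib]
  refine Finset.sum_congr rfl fun σ _ => ?_
  rw [← Finset.sum_neg_distrib]
  refine Finset.sum_congr rfl fun τ _ => ?_
  rw [hg'.ricciCoef_chernFinsler (hc.lift_mem hqt)]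
  ring

theorem IsLocalMetric.continuousOn_scalarCoef {U : Set (Cn n)} {g : Pn n → ℝ}
    (hg : IsLocalMetric U g) : ContinuousOn (scalarCoef g (chernFinsler g)) (slit U) := by
  refine continuousOn_finsetSum _ fun μ _ => continuousOn_finsetSum _ fun ν _ =>
    (hg.contDiffOn_gInv ν μ).continuousOn.mul ?_
  refine ContinuousOn.congr ?_ fun q hq => hg.ricciCoef_chernFinsler' hq μ ν
  refine ContinuousOn.sub ((hg.contDiffOn_dAnti_horVec ?_ ν).continuousOn.neg) ?_
  · exact ContDiffOn.sum fun α _ => ContDiffOn.sum fun l _ =>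
      (hg.contDiffOn_gInv l α).mul (hg.contDiffOn_dHol_horVec (hg.contDiffOn_gCoef α l) μ)
  · refine continuousOn_finsetSum _ fun α _ => continuousOn_finsetSum _ fun l _ =>
      (hg.contDiffOn_gInv l α).continuousOn.mul ?_
    refine ContinuousOn.congr ?_ fun q _ => dHol_fibre _ _ _
    exact continuousOn_finsetSum _ fun γ _ =>
      (hg.contDiffOn_dAnti_horVec (hg.contDiffOn_nonlin γ μ) ν).continuousOn.mul
        (contDiffOn_dHol hg.isOpen_slit (hg.contDiffOn_gCoef α l) _).continuousOn

theorem continuous_scalD : Continuous (scalD F) :=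
  continuous_of_local (fe := fun e => scalarCoef (F.loc e) (chernFinsler (F.loc e)))
    (fun _ he => (isLocalMetric F he).continuousOn_scalarCoef)
    fun _ he _ hq h => scalD_linePoint F he hq h

/-- Deduced from the continuity of s_D and the difference formula, so the canonical connection need
not be transformed between charts. -/
theorem continuous_scalNabla : Continuous (scalNabla F) := by
  have h : scalNabla F = fun p => scalD F p - (1 / 2) *
      (inner11 F (delH F (torsForm F)) (omegaH F) p +
        star (inner11 F (delH F (torsForm F)) (omegaH F) p)) := by
    funext p
    rw [← scalD_sub_scalNabla_eq]
    ring
  rw [h]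
  have hc := continuous_inner11_delH F (torsForm F)
  exact (continuous_scalD F).sub (continuous_const.mul (hc.add hc.star))

/-- Replacing X by iX multiplies the (1,0)-part by i and the (0,1)-part by −i, which separates the
two. -/
theorem torsForm_eq_zero_of_add {p : PTM n M} (h : ∀ X, (torsForm F).toRaw p X +
    (torsForm F).conj.toRaw p X = 0) : (torsForm F).toRaw p = 0 := by
  refine LinearMap.ext fun X => ?_
  have h1 := h X
  have h2 := h (Complex.I • X)
  rw [map_smulₛₗ, map_smul, Complex.conj_I, smul_eq_mul, smul_eq_mul] at h2
  change _ = (0 : ℂ)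
  have h3 : Complex.I * Complex.I = -1 := Complex.I_mul_I
  linear_combination (1 / 2) * h1 + (Complex.I / 2) * h2 + (1 / 2) *
    ((torsForm F).toRaw p X - (torsForm F).conj.toRaw p X) * h3

theorem scalD_eq_of_ricD_eq (h : ricD F = ricNabla F) (p : PTM n M) :
    scalD F p = scalNabla F p := by
  unfold scalD scalNabla scalarCoef
  refine Finset.sum_congr rfl fun μ _ => Finset.sum_congr rfl fun ν _ => ?_
  have h1 : ricD F p (frame p.base μ) (frame p.base ν) =
      ricNabla F p (frame p.base μ) (frame p.base ν) := by rw [h]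
  rw [ricD, ricNabla, sesq_frame, sesq_frame] at h1
  rw [mul_left_cancel₀ Complex.I_ne_zero h1]

theorem ricD_eq_of_torsForm_eq_zero (h0 : ∀ p, (torsForm F).toRaw p = 0) :
    ricD F = ricNabla F := by
  have hc : ∀ e β, coef01 (torsForm F).toRaw e β = fun _ => 0 := by
    intro e β
    funext q
    unfold coef01
    split_ifs
    · rw [h0]; rfl
    · rfl
  funext p
  have hz : ∀ μ ν, Complex.I * ricciCoef (F.locAt p) (chernFinsler (F.locAt p)) μ ν (coord p) =
      Complex.I * ricciCoef (F.locAt p) (canonical (F.locAt p)) μ ν (coord p) := by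
    intro μ ν
    rw [← sub_eq_zero, ricciCoef_sub_torsForm, act_hor, act_horBar, coef10_conj, dAnti_star,
      hc, hc, dHol_const, dHol_const, star_zero, sub_zero, mul_zero]
  simp only [ricD, ricNabla, hz]

variable [NeZero n] [T2Space M] [CompactSpace M]

theorem tfae_balanced : [IsBalanced F, ricD F = ricNabla F,
    ∫ p, scalD F p ∂(volPTM F) = ∫ p, scalNabla F p ∂(volPTM F)].TFAE := by
  tfae_have 1 → 2 := by
    intro h
    have h0 : ∀ p, (torsForm F).toRaw p = 0 := fun p => torsForm_eq_zero_of_add F fun X => by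
      have := h p X
      rwa [delStar_omegaH, delbarStar_omegaH] at this
    exact ricD_eq_of_torsForm_eq_zero F h0
  tfae_have 2 → 3 := by
    intro h
    rw [show scalD F = scalNabla F from funext fun p => scalD_eq_of_ricD_eq F h p]
  tfae_have 3 → 1 := by
    intro h
    have hi := integrable_volPTM F (continuous_inner11_delH F (torsForm F))
    rw [← sub_eq_zero, ← integral_sub (integrable_volPTM F (continuous_scalD F))
      (integrable_volPTM F (continuous_scalNabla F))] at h
    simp only [scalD_sub_scalNabla_eq] at h
    rw [integral_const_mul, integral_add hi ((integrable_volPTM F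
      (continuous_inner11_delH F (torsForm F)).star))] at h
    -- Adjointness with the torsion form itself as test form: the integral of ⟨∂_H∂_H^*ω_H, ω_H⟩ is
    -- ‖∂_H^*ω_H‖², which is real. Hence both halves of the integrated difference are equal and must
    -- vanish.
    have h1 := isDelAdjoint_torsForm F (torsForm F)
    have h2 : ∫ p, star (inner11 F (delH F (torsForm F)) (omegaH F) p) ∂(volPTM F) =
        ∫ p, inner01 F (torsForm F).toRaw (torsForm F).toRaw p ∂(volPTM F) := by
      refine (integral_conj (f := inner11 F (delH F (torsForm F)) (omegaH F))).trans ?_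
      rw [h1, ← integral_conj]
      refine integral_congr_ae (Filter.Eventually.of_forall fun p => ?_)
      exact Complex.conj_eq_iff_im.2 (Complex.le_def.1 (inner01_self F _ p).1).2.symm
    rw [h2, h1] at h
    have h3 := eq_zero_of_integral_inner01 F (φ := torsForm F) (by linear_combination h)
    intro p X
    rw [delStar_omegaH, delbarStar_omegaH, Form01.conj_apply, h3 p]
    simp
  tfae_finish

end Curvature

end ComplexFinsler

end

open ComplexFinsler
theorem theorem1p2 {n : ℕ} (hn : 2 ≤ n) {M : Type*} [TopologicalSpace M] [T2Space M]
    [CompactSpace M] [ChartedSpace (Cn n) M] [IsManifold 𝓘(ℂ, Cn n) ω M]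
    (F : FinslerMetric n M) :
    (∃! φ : Form01 n M, IsDelAdjoint F (omegaH F) φ) ∧
    (∃! φ : Form10 n M, IsDelbarAdjoint F (omegaH F) φ) ∧
    ricD F - ricNabla F =
      (1 / 2 : ℂ) • (delH F (delStar F (omegaH F)) + delbarH F (delbarStar F (omegaH F))) ∧
    (∀ p : PTM n M, scalD F p - scalNabla F p =
      (1 / 2) * inner11 F
        (delH F (delStar F (omegaH F)) + delbarH F (delbarStar F (omegaH F))) (omegaH F) p) ∧
    Integrable (scalD F) (volPTM F) ∧ Integrable (scalNabla F) (volPTM F) ∧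
    [IsBalanced F,
      ricD F = ricNabla F,
      ∫ p, scalD F p ∂(volPTM F) = ∫ p, scalNabla F p ∂(volPTM F)].TFAE := by
  -- Provides an affine index for the fibre coordinates.
  have : NeZero n := ⟨by omega⟩
  rw [delStar_omegaH, delbarStar_omegaH]
  exact ⟨existsUnique_isDelAdjoint F, existsUnique_isDelbarAdjoint F, ricD_sub_ricNabla F,
    scalD_sub_scalNabla F, integrable_volPTM F (continuous_scalD F),
    integrable_volPTM F (continuous_scalNabla F), tfae_balanced F⟩
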